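/- **Setting.** A unit has pretreatment confounders $X$, a treatment $A$ and a mediator $M$ with finitely many levels, posttreatment confounders $Z$, an outcome $Y$, and integrable potential outcomes $Y(a',m')$. Assume 1. consistency: $Y=Y(a',m')$ whenever $A=a'$, $M=m'$; 2. sequential ignorability: $Y(a',m')\perp A\mid X$ and $Y(a',m')\perp M\mid X,A,Z$ for all $a',m'$; 3. positivity: there is $\epsilon>0$ with $\Pr[A=a'\mid X]>\epsilon$ and $\Pr[M=m'\mid X,A,Z]>\epsilon$ almost surely, for all $a',m'$. Fix $(a,m)$ and put $\psi_{am}=\mathbb E[Y(a,m)]$. For every $a'$ let $\mu_y(x,a',z,m')=\mathbb E[Y\mid x,a',z,m']$, $\nu_y(x,a')=\mathbb E[\mu_y(X,a',Z,m)\mid X=x,A=a']$, $\pi_{A}(a'\mid x)=\Pr[A=a'\mid x]$, $\pi_M(m'\mid x,a',z)=\Pr[M=m'\mid x,a',z]$; the nuisance functions are $\mu_y(x,z)=\mu_y(x,a,z,m)$, $\nu_y(x)=\nu_y(x,a)$, $\pi_a(x)=\pi_A(a\mid x)$, $\pi_m(x,z)=\pi_M(m\mid x,a,z)$. Let $O_i=(X_i,A_i,Z_i,M_i,Y_i)$,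 $i=1,\dots,n$, be an i.i.d. sample, and $\mathbb P_n$ the sample mean. **Working models.** Let $\mu(x,a',z,m';\beta)$, $\nu(x,a';\eta)$, $p_A(a'\mid x;\alpha)$, $p_M(m'\mid x,a',z;\gamma)$ be measurable parametric working models with finite-dimensional parameters in sets $\Theta_\mu,\Theta_\nu,\Theta_A,\Theta_M$, and let $w_\mu,w_\nu,w_A,w_M$ be measurable vector-valued weights, which may depend on the same arguments as the respective model, with values in the respective parameter space. Fix sets $S\ni a$, $L_A\ni a$ of treatment levels and $T\ni m$, $L_M\ni m$ of mediator levels (fits within a stratum: $S=\{a\}$, $T=\{m\}$; pooled fits: all levels). The estimating functions are $$U_\mu=\mathbb I(A\in S,M\in T)\,(Y-\mu(X,A,Z,M;\beta))\,w_\mu,\qquad U_A=\sum_{l\in L_A}(\mathbb I(A=l)-p_A(l\mid X;\alpha))\,w_A(X,l;\alpha),$$ $$U_M=\mathbb I(A\in S)\sum_{l\in L_M}(\mathbb I(M=l)-p_M(l\mid X,A,Z;\gamma))\,w_M(X,A,Z,l;\gamma),\qquad U_\nu[R]=\mathbb I(A\in S)\,(R-\nu(X,A;\eta))\,w_\nu(X,A;\eta),$$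 where the response $R$ is $R_1=\mu(X,A,Z,m;\beta)$, $R_2=\mathbb I(M=m)Y/p_M(m\mid X,A,Z;\gamma)$ or $R_4=\mu(X,A,Z,m;\beta)+\frac{\mathbb I(M=m)}{p_M(m\mid X,A,Z;\gamma)}(Y-\mu(X,A,Z,m;\beta))$. A working model is *correctly specified* if for some value of its parameter in its parameter set it equals the corresponding true function almost everywhere on the cells used in its fit ($A\in S,M\in T$ for $\mu$; $A\in S$ for $\nu$; levels in $L_A$ for $p_A$; $A\in S$ and levels in $L_M$ for $p_M$). **Estimators.** Write $\mu(X,Z)=\mu(X,a,Z,m;\beta)$, $\nu(X)=\nu(X,a;\eta)$, $p_a(X)=p_A(a\mid X;\alpha)$, $p_m(X,Z)=p_M(m\mid X,a,Z;\gamma)$ and let $$\varphi_1=\nu(X)+\tfrac{\mathbb I(A=a)}{p_a(X)}(\mu(X,Z)-\nu(X)),\qquad \varphi_2=\nu(X)+\tfrac{\mathbb I(A=a)}{p_a(X)}\Big(\tfrac{\mathbb I(M=m)Y}{p_m(X,Z)}-\nu(X)\Big),$$ $$\varphi_3=\tfrac{\mathbb I(A=a)}{p_a(X)}\Big(\mu(X,Z)+\tfrac{\mathbb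 I(M=m)}{p_m(X,Z)}(Y-\mu(X,Z))\Big),\qquad \varphi_4=\nu(X).$$ For $k=1,2,3,4$ the nuisance parameter $\theta$ is $(\beta,\eta,\alpha)$, $(\gamma,\eta,\alpha)$, $(\beta,\gamma,\alpha)$, $(\beta,\gamma,\eta)$, the system $\Psi_k$ of estimating functions is $(U_\mu,U_\nu[R_1],U_A)$, $(U_M,U_\nu[R_2],U_A)$, $(U_\mu,U_M,U_A)$, $(U_\mu,U_M,U_\nu[R_4])$, and $\hat\psi^{\mathrm{dr}_k}_{am}=\mathbb P_n[\varphi_k(O;\hat\theta)]$, where $\hat\theta$ is a measurable solution of $\mathbb P_n[\Psi_k(O;\hat\theta)]=0$ up to $o_p(n^{-1/2})$. **Regularity conditions for $\hat\psi^{\mathrm{dr}_k}_{am}$.** (i) $\hat\theta$ has a probability limit $\theta^*$ (which need not be related to the truth), each block of which is interior to its parameter set. (ii) For each estimating function in $\Psi_k$, as a function of its own parameter with parameters from earlier steps at their limits, the expectation exists on the whole parameter set and vanishes there at no point other than, possibly, the respective block of $\theta^*$. (iii) On a ball around $\theta^*$, $\Psi_k(O;\cdot)$ and $\varphi_k(O;\cdot)$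 are almost surely continuously differentiable with derivatives bounded in norm by an integrable function of $O$. (iv) $\Psi_k(O;\theta^*)$ and $\varphi_k(O;\theta^*)$ have finite second moments. (v) $\mathbb E[\partial_\theta\Psi_k(O;\theta^*)]$ is nonsingular. **Claim.** For each $k$, under assumptions 1-3 and the regularity conditions for $\hat\psi^{\mathrm{dr}_k}_{am}$, the estimator is consistent and asymptotically normal (CAN): $\hat\psi^{\mathrm{dr}_k}_{am}\to\psi_{am}$ in probability and $\sqrt n(\hat\psi^{\mathrm{dr}_k}_{am}-\psi_{am})\to N(0,v_k)$ in distribution, with $$v_k=\operatorname{Var}\big[\varphi_k(O;\theta^*)-\psi_{am}-\mathbb E[\partial_\theta\varphi_k(O;\theta^*)]\,\mathbb E[\partial_\theta\Psi_k(O;\theta^*)]^{-1}\Psi_k(O;\theta^*)\big],$$ provided that 1. for $k=1$: $\mu$ is correctly specified and either $\nu$ or $p_A$ is correctly specified; 2. for $k=2$: $p_M$ is correctly specified and either $\nu$ or $p_A$ is correctly specified; 3. for $k=3$: $p_A$ is correctly specified and either $p_M$ or $\mu$ is correctly specified; 4. for $k=4$: $\nu$ is correctly specified and either $p_M$ or $\mu$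 is correctly specified. (The remaining working models may be misspecified. $N(0,0)$ denotes the point mass at $0$.) -/

import Mathlib

open MeasureTheory ProbabilityTheory Filter Topology
open scoped NNReal ENNReal

namespace CRF

/-! ### The population: observed variables and potential outcomes -/

/-- One generic unit: pretreatment confounders `X`, treatment `A`, posttreatment confounders `Z`,
mediator `M`, observed outcome `Y`, potential outcomes `Ypot a m = Y(a, m)`.  The fields other than
the variables themselves are measurability and existence of the means. -/
structure Population (Ω 𝒳 𝒜 𝒵 ℳ : Type*) [MeasurableSpace Ω] [MeasurableSpace 𝒳]
    [MeasurableSpace 𝒜] [MeasurableSpace 𝒵] [MeasurableSpace ℳ] (P : Measure Ω) where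
  X : Ω → 𝒳
  A : Ω → 𝒜
  Z : Ω → 𝒵
  M : Ω → ℳ
  Y : Ω → ℝ
  Ypot : 𝒜 → ℳ → Ω → ℝ
  measurable_X : Measurable X
  measurable_A : Measurable A
  measurable_Z : Measurable Z
  measurable_M : Measurable M
  measurable_Y : Measurable Y
  measurable_Ypot : ∀ a m, Measurable (Ypot a m)
  integrable_Ypot : ∀ a m, Integrable (Ypot a m) P

/-- Observed data of one unit, `O = (X, A, Z, M, Y)`. -/
abbrev Obs (𝒳 𝒜 𝒵 ℳ : Type*) := 𝒳 × 𝒜 × 𝒵 × ℳ × ℝ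

namespace Population

variable {Ω 𝒳 𝒜 𝒵 ℳ : Type*} [MeasurableSpace Ω] [MeasurableSpace 𝒳]
  [MeasurableSpace 𝒜] [MeasurableSpace 𝒵] [MeasurableSpace ℳ] {P : Measure Ω}

def XA (V : Population Ω 𝒳 𝒜 𝒵 ℳ P) (ω : Ω) : 𝒳 × 𝒜 := (V.X ω, V.A ω)

def XAZ (V : Population Ω 𝒳 𝒜 𝒵 ℳ P) (ω : Ω) : 𝒳 × 𝒜 × 𝒵 := (V.X ω, V.A ω, V.Z ω)

def XAZM (V : Population Ω 𝒳 𝒜 𝒵 ℳ P) (ω : Ω) : 𝒳 × 𝒜 × 𝒵 × ℳ :=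
  (V.X ω, V.A ω, V.Z ω, V.M ω)

def obs (V : Population Ω 𝒳 𝒜 𝒵 ℳ P) (ω : Ω) : Obs 𝒳 𝒜 𝒵 ℳ :=
  (V.X ω, V.A ω, V.Z ω, V.M ω, V.Y ω)

/-- The law of the observed data of one unit. -/
noncomputable def law (V : Population Ω 𝒳 𝒜 𝒵 ℳ P) : Measure (Obs 𝒳 𝒜 𝒵 ℳ) := P.map V.obs

theorem measurable_XAZ (V : Population Ω 𝒳 𝒜 𝒵 ℳ P) : Measurable V.XAZ :=
  V.measurable_X.prodMk (V.measurable_A.prodMk V.measurable_Z)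

/-- The controlled response function `ψ_am = E[Y(a, m)]`. -/
noncomputable def psi (V : Population Ω 𝒳 𝒜 𝒵 ℳ P) (a : 𝒜) (m : ℳ) : ℝ := ∫ ω, V.Ypot a m ω ∂P

/-- `E[Y | x, a', z, m']`, as a function of `(x, a', z, m')`.
At `a' = a`, `m' = m` it is `μ_y(x, z)`. -/
noncomputable def muY [IsFiniteMeasure P] (V : Population Ω 𝒳 𝒜 𝒵 ℳ P)
    (v : 𝒳 × 𝒜 × 𝒵 × ℳ) : ℝ :=
  ∫ y, y ∂(condDistrib V.Y V.XAZM P v)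

/-- `E_{Z | x, a'} E[Y | x, a', Z, m]`, as a function of `(x, a')`.
At `a' = a` it is `ν_y(x)`. -/
noncomputable def nuY [IsFiniteMeasure P] [StandardBorelSpace 𝒵] [Nonempty 𝒵]
    (V : Population Ω 𝒳 𝒜 𝒵 ℳ P) (m : ℳ) (v : 𝒳 × 𝒜) : ℝ :=
  ∫ z, V.muY (v.1, v.2, z, m) ∂(condDistrib V.Z V.XA P v)

/-- `Pr[A = a' | x]`.  At `a' = a` it is `π_a(x)`. -/
noncomputable def piA [IsFiniteMeasure P] [StandardBorelSpace 𝒜] [Nonempty 𝒜]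
    (V : Population Ω 𝒳 𝒜 𝒵 ℳ P) (x : 𝒳) (a' : 𝒜) : ℝ :=
  (condDistrib V.A V.X P x).real {a'}

/-- `Pr[M = m' | x, a', z]`, as a function of `(x, a', z)`.
At `a' = a`, `m' = m` it is `π_m(x, z)`. -/
noncomputable def piM [IsFiniteMeasure P] [StandardBorelSpace ℳ] [Nonempty ℳ]
    (V : Population Ω 𝒳 𝒜 𝒵 ℳ P) (v : 𝒳 × 𝒜 × 𝒵) (m' : ℳ) : ℝ :=
  (condDistrib V.M V.XAZ P v).real {m'}

/-- Consistency: if `A = a` and `M = m`, then `Y = Y(a, m)`. -/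
def Consistency (V : Population Ω 𝒳 𝒜 𝒵 ℳ P) : Prop :=
  ∀ a m, ∀ᵐ ω ∂P, V.A ω = a → V.M ω = m → V.Y ω = V.Ypot a m ω

/-- Sequential ignorability: `Y(a, m) ⫫ A | X` and `Y(a, m) ⫫ M | X, A, Z` for all `a`, `m`. -/
def SequentialIgnorability [StandardBorelSpace Ω] [IsFiniteMeasure P]
    (V : Population Ω 𝒳 𝒜 𝒵 ℳ P) : Prop :=
  (∀ a m, CondIndepFun (MeasurableSpace.comap V.X inferInstance) V.measurable_X.comap_le
      (V.Ypot a m) V.A P) ∧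
  (∀ a m, CondIndepFun (MeasurableSpace.comap V.XAZ inferInstance) V.measurable_XAZ.comap_le
      (V.Ypot a m) V.M P)

/-- Positivity: `p(a' | x)` and `p(m' | x, a', z)` are bounded below by some `ε > 0`, for all
levels `a'`, `m'` and almost all values of the conditioning variables. -/
def Positivity [IsFiniteMeasure P] [StandardBorelSpace 𝒜] [Nonempty 𝒜]
    [StandardBorelSpace ℳ] [Nonempty ℳ] (V : Population Ω 𝒳 𝒜 𝒵 ℳ P) : Prop :=
  ∃ ε : ℝ, 0 < ε ∧
    (∀ a', ∀ᵐ x ∂(P.map V.X), ε < V.piA x a') ∧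
    (∀ m', ∀ᵐ v ∂(P.map V.XAZ), ε < V.piM v m')

end Population

/-! ### Working models and the estimating functions that fit them -/

/-- Finite-dimensional parameters. -/
abbrev Par (d : ℕ) := EuclideanSpace ℝ (Fin d)

/-- Parametric working models for the four nuisance functions at a fixed `(a, m)`.

Each model comes with a parameter set `Θ`, a regression function, and a vector-valued weight
(a score or instrument, for instance the vector of regressors of a generalized linear model) for its
estimating equation.  The models for `μ_y`, `ν_y`, `π_m` are fitted on the units with
`A ∈ S`, the model for `μ_y` moreover only on those with `M ∈ T`: `S = {a}`, `T = {m}` are fits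
within the stratum of interest, `S = T = univ` are regressions pooled over treatment and mediator.
The propensity models use the indicators of the levels in `LA`, `LM`: `LA = {a}` is a binary
regression of `𝟙(A = a)`, `LA = univ` a categorical regression such as multinomial logit. -/
structure WorkingModels (𝒳 : Type*) {𝒜 : Type*} (𝒵 : Type*) {ℳ : Type*} [MeasurableSpace 𝒳]
    [MeasurableSpace 𝒜] [MeasurableSpace 𝒵] [MeasurableSpace ℳ] (a : 𝒜) (m : ℳ) where
  S : Finset 𝒜
  T : Finset ℳ
  LA : Finset 𝒜
  LM : Finset ℳ
  a_mem_S : a ∈ S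
  m_mem_T : m ∈ T
  a_mem_LA : a ∈ LA
  m_mem_LM : m ∈ LM
  /-- dimensions of the parameters -/
  dMu : ℕ
  dNu : ℕ
  dA : ℕ
  dM : ℕ
  /-- parameter sets -/
  ΘMu : Set (Par dMu)
  ΘNu : Set (Par dNu)
  ΘA : Set (Par dA)
  ΘM : Set (Par dM)
  /-- working model for `E[Y | x, a', z, m']` -/
  mu : Par dMu → 𝒳 × 𝒜 × 𝒵 × ℳ → ℝ
  wMu : Par dMu → 𝒳 × 𝒜 × 𝒵 × ℳ → Par dMu
  /-- working model for `E_{Z | x, a'} E[Y | x, a', Z, m]` -/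
  nu : Par dNu → 𝒳 × 𝒜 → ℝ
  wNu : Par dNu → 𝒳 × 𝒜 → Par dNu
  /-- working model for `Pr[A = a' | x]` -/
  pA : Par dA → 𝒳 → 𝒜 → ℝ
  wA : Par dA → 𝒳 → 𝒜 → Par dA
  /-- working model for `Pr[M = m' | x, a', z]` -/
  pM : Par dM → 𝒳 × 𝒜 × 𝒵 → ℳ → ℝ
  wM : Par dM → 𝒳 × 𝒜 × 𝒵 → ℳ → Par dM
  measurable_mu : Measurable (Function.uncurry mu)
  measurable_wMu : Measurable (Function.uncurry wMu)
  measurable_nu : Measurable (Function.uncurry nu)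
  measurable_wNu : Measurable (Function.uncurry wNu)
  measurable_pA : ∀ a', Measurable (fun q : Par dA × 𝒳 => pA q.1 q.2 a')
  measurable_wA : ∀ a', Measurable (fun q : Par dA × 𝒳 => wA q.1 q.2 a')
  measurable_pM : ∀ m', Measurable (fun q : Par dM × (𝒳 × 𝒜 × 𝒵) => pM q.1 q.2 m')
  measurable_wM : ∀ m', Measurable (fun q : Par dM × (𝒳 × 𝒜 × 𝒵) => wM q.1 q.2 m')

namespace WorkingModels

section Estimating

variable {𝒳 𝒜 𝒵 ℳ : Type*} [MeasurableSpace 𝒳] [MeasurableSpace 𝒜] [MeasurableSpace 𝒵]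
  [MeasurableSpace ℳ] [DecidableEq 𝒜] [DecidableEq ℳ] {a : 𝒜} {m : ℳ}

/-- Estimating function of the model for `μ_y`. -/
noncomputable def scoreMu (W : WorkingModels 𝒳 𝒵 a m) : Obs 𝒳 𝒜 𝒵 ℳ → Par W.dMu → Par W.dMu :=
  fun (x, a', z, m', y) β =>
    if a' ∈ W.S ∧ m' ∈ W.T then
      (y - W.mu β (x, a', z, m')) • W.wMu β (x, a', z, m') else 0

/-- Estimating function of the model for `π_a`. -/
noncomputable def scoreA (W : WorkingModels 𝒳 𝒵 a m) : Obs 𝒳 𝒜 𝒵 ℳ → Par W.dA → Par W.dA :=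
  fun (x, a', _, _, _) α =>
    ∑ l ∈ W.LA, ((if a' = l then (1 : ℝ) else 0) - W.pA α x l) • W.wA α x l

/-- Estimating function of the model for `π_m`. -/
noncomputable def scoreM (W : WorkingModels 𝒳 𝒵 a m) : Obs 𝒳 𝒜 𝒵 ℳ → Par W.dM → Par W.dM :=
  fun (x, a', z, m', _) γ =>
    if a' ∈ W.S then
      ∑ l ∈ W.LM, ((if m' = l then (1 : ℝ) else 0) - W.pM γ (x, a', z) l) • W.wM γ (x, a', z) l
    else 0

/-- Estimating function for the regression of a response `u` on `(X, A)` under the model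
for `ν_y`. -/
noncomputable def scoreNu (W : WorkingModels 𝒳 𝒵 a m) (u : Obs 𝒳 𝒜 𝒵 ℳ → ℝ) :
    Obs 𝒳 𝒜 𝒵 ℳ → Par W.dNu → Par W.dNu :=
  fun o η =>
    if o.2.1 ∈ W.S then
      (u o - W.nu η (o.1, o.2.1)) • W.wNu η (o.1, o.2.1) else 0

/-- Imputed outcome: the response in `ν̂(x; μ̂)`. -/
def respMu (W : WorkingModels 𝒳 𝒵 a m) (β : Par W.dMu) : Obs 𝒳 𝒜 𝒵 ℳ → ℝ :=
  fun (x, a', z, _, _) => W.mu β (x, a', z, m)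

/-- Inverse-probability-weighted outcome: the response in `ν̂(x; π̂_m)`. -/
noncomputable def respM (W : WorkingModels 𝒳 𝒵 a m) (γ : Par W.dM) : Obs 𝒳 𝒜 𝒵 ℳ → ℝ :=
  fun (x, a', z, m', y) => (if m' = m then (1 : ℝ) else 0) * y / W.pM γ (x, a', z) m

/-- Augmented inverse-probability-weighted outcome: the response in `ν̂(x; μ̂, π̂_m)`. -/
noncomputable def respMuM (W : WorkingModels 𝒳 𝒵 a m) (β : Par W.dMu) (γ : Par W.dM) :
    Obs 𝒳 𝒜 𝒵 ℳ → ℝ :=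
  fun (x, a', z, m', y) =>
    W.mu β (x, a', z, m) +
      (if m' = m then (1 : ℝ) else 0) / W.pM γ (x, a', z) m * (y - W.mu β (x, a', z, m))

/-! The four systems of estimating equations for the nuisance parameters, and the function whose
sample mean, at the estimated nuisance parameters, is the estimator of `ψ_am`. -/

/-- Nuisance parameters `(β, η, α)` of the models for `μ_y`, `ν_y`, `π_a`. -/
abbrev Par1 (W : WorkingModels 𝒳 𝒵 a m) := Par W.dMu × Par W.dNu × Par W.dA

/-- Nuisance parameters `(γ, η, α)` of the models for `π_m`, `ν_y`, `π_a`. -/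
abbrev Par2 (W : WorkingModels 𝒳 𝒵 a m) := Par W.dM × Par W.dNu × Par W.dA

/-- Nuisance parameters `(β, γ, α)` of the models for `μ_y`, `π_m`, `π_a`. -/
abbrev Par3 (W : WorkingModels 𝒳 𝒵 a m) := Par W.dMu × Par W.dM × Par W.dA

/-- Nuisance parameters `(β, γ, η)` of the models for `μ_y`, `π_m`, `ν_y`. -/
abbrev Par4 (W : WorkingModels 𝒳 𝒵 a m) := Par W.dMu × Par W.dM × Par W.dNu

noncomputable def system1 (W : WorkingModels 𝒳 𝒵 a m) : Obs 𝒳 𝒜 𝒵 ℳ → W.Par1 → W.Par1 :=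
  fun o (β, η, α) => (W.scoreMu o β, W.scoreNu (W.respMu β) o η, W.scoreA o α)

noncomputable def system2 (W : WorkingModels 𝒳 𝒵 a m) : Obs 𝒳 𝒜 𝒵 ℳ → W.Par2 → W.Par2 :=
  fun o (γ, η, α) => (W.scoreM o γ, W.scoreNu (W.respM γ) o η, W.scoreA o α)

noncomputable def system3 (W : WorkingModels 𝒳 𝒵 a m) : Obs 𝒳 𝒜 𝒵 ℳ → W.Par3 → W.Par3 :=
  fun o (β, γ, α) => (W.scoreMu o β, W.scoreM o γ, W.scoreA o α)

noncomputable def system4 (W : WorkingModels 𝒳 𝒵 a m) : Obs 𝒳 𝒜 𝒵 ℳ → W.Par4 → W.Par4 :=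
  fun o (β, γ, η) => (W.scoreMu o β, W.scoreM o γ, W.scoreNu (W.respMuM β γ) o η)

noncomputable def dr1 (W : WorkingModels 𝒳 𝒵 a m) : Obs 𝒳 𝒜 𝒵 ℳ → W.Par1 → ℝ :=
  fun (x, a', z, _, _) (β, η, α) =>
    W.nu η (x, a) + (if a' = a then (1 : ℝ) else 0) / W.pA α x a *
      (W.mu β (x, a, z, m) - W.nu η (x, a))

noncomputable def dr2 (W : WorkingModels 𝒳 𝒵 a m) : Obs 𝒳 𝒜 𝒵 ℳ → W.Par2 → ℝ :=
  fun (x, a', z, m', y) (γ, η, α) =>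
    W.nu η (x, a) + (if a' = a then (1 : ℝ) else 0) / W.pA α x a *
      ((if m' = m then (1 : ℝ) else 0) * y / W.pM γ (x, a, z) m - W.nu η (x, a))

noncomputable def dr3 (W : WorkingModels 𝒳 𝒵 a m) : Obs 𝒳 𝒜 𝒵 ℳ → W.Par3 → ℝ :=
  fun (x, a', z, m', y) (β, γ, α) =>
    (if a' = a then (1 : ℝ) else 0) / W.pA α x a *
      (W.mu β (x, a, z, m) +
        (if m' = m then (1 : ℝ) else 0) / W.pM γ (x, a, z) m * (y - W.mu β (x, a, z, m)))

def dr4 (W : WorkingModels 𝒳 𝒵 a m) : Obs 𝒳 𝒜 𝒵 ℳ → W.Par4 → ℝ :=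
  fun (x, _, _, _, _) (_, _, η) => W.nu η (x, a)

end Estimating

/-! Correct specification: the working model contains the true function, on the cells that are used
in fitting the model (these include the cell of interest). -/

section Correct

variable {Ω 𝒳 𝒜 𝒵 ℳ : Type*} [MeasurableSpace Ω] [MeasurableSpace 𝒳] [MeasurableSpace 𝒜]
  [MeasurableSpace 𝒵] [MeasurableSpace ℳ] {P : Measure Ω} [IsFiniteMeasure P] {a : 𝒜} {m : ℳ}

def MuCorrect (W : WorkingModels 𝒳 𝒵 a m) (V : Population Ω 𝒳 𝒜 𝒵 ℳ P) : Prop :=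
  ∃ β ∈ W.ΘMu, ∀ᵐ v ∂(P.map V.XAZM), v.2.1 ∈ W.S → v.2.2.2 ∈ W.T → W.mu β v = V.muY v

def NuCorrect [StandardBorelSpace 𝒵] [Nonempty 𝒵]
    (W : WorkingModels 𝒳 𝒵 a m) (V : Population Ω 𝒳 𝒜 𝒵 ℳ P) : Prop :=
  ∃ η ∈ W.ΘNu, ∀ᵐ v ∂(P.map V.XA), v.2 ∈ W.S → W.nu η v = V.nuY m v

def PiACorrect [StandardBorelSpace 𝒜] [Nonempty 𝒜]
    (W : WorkingModels 𝒳 𝒵 a m) (V : Population Ω 𝒳 𝒜 𝒵 ℳ P) : Prop :=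
  ∃ α ∈ W.ΘA, ∀ᵐ x ∂(P.map V.X), ∀ l ∈ W.LA, W.pA α x l = V.piA x l

def PiMCorrect [StandardBorelSpace ℳ] [Nonempty ℳ]
    (W : WorkingModels 𝒳 𝒵 a m) (V : Population Ω 𝒳 𝒜 𝒵 ℳ P) : Prop :=
  ∃ γ ∈ W.ΘM, ∀ᵐ v ∂(P.map V.XAZ), v.2.1 ∈ W.S → ∀ l ∈ W.LM, W.pM γ v l = V.piM v l

end Correct

end WorkingModels

/-! ### Estimators defined by estimating equations: regularity conditions and limit notions -/

section Asymptotics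

variable {Ω' 𝒪 E : Type*} [MeasurableSpace Ω'] [MeasurableSpace 𝒪]
  [NormedAddCommGroup E] [NormedSpace ℝ E]

/-- The sample mean `ℙ_n[g]` of `g` over the units `0, …, n - 1`. -/
noncomputable def sampleMean {F : Type*} [AddCommGroup F] [Module ℝ F] (O : ℕ → Ω' → 𝒪) (n : ℕ)
    (ω : Ω') (g : 𝒪 → F) : F :=
  (n : ℝ)⁻¹ • ∑ i ∈ Finset.range n, g (O i ω)

/-- `O 0, O 1, …` is an i.i.d. sample from `Q`. -/
structure IsSample (P' : Measure Ω') (O : ℕ → Ω' → 𝒪) (Q : Measure 𝒪) : Prop where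
  measurable : ∀ i, Measurable (O i)
  indep : iIndepFun O P'
  map_eq : ∀ i, P'.map (O i) = Q

/-- The population estimating equation `E[U(O; θ)] = 0` is well defined on the parameter set `Θ`,
has at most one root in it, namely `θ`, and `θ` is an interior point of `Θ`. -/
structure Identified (Q : Measure 𝒪) (U : 𝒪 → E → E) (Θ : Set E) (θ : E) : Prop where
  interior : θ ∈ interior Θ
  integrable : ∀ t ∈ Θ, Integrable (fun o => U o t) Q
  unique : ∀ t ∈ Θ, ∫ o, U o t ∂Q = 0 → t = θ

/-- The standard smoothness and moment conditions for M-estimation at `θ`, for the system `Ψ` of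
estimating functions and the function `φ` whose sample mean is taken in the last step: both are
continuously differentiable near `θ` with derivatives dominated by an integrable function, have
finite second moments at `θ`, and the expected Jacobian of the system is nonsingular. -/
structure ZRegular (Q : Measure 𝒪) (Ψ : 𝒪 → E → E) (φ : 𝒪 → E → ℝ) (θ : E) : Prop where
  smooth : ∃ r > 0, ∃ G : 𝒪 → ℝ, Integrable G Q ∧ ∀ᵐ o ∂Q,
    ContDiffOn ℝ 1 (Ψ o) (Metric.ball θ r) ∧ ContDiffOn ℝ 1 (φ o) (Metric.ball θ r) ∧
    ∀ t ∈ Metric.ball θ r, ‖fderiv ℝ (Ψ o) t‖ ≤ G o ∧ ‖fderiv ℝ (φ o) t‖ ≤ G o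
  memLp_system : MemLp (fun o => Ψ o θ) 2 Q
  memLp_target : MemLp (fun o => φ o θ) 2 Q
  nonsingular : IsUnit (∫ o, fderiv ℝ (Ψ o) θ ∂Q)

/-- `θhat n` is a (measurable) solution of the sample estimating equations `ℙ_n[Ψ(O; t)] = 0`,
up to `o_p(n^{-1/2})`, and has the probability limit `θ`. -/
structure IsZEstimator [MeasurableSpace E] (P' : Measure Ω') (O : ℕ → Ω' → 𝒪) (Ψ : 𝒪 → E → E)
    (θhat : ℕ → Ω' → E) (θ : E) : Prop where
  measurable : ∀ n, Measurable (θhat n)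
  root : TendstoInMeasure P'
    (fun (n : ℕ) ω => √(n : ℝ) • sampleMean O n ω (fun o => Ψ o (θhat n ω))) atTop (fun _ => 0)
  plim : TendstoInMeasure P' θhat atTop (fun _ => θ)

/-- The plug-in estimator `ℙ_n[φ(O; θhat n)]`. -/
noncomputable def plugIn (O : ℕ → Ω' → 𝒪) (φ : 𝒪 → E → ℝ) (θhat : ℕ → Ω' → E) (n : ℕ) (ω : Ω') :
    ℝ :=
  sampleMean O n ω (fun o => φ o (θhat n ω))

/-- Variance of the influence function
`φ(O; θ) - ψ - E[∂φ(O; θ)] E[∂Ψ(O; θ)]⁻¹ Ψ(O; θ)` of the plug-in estimator. -/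
noncomputable def asympVar (Q : Measure 𝒪) (Ψ : 𝒪 → E → E) (φ : 𝒪 → E → ℝ) (ψ : ℝ) (θ : E) : ℝ≥0 :=
  (Var[fun o => φ o θ - ψ -
    (∫ o', fderiv ℝ (φ o') θ ∂Q) (Ring.inverse (∫ o', fderiv ℝ (Ψ o') θ ∂Q) (Ψ o θ)); Q]).toNNReal

/-- Consistent and asymptotically normal: `ψhat n → ψ` in probability and
`√n (ψhat n - ψ) → N(0, v)` in distribution. -/
def IsCAN (P' : Measure Ω') [IsProbabilityMeasure P'] (ψhat : ℕ → Ω' → ℝ) (ψ : ℝ) (v : ℝ≥0) :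
    Prop :=
  TendstoInMeasure P' ψhat atTop (fun _ => ψ) ∧
  TendstoInDistribution (fun (n : ℕ) ω => √(n : ℝ) * (ψhat n ω - ψ)) atTop (id : ℝ → ℝ)
    (fun _ => P') (gaussianReal 0 v)

end Asymptotics

/-! ### Regularity conditions for the four estimators -/

namespace WorkingModels

variable {𝒳 𝒜 𝒵 ℳ : Type*} [MeasurableSpace 𝒳] [MeasurableSpace 𝒜] [MeasurableSpace 𝒵]
  [MeasurableSpace ℳ] [DecidableEq 𝒜] [DecidableEq ℳ] {a : 𝒜} {m : ℳ}

structure Regular1 (W : WorkingModels 𝒳 𝒵 a m) (Q : Measure (Obs 𝒳 𝒜 𝒵 ℳ)) (θ : W.Par1) :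
    Prop where
  mu : Identified Q W.scoreMu W.ΘMu θ.1
  nu : Identified Q (W.scoreNu (W.respMu θ.1)) W.ΘNu θ.2.1
  piA : Identified Q W.scoreA W.ΘA θ.2.2
  regular : ZRegular Q W.system1 W.dr1 θ

structure Regular2 (W : WorkingModels 𝒳 𝒵 a m) (Q : Measure (Obs 𝒳 𝒜 𝒵 ℳ)) (θ : W.Par2) :
    Prop where
  piM : Identified Q W.scoreM W.ΘM θ.1
  nu : Identified Q (W.scoreNu (W.respM θ.1)) W.ΘNu θ.2.1
  piA : Identified Q W.scoreA W.ΘA θ.2.2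
  regular : ZRegular Q W.system2 W.dr2 θ

structure Regular3 (W : WorkingModels 𝒳 𝒵 a m) (Q : Measure (Obs 𝒳 𝒜 𝒵 ℳ)) (θ : W.Par3) :
    Prop where
  mu : Identified Q W.scoreMu W.ΘMu θ.1
  piM : Identified Q W.scoreM W.ΘM θ.2.1
  piA : Identified Q W.scoreA W.ΘA θ.2.2
  regular : ZRegular Q W.system3 W.dr3 θ

structure Regular4 (W : WorkingModels 𝒳 𝒵 a m) (Q : Measure (Obs 𝒳 𝒜 𝒵 ℳ)) (θ : W.Par4) :
    Prop where
  mu : Identified Q W.scoreMu W.ΘMu θ.1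
  piM : Identified Q W.scoreM W.ΘM θ.2.1
  nu : Identified Q (W.scoreNu (W.respMuM θ.1 θ.2.1)) W.ΘNu θ.2.2
  regular : ZRegular Q W.system4 W.dr4 θ

end WorkingModels

end CRF

open CRF

set_option linter.unusedSectionVars false

/-! The proof has two independent halves.

Asymptotic half (`isCAN_plugIn`). For any regular system `Ψ` and target `φ`, a plug-in estimator
built on a Z-estimator with limit `θ` is CAN for `E[φ(O; θ)]`, with the sandwich variance. The
engine is `tendstoInMeasure_remainder`: a sample mean evaluated at `θhat` equals the one at `θ`,
plus the expected derivative applied to `θhat - θ`, plus `o_p(‖θhat - θ‖)`. Applied to `Ψ`, it first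
shows that `θ` solves the population equation (which is not assumed), and then, as the expected
Jacobian `J` is invertible, that `θhat - θ` is `-J⁻¹ ℙ_n[Ψ(O; θ)]` up to `o_p(n^{-1/2})`. Inserting
this into the expansion of `φ` gives the influence function, to which the central limit theorem
applies.

Population half. What remains is `E[φ_k(O; θ*)] = ψ_am`. At a correct parameter an estimating
function is a weight times a residual with conditional mean zero, so its expectation vanishes and
uniqueness of the root makes that parameter the limit. Positivity transfers equalities from the
cells of the fit to almost every covariate value (`mu_eq_muYAt`, `pA_eq_piA`, `pM_eq_piM`,
`nu_eq_nuY`). Ignorability and consistency give `E[ν_y(X)] = ψ_am` (`integral_nuY`). If `μ` or `p_M`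
is correct, the response on `A ∈ S` has the form `R + g * D`, where `R` has conditional mean `ν_y(X,
A)` given `(X, A)` and `D` is a residual given a finer σ-algebra. If moreover `ν` or `p_A` is
correct, the remaining error of `φ_k` is again a weight times a residual.

The recurring difficulty is integrability: weights coming from misspecified models may be unbounded,
and only the whole estimating function or the whole `φ_k` is known to be integrable. Individual
terms are made integrable by truncating the weight, or by subtracting the terms already known to be
integrable. -/

namespace CRF

/-! ### Measurability of parameter derivatives -/

section Derivative

variable {𝒪 E F : Type*} [MeasurableSpace 𝒪] {Q : Measure 𝒪}
  [NormedAddCommGroup E] [NormedSpace ℝ E] [NormedAddCommGroup F] [NormedSpace ℝ F]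

/-- A directional derivative is the almost sure limit of the difference quotients with step `1 / n`,
each of which involves `Φ` at two fixed parameters only. -/
theorem aestronglyMeasurable_fderiv_apply_param {Φ : 𝒪 → E → F}
    (hΦ : ∀ t, AEStronglyMeasurable (fun o => Φ o t) Q) {θ : E}
    (hd : ∀ᵐ o ∂Q, DifferentiableAt ℝ (Φ o) θ) (v : E) :
    AEStronglyMeasurable (fun o => fderiv ℝ (Φ o) θ v) Q := by
  refine aestronglyMeasurable_of_tendsto_ae (u := atTop)
    (f := fun (n : ℕ) o => (n : ℝ) • (Φ o (θ + (n : ℝ)⁻¹ • v) - Φ o θ)) (fun n => ?_) ?_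
  · exact ((hΦ _).sub (hΦ _)).const_smul _
  · filter_upwards [hd] with o ho
    refine ho.hasFDerivAt.lim (l := atTop) v (c := fun n : ℕ => (n : ℝ)) ?_
    exact tendsto_norm_atTop_atTop.comp tendsto_natCast_atTop_atTop

/-- In finite dimension the derivative is a finite sum of rank-one operators whose vectors are its
values on a basis. -/
theorem aestronglyMeasurable_fderiv_param [FiniteDimensional ℝ E] {Φ : 𝒪 → E → F}
    (hΦ : ∀ t, AEStronglyMeasurable (fun o => Φ o t) Q) {θ : E}
    (hd : ∀ᵐ o ∂Q, DifferentiableAt ℝ (Φ o) θ) :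
    AEStronglyMeasurable (fun o => fderiv ℝ (Φ o) θ) Q := by
  let b := Module.finBasis ℝ E
  have key : (fun o => fderiv ℝ (Φ o) θ) = fun o => ∑ i,
      ContinuousLinearMap.smulRightL ℝ E F (LinearMap.toContinuousLinearMap (b.coord i))
        (fderiv ℝ (Φ o) θ (b i)) := by
    ext o v
    conv_lhs => rw [← b.sum_repr v, map_sum]
    simp
  rw [key]
  exact Finset.aestronglyMeasurable_fun_sum _ fun i _ =>
    (ContinuousLinearMap.continuous _).comp_aestronglyMeasurable
      (aestronglyMeasurable_fderiv_apply_param hΦ hd (b i))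

end Derivative

/-! ### Calculus of `o_p(1)` and `O_p(1)` -/

section InProbability

variable {Ω' F : Type*} [MeasurableSpace Ω'] {P' : Measure Ω'} [NormedAddCommGroup F]

/-- The comparison may fail on events of vanishing probability. This is needed where the error `θhat
- θ` can be absorbed only if the random remainder coefficient is small. -/
theorem tendstoInMeasure_zero_of_norm_le {f : ℕ → Ω' → F} {g : ℕ → Ω' → ℝ}
    (hg : TendstoInMeasure P' g atTop (fun _ => 0)) {B : ℕ → Set Ω'}
    (hB : Tendsto (fun n => P' (B n)) atTop (𝓝 0))
    (h : ∀ n, ∀ᵐ ω ∂P', ω ∉ B n → ‖f n ω‖ ≤ g n ω) :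
    TendstoInMeasure P' f atTop (fun _ => 0) := by
  rw [tendstoInMeasure_iff_norm] at hg ⊢
  intro ε hε
  have h0 := (hg ε hε).add hB
  simp only [sub_zero, add_zero] at h0
  refine tendsto_of_tendsto_of_tendsto_of_le_of_le tendsto_const_nhds h0 (fun _ => zero_le)
    fun n => ?_
  refine le_trans (measure_mono_ae ?_) (measure_union_le _ _)
  filter_upwards [h n] with ω hω hε'
  by_cases hb : ω ∈ B n
  · exact Or.inr hb
  · left
    simp only [sub_zero] at hε'
    exact (hε'.trans (hω hb)).trans (le_abs_self _)

theorem tendstoInMeasure_zero_of_norm_le_ae {f : ℕ → Ω' → F} {g : ℕ → Ω' → ℝ}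
    (hg : TendstoInMeasure P' g atTop (fun _ => 0)) (h : ∀ n, ∀ᵐ ω ∂P', ‖f n ω‖ ≤ g n ω) :
    TendstoInMeasure P' f atTop (fun _ => 0) :=
  tendstoInMeasure_zero_of_norm_le hg (B := fun _ => ∅) (by simp) fun n => by
    filter_upwards [h n] with ω hω _ using hω

theorem tendstoInMeasure_zero_add {f g : ℕ → Ω' → F}
    (hf : TendstoInMeasure P' f atTop (fun _ => 0))
    (hg : TendstoInMeasure P' g atTop (fun _ => 0)) :
    TendstoInMeasure P' (fun n ω => f n ω + g n ω) atTop (fun _ => 0) := by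
  rw [tendstoInMeasure_iff_norm] at hf hg ⊢
  intro ε hε
  have h0 := (hf (ε / 2) (half_pos hε)).add (hg (ε / 2) (half_pos hε))
  simp only [sub_zero, add_zero] at h0
  refine tendsto_of_tendsto_of_tendsto_of_le_of_le tendsto_const_nhds h0 (fun _ => zero_le)
    fun n => ?_
  refine le_trans (measure_mono fun ω hω => ?_) (measure_union_le _ _)
  simp only [sub_zero, Set.mem_ofPred_eq] at hω
  by_contra hc
  simp only [Set.mem_union, Set.mem_ofPred_eq, not_or, not_le] at hc
  linarith [norm_add_le (f n ω) (g n ω), hc.1, hc.2]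

theorem tendstoInMeasure_zero_norm {f : ℕ → Ω' → F}
    (hf : TendstoInMeasure P' f atTop (fun _ => 0)) :
    TendstoInMeasure P' (fun n ω => ‖f n ω‖) atTop (fun _ => (0 : ℝ)) := by
  rw [tendstoInMeasure_iff_norm] at hf ⊢
  simpa using hf

theorem tendstoInMeasure_zero_sub_iff {f : ℕ → Ω' → F} {c : F} :
    TendstoInMeasure P' (fun n ω => f n ω - c) atTop (fun _ => 0) ↔
      TendstoInMeasure P' f atTop (fun _ => c) := by
  rw [tendstoInMeasure_iff_norm, tendstoInMeasure_iff_norm]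
  simp

theorem tendstoInMeasure_zero_const_mul {f : ℕ → Ω' → ℝ} (c : ℝ)
    (hf : TendstoInMeasure P' f atTop (fun _ => 0)) :
    TendstoInMeasure P' (fun n ω => c * f n ω) atTop (fun _ => 0) := by
  rw [tendstoInMeasure_iff_norm] at hf ⊢
  intro ε hε
  have hc : 0 < |c| + 1 := by positivity
  have h0 := hf (ε / (|c| + 1)) (by positivity)
  refine tendsto_of_tendsto_of_tendsto_of_le_of_le tendsto_const_nhds h0 (fun _ => zero_le)
    fun n => measure_mono fun ω hω => ?_
  simp only [sub_zero, Set.mem_ofPred_eq, norm_mul, Real.norm_eq_abs] at hω ⊢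
  rw [div_le_iff₀ hc]
  nlinarith [abs_nonneg (f n ω)]

/-- A sequence of real random variables that is bounded in probability. -/
def BoundedInProb (P' : Measure Ω') (s : ℕ → Ω' → ℝ) : Prop :=
  ∀ ε : ℝ≥0∞, 0 < ε → ∃ K : ℝ, 0 < K ∧ ∀ n, P' {ω | K ≤ |s n ω|} ≤ ε

theorem BoundedInProb.mul_tendstoInMeasure_zero {f s : ℕ → Ω' → ℝ} (hs : BoundedInProb P' s)
    (hf : TendstoInMeasure P' f atTop (fun _ => 0)) :
    TendstoInMeasure P' (fun n ω => f n ω * s n ω) atTop (fun _ => 0) := by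
  rw [tendstoInMeasure_iff_norm] at hf ⊢
  intro ε hε
  rw [ENNReal.tendsto_nhds_zero]
  intro δ hδ
  obtain ⟨K, hK, hsK⟩ := hs (δ / 2) (ENNReal.half_pos hδ.ne')
  filter_upwards [(ENNReal.tendsto_nhds_zero.1 (hf (ε / K) (by positivity))) (δ / 2)
    (ENNReal.half_pos hδ.ne')] with n hn
  refine le_trans (le_trans (measure_mono fun ω hω => ?_) (measure_union_le _ _))
    ((add_le_add hn (hsK n)).trans (ENNReal.add_halves δ).le)
  simp only [sub_zero, Set.mem_ofPred_eq, norm_mul, Real.norm_eq_abs] at hω ⊢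
  by_contra hc
  simp only [Set.mem_union, Set.mem_ofPred_eq, not_or, not_le] at hc
  have := mul_lt_mul'' hc.1 hc.2 (abs_nonneg _) (abs_nonneg _)
  rw [div_mul_cancel₀ _ hK.ne'] at this
  linarith

theorem BoundedInProb.add {s t : ℕ → Ω' → ℝ} (hs : BoundedInProb P' s) (ht : BoundedInProb P' t) :
    BoundedInProb P' (fun n ω => s n ω + t n ω) := by
  intro ε hε
  obtain ⟨K, hK, h1⟩ := hs (ε / 2) (ENNReal.half_pos hε.ne')
  obtain ⟨L, hL, h2⟩ := ht (ε / 2) (ENNReal.half_pos hε.ne')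
  refine ⟨K + L, by positivity, fun n => ?_⟩
  refine le_trans (le_trans (measure_mono fun ω hω => ?_) (measure_union_le _ _))
    ((add_le_add (h1 n) (h2 n)).trans (ENNReal.add_halves ε).le)
  simp only [Set.mem_ofPred_eq] at hω
  by_contra hc
  simp only [Set.mem_union, Set.mem_ofPred_eq, not_or, not_le] at hc
  linarith [abs_add_le (s n ω) (t n ω), hc.1, hc.2]

theorem BoundedInProb.mono {s t : ℕ → Ω' → ℝ} (hs : BoundedInProb P' s)
    (h : ∀ n ω, |t n ω| ≤ |s n ω|) : BoundedInProb P' t := fun ε hε => by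
  obtain ⟨K, hK, h1⟩ := hs ε hε
  exact ⟨K, hK, fun n => (measure_mono fun ω hω => le_trans hω (h n ω)).trans (h1 n)⟩

theorem boundedInProb_of_lintegral_sq_le {s : ℕ → Ω' → ℝ} (hm : ∀ n, AEMeasurable (s n) P')
    {C : ℝ≥0∞} (hC : C ≠ ∞) (h : ∀ n, ∫⁻ ω, ‖s n ω‖ₑ ^ 2 ∂P' ≤ C) : BoundedInProb P' s := by
  intro ε hε
  by_cases hεt : ε = ∞
  · exact ⟨1, one_pos, fun n => by simp [hεt]⟩
  have hdiv : C / ε ≠ ∞ := ENNReal.div_ne_top hC hε.ne'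
  -- The summand `1` makes the threshold at least `1`, so that its square is at least `C / ε + 1`
  -- and no square root is needed in Chebyshev's inequality.
  refine ⟨(C / ε).toReal + 1, by positivity, fun n => ?_⟩
  have hsub : {ω | (C / ε).toReal + 1 ≤ |s n ω|} ⊆ {ω | C / ε + 1 ≤ ‖s n ω‖ₑ ^ 2} := by
    intro ω hω
    simp only [Set.mem_ofPred_eq] at hω ⊢
    have h1 : (C / ε).toReal + 1 ≤ |s n ω| ^ 2 := by
      nlinarith [ENNReal.toReal_nonneg (a := C / ε)]
    calc C / ε + 1 = ENNReal.ofReal ((C / ε).toReal + 1) := by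
          rw [ENNReal.ofReal_add (by positivity) zero_le_one, ENNReal.ofReal_toReal hdiv]; simp
      _ ≤ ENNReal.ofReal (|s n ω| ^ 2) := ENNReal.ofReal_le_ofReal h1
      _ = ‖s n ω‖ₑ ^ 2 := by
          rw [ENNReal.ofReal_pow (abs_nonneg _), ← Real.norm_eq_abs, ofReal_norm]
  have hmk := mul_meas_ge_le_lintegral₀ ((hm n).enorm.pow_const 2) (C / ε + 1)
  have h2 : (C / ε) * P' {ω | (C / ε).toReal + 1 ≤ |s n ω|} ≤ C :=
    le_trans (mul_le_mul' le_self_add (measure_mono hsub)) (hmk.trans (h n))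
  -- For `C = 0` the quotient `C / (C / ε)` is useless. There the summand `1` in the Markov bound
  -- forces probability zero.
  by_cases hC0 : C = 0
  · have : (C / ε + 1) * P' {ω | (C / ε).toReal + 1 ≤ |s n ω|} ≤ C :=
      le_trans (mul_le_mul' le_rfl (measure_mono hsub)) (hmk.trans (h n))
    rw [hC0] at this ⊢
    simp at this
    simp [this]
  · have h3 : P' {ω | (C / ε).toReal + 1 ≤ |s n ω|} ≤ C / (C / ε) := by
      rw [ENNReal.le_div_iff_mul_le (Or.inl (ENNReal.div_ne_zero.2 ⟨hC0, hεt⟩)) (Or.inl hdiv)]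
      rwa [mul_comm]
    rwa [ENNReal.div_div_cancel hC0 hC] at h3

end InProbability

/-! ### Sample means and the law of large numbers -/

section Sample

variable {Ω' 𝒪 F : Type*} [MeasurableSpace Ω'] [MeasurableSpace 𝒪] {P' : Measure Ω'}
  {O : ℕ → Ω' → 𝒪} {Q : Measure 𝒪} [NormedAddCommGroup F] [NormedSpace ℝ F]

theorem IsSample.ae_forall (hO : IsSample P' O Q) {p : 𝒪 → Prop} (h : ∀ᵐ o ∂Q, p o) :
    ∀ᵐ ω ∂P', ∀ i, p (O i ω) := by
  refine ae_all_iff.2 fun i => ae_of_ae_map (hO.measurable i).aemeasurable ?_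
  rwa [hO.map_eq i]

theorem sampleMean_sub (O : ℕ → Ω' → 𝒪) (n : ℕ) (ω : Ω') (f g : 𝒪 → F) :
    sampleMean O n ω (fun o => f o - g o) = sampleMean O n ω f - sampleMean O n ω g := by
  simp only [sampleMean, Finset.sum_sub_distrib, smul_sub]

theorem sampleMean_clm {E : Type*} [NormedAddCommGroup E] [NormedSpace ℝ E]
    (O : ℕ → Ω' → 𝒪) (n : ℕ) (ω : Ω') (f : 𝒪 → E) (L : E →L[ℝ] F) :
    sampleMean O n ω (fun o => L (f o)) = L (sampleMean O n ω f) := by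
  simp [sampleMean, map_sum]

theorem sampleMean_clm_apply {E : Type*} [NormedAddCommGroup E] [NormedSpace ℝ E]
    (O : ℕ → Ω' → 𝒪) (n : ℕ) (ω : Ω') (f : 𝒪 → E →L[ℝ] F) (v : E) :
    sampleMean O n ω (fun o => f o v) = sampleMean O n ω f v := by
  simp [sampleMean]

theorem norm_sampleMean_le {n : ℕ} {ω : Ω'} {f : 𝒪 → F} {g : 𝒪 → ℝ} {c : ℝ}
    (h : ∀ i, ‖f (O i ω)‖ ≤ g (O i ω) * c) :
    ‖sampleMean O n ω f‖ ≤ sampleMean O n ω g * c := by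
  simp only [sampleMean, norm_smul, norm_inv, Real.norm_natCast, smul_eq_mul, mul_assoc,
    Finset.sum_mul]
  gcongr
  exact (norm_sum_le _ _).trans (Finset.sum_le_sum fun i _ => h i)

theorem measurable_sampleMean [MeasurableSpace F] [BorelSpace F] [SecondCountableTopology F]
    {E : Type*} [MeasurableSpace E] (hO : IsSample P' O Q) {Φ : 𝒪 → E → F}
    (hΦ : Measurable (Function.uncurry Φ)) {T : Ω' → E} (hT : Measurable T) (n : ℕ) :
    Measurable (fun ω => sampleMean O n ω (fun o => Φ o (T ω))) :=
  (Finset.measurable_sum _ fun i _ =>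
    hΦ.comp ((hO.measurable i).prodMk hT)).const_smul ((n : ℝ)⁻¹)

theorem IsSample.identDistrib [MeasurableSpace F] (hO : IsSample P' O Q) {f : 𝒪 → F}
    (hf : Measurable f) (i : ℕ) : IdentDistrib (fun ω => f (O i ω)) (fun ω => f (O 0 ω)) P' P' :=
  IdentDistrib.comp (u := f) ⟨(hO.measurable i).aemeasurable, (hO.measurable 0).aemeasurable,
    by rw [hO.map_eq, hO.map_eq]⟩ hf

/-- Weak law of large numbers. -/
theorem IsSample.tendstoInMeasure_sampleMean [IsProbabilityMeasure P'] [CompleteSpace F]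
    (hO : IsSample P' O Q) {f : 𝒪 → F} (hf : Integrable f Q) :
    TendstoInMeasure P' (fun n ω => sampleMean O n ω f) atTop (fun _ => ∫ o, f o ∂Q) := by
  let _ : MeasurableSpace F := borel F
  have _ : BorelSpace F := ⟨rfl⟩
  -- Independence and identical distribution pass to measurable functions of the observations, so
  -- `f`, measurable only up to null sets, is replaced by a strongly measurable version.
  set g := hf.1.mk f with hg
  have hgm : StronglyMeasurable g := hf.1.stronglyMeasurable_mk
  have hfg : f =ᵐ[Q] g := hf.1.ae_eq_mk
  have hgi : Integrable g Q := hf.congr hfg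
  have h0 : Integrable (fun ω => g (O 0 ω)) P' := by
    have := hgi
    rw [← hO.map_eq 0] at this
    exact this.comp_measurable (hO.measurable 0)
  have hE : ∫ ω, g (O 0 ω) ∂P' = ∫ o, f o ∂Q := by
    rw [integral_congr_ae hfg, ← hO.map_eq 0, integral_map (hO.measurable 0).aemeasurable]
    exact hgm.aestronglyMeasurable
  have hlaw := strong_law_ae (fun i ω => g (O i ω)) h0
    (fun i j hij => (hO.indep.indepFun hij).comp hgm.measurable hgm.measurable)
    (fun i => hO.identDistrib hgm.measurable i)
  refine tendstoInMeasure_of_tendsto_ae (fun n => ?_) ?_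
  · have hm : ∀ i, AEStronglyMeasurable (fun ω => f (O i ω)) P' := fun i => by
      have := hf.1
      rw [← hO.map_eq i] at this
      exact this.comp_aemeasurable (hO.measurable i).aemeasurable
    exact (Finset.aestronglyMeasurable_fun_sum _ fun i _ => hm i).const_smul _
  · filter_upwards [hlaw, hO.ae_forall hfg] with ω h1 h2
    rw [hE] at h1
    simpa [sampleMean, h2] using h1

end Sample

/-! ### Uniform first-order expansion near the limit parameter -/

section Remainder

variable {Ω' 𝒪 E F : Type*} [MeasurableSpace Ω'] [MeasurableSpace 𝒪] {P' : Measure Ω'}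
  {O : ℕ → Ω' → 𝒪} {Q : Measure 𝒪} [NormedAddCommGroup E] [NormedSpace ℝ E]
  [NormedAddCommGroup F] [NormedSpace ℝ F]

/-- The relative error of the linear approximation of `g` at `θ`. -/
noncomputable def linError (g : E → F) (θ t : E) : ℝ :=
  ‖g t - g θ - fderiv ℝ g θ (t - θ)‖ / ‖t - θ‖

/-- At `t = θ` the quotient is `0 / 0 = 0`, so the identity needs no exception. -/
theorem linError_mul (g : E → F) (θ t : E) :
    ‖g t - g θ - fderiv ℝ g θ (t - θ)‖ = linError g θ t * ‖t - θ‖ := by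
  by_cases h : t = θ
  · simp [h]
  · rw [linError, div_mul_cancel₀]
    exact norm_ne_zero_iff.2 (sub_ne_zero.2 h)

/-- One `C` comes from the mean value inequality on the ball, the other from the derivative at `θ`.
-/
theorem linError_le {g : E → F} {θ : E} {r C : ℝ} (hg : ContDiffOn ℝ 1 g (Metric.ball θ r))
    (hC : ∀ t ∈ Metric.ball θ r, ‖fderiv ℝ g t‖ ≤ C) {t : E} (ht : t ∈ Metric.ball θ r) :
    linError g θ t ≤ 2 * C := by
  have hr : 0 < r := Metric.nonempty_ball.1 ⟨t, ht⟩
  have hθ : θ ∈ Metric.ball θ r := Metric.mem_ball_self hr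
  have hC0 : 0 ≤ C := (norm_nonneg _).trans (hC θ hθ)
  have h1 : ‖g t - g θ‖ ≤ C * ‖t - θ‖ :=
    (convex_ball θ r).norm_image_sub_le_of_norm_fderiv_le (𝕜 := ℝ)
      (fun x hx => (hg.differentiableOn one_ne_zero).differentiableAt
        (Metric.isOpen_ball.mem_nhds hx)) hC hθ ht
  have h2 : ‖fderiv ℝ g θ (t - θ)‖ ≤ C * ‖t - θ‖ :=
    (ContinuousLinearMap.le_opNorm _ _).trans (by gcongr; exact hC θ hθ)
  refine div_le_of_le_mul₀ (norm_nonneg _) (by positivity) ?_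
  linarith [norm_sub_le (g t - g θ) (fderiv ℝ g θ (t - θ))]

open Classical in
/-- Supremum of the relative error of linear approximation over a dense set of points of the ball
of radius `δ`. -/
noncomputable def linModulus [TopologicalSpace.SeparableSpace E] (g : E → F) (θ : E) (δ : ℝ) :
    ℝ≥0∞ :=
  ⨆ j : ℕ, if TopologicalSpace.denseSeq E j ∈ Metric.ball θ δ then
    ENNReal.ofReal (linError g θ (TopologicalSpace.denseSeq E j)) else 0

variable [TopologicalSpace.SeparableSpace E]

theorem linModulus_le {g : E → F} {θ : E} {δ C : ℝ}
    (h : ∀ t ∈ Metric.ball θ δ, linError g θ t ≤ C) :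
    linModulus g θ δ ≤ ENNReal.ofReal C := by
  refine iSup_le fun j => ?_
  split_ifs with hj
  · exact ENNReal.ofReal_le_ofReal (h _ hj)
  · exact zero_le

/-- Away from `θ` the relative error is continuous, so it is controlled by nearby points of the
dense sequence; at `θ` it is zero. A countable supremum thus dominates the whole ball while
remaining measurable in the observation. -/
theorem le_linModulus {g : E → F} {θ : E} {δ : ℝ} (hg : ContinuousOn g (Metric.ball θ δ)) {t : E}
    (ht : t ∈ Metric.ball θ δ) : ENNReal.ofReal (linError g θ t) ≤ linModulus g θ δ := by
  by_cases hθ : t = θ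
  · simp [hθ, linError]
  have hcont : ContinuousAt (fun s => ENNReal.ofReal (linError g θ s)) t := by
    refine ENNReal.continuous_ofReal.continuousAt.comp ?_
    have hgt := hg.continuousAt (Metric.isOpen_ball.mem_nhds ht)
    unfold linError
    refine ContinuousAt.div ?_ (by fun_prop) (norm_ne_zero_iff.2 (sub_ne_zero.2 hθ))
    fun_prop
  refine le_of_forall_lt fun c hc => ?_
  have hev : ∀ᶠ s in 𝓝 t, c < ENNReal.ofReal (linError g θ s) ∧ s ∈ Metric.ball θ δ :=
    (hcont.eventually_const_lt hc).and (Metric.isOpen_ball.mem_nhds ht)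
  obtain ⟨_, ⟨j, rfl⟩, hs1, hs2⟩ :=
    (TopologicalSpace.denseRange_denseSeq E).inter_nhds_nonempty hev
  refine hs1.trans_le (le_trans ?_ (le_iSup _ j))
  rw [if_pos hs2]

theorem tendsto_linModulus {g : E → F} {θ : E} (hg : DifferentiableAt ℝ g θ) {δ : ℕ → ℝ}
    (hδ : Tendsto δ atTop (𝓝 0)) : Tendsto (fun k => linModulus g θ (δ k)) atTop (𝓝 0) := by
  rw [ENNReal.tendsto_nhds_zero]
  intro ε hε
  obtain ⟨c, hc0, hc⟩ := ENNReal.lt_iff_exists_real_btwn.1 hε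
  have hc1 : 0 < c := by simpa using hc.1
  have h1 := hg.hasFDerivAt.isLittleO.def hc1
  obtain ⟨d, hd, hball⟩ := Metric.eventually_nhds_iff_ball.1 h1
  filter_upwards [hδ.eventually_lt_const hd] with k hk
  refine (linModulus_le fun t ht => ?_).trans hc.2.le
  exact div_le_of_le_mul₀ (norm_nonneg _) hc1.le (hball t (Metric.ball_subset_ball hk.le ht))

theorem aemeasurable_linModulus [FiniteDimensional ℝ E] {Φ : 𝒪 → E → F}
    (hΦ : ∀ t, AEStronglyMeasurable (fun o => Φ o t) Q) {θ : E}
    (hd : ∀ᵐ o ∂Q, DifferentiableAt ℝ (Φ o) θ) (δ : ℝ) :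
    AEMeasurable (fun o => linModulus (Φ o) θ δ) Q := by
  unfold linModulus
  refine AEMeasurable.iSup fun j => ?_
  split_ifs
  · refine AEMeasurable.ennreal_ofReal ?_
    unfold linError
    exact (((hΦ _).sub (hΦ _)).sub
      (aestronglyMeasurable_fderiv_apply_param hΦ hd _)).norm.aemeasurable.div_const _
  · exact aemeasurable_const

theorem integrable_fderiv_param [FiniteDimensional ℝ E] {Φ : 𝒪 → E → F}
    (hΦ : ∀ t, AEStronglyMeasurable (fun o => Φ o t) Q) {θ : E} {r : ℝ} (hr : 0 < r)
    {G : 𝒪 → ℝ} (hG : Integrable G Q) (hsm : ∀ᵐ o ∂Q, ContDiffOn ℝ 1 (Φ o) (Metric.ball θ r) ∧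
      ∀ t ∈ Metric.ball θ r, ‖fderiv ℝ (Φ o) t‖ ≤ G o) :
    Integrable (fun o => fderiv ℝ (Φ o) θ) Q := by
  refine hG.mono' (aestronglyMeasurable_fderiv_param hΦ ?_) ?_
  · filter_upwards [hsm] with o ho
    exact (ho.1.differentiableOn one_ne_zero).differentiableAt (Metric.ball_mem_nhds θ hr)
  · filter_upwards [hsm] with o ho
    exact ho.2 θ (Metric.mem_ball_self hr)

/-- First-order expansion of a sample mean in the parameter, uniformly near `θ`. -/
theorem tendstoInMeasure_remainder [IsProbabilityMeasure P'] [FiniteDimensional ℝ E]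
    [CompleteSpace F] (hO : IsSample P' O Q) {Φ : 𝒪 → E → F}
    (hΦ : ∀ t, AEStronglyMeasurable (fun o => Φ o t) Q) {θ : E} {r : ℝ} (hr : 0 < r)
    {G : 𝒪 → ℝ} (hG : Integrable G Q) (hsm : ∀ᵐ o ∂Q, ContDiffOn ℝ 1 (Φ o) (Metric.ball θ r) ∧
      ∀ t ∈ Metric.ball θ r, ‖fderiv ℝ (Φ o) t‖ ≤ G o)
    {θhat : ℕ → Ω' → E} (hplim : TendstoInMeasure P' θhat atTop (fun _ => θ)) :
    TendstoInMeasure P' (fun n ω => ‖sampleMean O n ω (fun o => Φ o (θhat n ω)) -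
      sampleMean O n ω (fun o => Φ o θ) -
      (∫ o, fderiv ℝ (Φ o) θ ∂Q) (θhat n ω - θ)‖ / ‖θhat n ω - θ‖) atTop (fun _ => 0) := by
  have hdiff : ∀ᵐ o ∂Q, DifferentiableAt ℝ (Φ o) θ := by
    filter_upwards [hsm] with o ho
    exact (ho.1.differentiableOn one_ne_zero).differentiableAt (Metric.ball_mem_nhds θ hr)
  have hfi := integrable_fderiv_param hΦ hr hG hsm
  let δ : ℕ → ℝ := fun k => r / (k + 1)
  have hδ0 : ∀ k, 0 < δ k := fun k => by positivity
  have hδr : ∀ k, δ k ≤ r := fun k => div_le_self hr.le (by simp)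
  have hδ : Tendsto δ atTop (𝓝 0) := by
    have := tendsto_one_div_add_atTop_nhds_zero_nat (𝕜 := ℝ).const_mul r
    simpa [δ, div_eq_mul_inv] using this
  have hbound : ∀ k, ∀ᵐ o ∂Q, linModulus (Φ o) θ (δ k) ≤ ENNReal.ofReal (2 * G o) := fun k => by
    filter_upwards [hsm] with o ho
    exact linModulus_le fun t ht => linError_le ho.1 ho.2 (Metric.ball_subset_ball (hδr k) ht)
  have hfin : ∫⁻ o, ENNReal.ofReal (2 * G o) ∂Q ≠ ∞ :=
    ((hG.const_mul 2).lintegral_lt_top).ne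
  -- Dominated convergence: the modulus tends to zero by differentiability at `θ` and is bounded by
  -- `2 * G`.
  have hlim : Tendsto (fun k => ∫⁻ o, linModulus (Φ o) θ (δ k) ∂Q) atTop (𝓝 0) := by
    have := tendsto_lintegral_of_dominated_convergence' (μ := Q)
      (F := fun k o => linModulus (Φ o) θ (δ k)) (f := fun _ => 0) _
      (fun k => aemeasurable_linModulus hΦ hdiff (δ k)) hbound hfin
      (by filter_upwards [hdiff] with o ho using tendsto_linModulus ho hδ)
    simpa using this
  have hfinite : ∀ k, ∀ᵐ o ∂Q, linModulus (Φ o) θ (δ k) ≠ ∞ := fun k => by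
    filter_upwards [hbound k] with o ho using ne_top_of_le_ne_top ENNReal.ofReal_ne_top ho
  have hqi : ∀ k, Integrable (fun o => (linModulus (Φ o) θ (δ k)).toReal) Q := fun k =>
    integrable_toReal_of_lintegral_ne_top (aemeasurable_linModulus hΦ hdiff (δ k))
      (ne_top_of_le_ne_top hfin (lintegral_mono_ae (hbound k)))
  rw [tendstoInMeasure_iff_norm]
  intro ε hε
  obtain ⟨k, hk⟩ := (hlim.eventually_lt_const
    (show (0 : ℝ≥0∞) < ENNReal.ofReal (ε / 3) by simpa using hε)).exists
  have hEk : ∫ o, (linModulus (Φ o) θ (δ k)).toReal ∂Q < ε / 3 := by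
    rw [integral_toReal (aemeasurable_linModulus hΦ hdiff (δ k))
      ((hfinite k).mono fun o ho => ho.lt_top)]
    exact (ENNReal.lt_ofReal_iff_toReal_lt (ne_top_of_lt hk)).1 hk
  have hlln1 := hO.tendstoInMeasure_sampleMean (hqi k)
  have hlln2 := hO.tendstoInMeasure_sampleMean hfi
  rw [tendstoInMeasure_iff_norm] at hplim hlln1 hlln2
  -- Three events of vanishing probability are discarded: `θhat` outside the ball of radius `δ k`,
  -- the mean modulus exceeding its expectation by `ε / 3`, and the mean derivative being off by `ε
  -- / 3`. Elsewhere the relative remainder is at most `M + ‖D‖`, with `M < 2ε / 3` and `‖D‖ < ε /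
  -- 3`.
  have hsum := ((hplim (δ k) (hδ0 k)).add (hlln1 (ε / 3) (by positivity))).add
    (hlln2 (ε / 3) (by positivity))
  simp only [add_zero] at hsum
  refine tendsto_of_tendsto_of_tendsto_of_le_of_le tendsto_const_nhds hsum (fun _ => zero_le)
    fun n => ?_
  refine le_trans (measure_mono_ae ?_) ((measure_union_le _ _).trans
    (add_le_add_left (measure_union_le _ _) _))
  filter_upwards [hO.ae_forall hsm, hO.ae_forall (hfinite k)] with ω hω hωf hε'
  by_contra hc
  change ¬ (ω ∈ (_ : Set Ω')) at hc
  simp only [Set.mem_union, Set.mem_ofPred_eq, not_or, not_le] at hc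
  obtain ⟨⟨hc1, hc2⟩, hc3⟩ := hc
  change ε ≤ _ at hε'
  rw [sub_zero, norm_div, norm_norm, norm_norm] at hε'
  set T := θhat n ω
  set M := sampleMean O n ω fun o => (linModulus (Φ o) θ (δ k)).toReal
  set D := sampleMean O n ω (fun o => fderiv ℝ (Φ o) θ) - ∫ o, fderiv ℝ (Φ o) θ ∂Q
  have hT : T ∈ Metric.ball θ (δ k) := by rwa [mem_ball_iff_norm]
  have hmain : ‖sampleMean O n ω (fun o => Φ o T) - sampleMean O n ω (fun o => Φ o θ) -
      (∫ o, fderiv ℝ (Φ o) θ ∂Q) (T - θ)‖ ≤ (M + ‖D‖) * ‖T - θ‖ := by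
    have hsplit : sampleMean O n ω (fun o => Φ o T) - sampleMean O n ω (fun o => Φ o θ) -
        (∫ o, fderiv ℝ (Φ o) θ ∂Q) (T - θ) =
        sampleMean O n ω (fun o => Φ o T - Φ o θ - fderiv ℝ (Φ o) θ (T - θ)) + D (T - θ) := by
      rw [sampleMean_sub, sampleMean_sub, sampleMean_clm_apply, _root_.sub_apply]
      abel
    rw [hsplit, add_mul]
    refine (norm_add_le _ _).trans (add_le_add (norm_sampleMean_le fun i => ?_)
      (ContinuousLinearMap.le_opNorm _ _))
    rw [linError_mul]
    gcongr
    rw [← ENNReal.ofReal_le_iff_le_toReal (hωf i)]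
    exact le_linModulus ((hω i).1.continuousOn.mono (Metric.ball_subset_ball (hδr k))) hT
  have h4 : M + ‖D‖ < ε := by
    have := (abs_lt.1 (Real.norm_eq_abs _ ▸ hc2)).2
    linarith
  by_cases hT0 : ‖T - θ‖ = 0
  · rw [hT0, div_zero] at hε'
    linarith
  · have hpos : 0 < ‖T - θ‖ := lt_of_le_of_ne (norm_nonneg _) (Ne.symm hT0)
    rw [le_div_iff₀ hpos] at hε'
    nlinarith

end Remainder

/-! ### Products and finite sums in probability -/

section InProbability

variable {Ω' : Type*} [MeasurableSpace Ω'] {P' : Measure Ω'}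

theorem tendstoInMeasure_zero_mul {f g : ℕ → Ω' → ℝ}
    (hf : TendstoInMeasure P' f atTop (fun _ => 0))
    (hg : TendstoInMeasure P' g atTop (fun _ => 0)) :
    TendstoInMeasure P' (fun n ω => f n ω * g n ω) atTop (fun _ => 0) := by
  refine tendstoInMeasure_zero_of_norm_le (B := fun n => {ω | 1 ≤ ‖f n ω - 0‖})
    (tendstoInMeasure_zero_norm hg) ((tendstoInMeasure_iff_norm.1 hf) 1 one_pos)
    fun n => ae_of_all _ fun ω hω => ?_
  simp only [sub_zero, Set.mem_ofPred_eq, not_le] at hω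
  rw [norm_mul]
  exact mul_le_of_le_one_left (norm_nonneg _) hω.le

theorem BoundedInProb.sum {ι : Type*} {s : ι → ℕ → Ω' → ℝ} (I : Finset ι)
    (hs : ∀ i ∈ I, BoundedInProb P' (s i)) : BoundedInProb P' (fun n ω => ∑ i ∈ I, s i n ω) := by
  classical
  induction I using Finset.induction_on with
  | empty =>
    exact fun ε _ => ⟨1, one_pos, fun n => by simp [show ¬ (1 : ℝ) ≤ 0 by norm_num]⟩
  | insert i I hi ih =>
    simp only [Finset.sum_insert hi]
    exact (hs i (Finset.mem_insert_self i I)).add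
      (ih fun j hj => hs j (Finset.mem_insert_of_mem hj))

theorem BoundedInProb.const_mul {s : ℕ → Ω' → ℝ} (hs : BoundedInProb P' s) (c : ℝ) :
    BoundedInProb P' (fun n ω => c * s n ω) := by
  intro ε hε
  obtain ⟨K, hK, h1⟩ := hs ε hε
  refine ⟨(|c| + 1) * K, by positivity, fun n => (measure_mono fun ω hω => ?_).trans (h1 n)⟩
  simp only [Set.mem_ofPred_eq, abs_mul] at hω ⊢
  by_contra hc
  push Not at hc
  have h2 : |c| * |s n ω| ≤ (|c| + 1) * |s n ω| :=
    mul_le_mul_of_nonneg_right (by linarith) (abs_nonneg _)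
  have h3 : (|c| + 1) * |s n ω| < (|c| + 1) * K := mul_lt_mul_of_pos_left hc (by positivity)
  linarith

end InProbability

/-! ### Root-n rate and central limit theorem -/

section RootN

variable {Ω' 𝒪 E : Type*} [MeasurableSpace Ω'] [MeasurableSpace 𝒪] {P' : Measure Ω'}
  [IsProbabilityMeasure P'] {O : ℕ → Ω' → 𝒪} {Q : Measure 𝒪} [NormedAddCommGroup E]
  [NormedSpace ℝ E]

theorem IsSample.memLp_comp (hO : IsSample P' O Q) {f : 𝒪 → ℝ} (hf : MemLp f 2 Q) (i : ℕ) :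
    MemLp (fun ω => f (O i ω)) 2 P' := by
  rw [← hO.map_eq i] at hf
  exact hf.comp_of_map (hO.measurable i).aemeasurable

theorem IsSample.integral_comp (hO : IsSample P' O Q) {f : 𝒪 → ℝ} (hf : Measurable f) (i : ℕ) :
    ∫ ω, f (O i ω) ∂P' = ∫ o, f o ∂Q := by
  rw [← hO.map_eq i, integral_map (hO.measurable i).aemeasurable hf.aestronglyMeasurable]

theorem IsSample.variance_comp (hO : IsSample P' O Q) {f : 𝒪 → ℝ} (hf : Measurable f) (i : ℕ) :
    Var[fun ω => f (O i ω); P'] = Var[f; Q] := by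
  rw [← hO.map_eq i, variance_map hf.aemeasurable (hO.measurable i).aemeasurable]
  rfl

theorem IsSample.isProbabilityMeasure (hO : IsSample P' O Q) : IsProbabilityMeasure Q := by
  rw [← hO.map_eq 0]
  exact Measure.isProbabilityMeasure_map (hO.measurable 0).aemeasurable

/-- By pairwise independence the second moment of the scaled mean is at most `Var[f]` for every `n`,
and Chebyshev's inequality applies. -/
theorem IsSample.boundedInProb_sqrt_mul_sampleMean (hO : IsSample P' O Q) {f : 𝒪 → ℝ}
    (hfm : Measurable f) (hf : MemLp f 2 Q) (h0 : ∫ o, f o ∂Q = 0) :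
    BoundedInProb P' (fun n ω => √(n : ℝ) * sampleMean O n ω f) := by
  have hmem : ∀ n : ℕ, MemLp (fun ω => √(n : ℝ) * sampleMean O n ω f) 2 P' := fun n =>
    ((memLp_finsetSum _ fun i _ => hO.memLp_comp hf i).const_mul ((n : ℝ)⁻¹)).const_mul _
  refine boundedInProb_of_lintegral_sq_le (C := ENNReal.ofReal Var[f; Q])
    (fun n => (hmem n).1.aemeasurable) ENNReal.ofReal_ne_top fun n => ?_
  have hmean : ∫ ω, √(n : ℝ) * sampleMean O n ω f ∂P' = 0 := by
    simp only [sampleMean, smul_eq_mul]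
    rw [integral_const_mul, integral_const_mul, integral_finsetSum]
    · simp [hO.integral_comp hfm, h0]
    · exact fun i _ => (hO.memLp_comp hf i).integrable one_le_two
  have hvar : Var[fun ω => √(n : ℝ) * sampleMean O n ω f; P'] ≤ Var[f; Q] := by
    simp only [sampleMean, smul_eq_mul]
    rw [variance_const_mul, variance_const_mul]
    have hs := IndepFun.variance_sum (μ := P') (X := fun i ω => f (O i ω)) (s := Finset.range n)
      (fun i _ => hO.memLp_comp hf i)
      (fun i _ j _ hij => (hO.indep.indepFun hij).comp hfm hfm)
    have heq : (∑ i ∈ Finset.range n, fun ω => f (O i ω)) =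
        fun ω => ∑ i ∈ Finset.range n, f (O i ω) := by
      ext ω; simp
    rw [heq] at hs
    rw [hs]
    simp only [hO.variance_comp hfm, Finset.sum_const, Finset.card_range, nsmul_eq_mul]
    rw [Real.sq_sqrt (Nat.cast_nonneg n)]
    rcases Nat.eq_zero_or_pos n with rfl | hn
    · simp [variance_nonneg]
    · have : (n : ℝ) ≠ 0 := by positivity
      refine le_of_eq ?_
      field_simp
  calc ∫⁻ ω, ‖√(n : ℝ) * sampleMean O n ω f‖ₑ ^ 2 ∂P'
      = eVar[fun ω => √(n : ℝ) * sampleMean O n ω f; P'] := by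
        simp [evariance, hmean]
    _ = ENNReal.ofReal Var[fun ω => √(n : ℝ) * sampleMean O n ω f; P'] :=
        ((hmem n).ofReal_variance_eq).symm
    _ ≤ _ := ENNReal.ofReal_le_ofReal hvar

theorem IsSample.boundedInProb_sqrt_mul_norm_sampleMean [FiniteDimensional ℝ E]
    [MeasurableSpace E] [BorelSpace E] (hO : IsSample P' O Q) {f : 𝒪 → E}
    (hfm : Measurable f) (hf : MemLp f 2 Q) (h0 : ∫ o, f o ∂Q = 0) :
    BoundedInProb P' (fun n ω => √(n : ℝ) * ‖sampleMean O n ω f‖) := by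
  have := hO.isProbabilityMeasure
  let b := Module.finBasis ℝ E
  let c := fun i => LinearMap.toContinuousLinearMap (b.coord i)
  have hi : ∀ i, BoundedInProb P' (fun n ω => √(n : ℝ) * sampleMean O n ω (fun o => c i (f o))) :=
    fun i => hO.boundedInProb_sqrt_mul_sampleMean ((c i).measurable.comp hfm)
      ((c i).comp_memLp' hf)
      (by rw [(c i).integral_comp_comm (hf.integrable one_le_two), h0, map_zero])
  have habs : ∀ i, BoundedInProb P' (fun n ω => ‖b i‖ *
      |√(n : ℝ) * sampleMean O n ω (fun o => c i (f o))|) :=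
    fun i => ((hi i).mono fun n ω => by rw [abs_abs]).const_mul _
  refine (BoundedInProb.sum Finset.univ fun i _ => habs i).mono fun n ω => ?_
  refine le_trans ?_ (le_abs_self _)
  rw [abs_mul, abs_norm, abs_of_nonneg (Real.sqrt_nonneg _)]
  have hx : ‖sampleMean O n ω f‖ ≤
      ∑ i, ‖b i‖ * |sampleMean O n ω (fun o => c i (f o))| := by
    conv_lhs => rw [← b.sum_repr (sampleMean O n ω f)]
    refine (norm_sum_le _ _).trans (Finset.sum_le_sum fun i _ => ?_)
    rw [norm_smul, mul_comm, sampleMean_clm]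
    rfl
  refine (mul_le_mul_of_nonneg_left hx (Real.sqrt_nonneg _)).trans (le_of_eq ?_)
  rw [Finset.mul_sum]
  refine Finset.sum_congr rfl fun i _ => ?_
  rw [abs_mul, abs_of_nonneg (Real.sqrt_nonneg _)]
  ring

/-- Central limit theorem for sample means. -/
theorem IsSample.tendstoInDistribution_sqrt_mul_sampleMean (hO : IsSample P' O Q) {f : 𝒪 → ℝ}
    (hfm : Measurable f) (hf : MemLp f 2 Q) (h0 : ∫ o, f o ∂Q = 0) :
    TendstoInDistribution (fun (n : ℕ) ω => √(n : ℝ) * sampleMean O n ω f) atTop (id : ℝ → ℝ)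
      (fun _ => P') (gaussianReal 0 Var[f; Q].toNNReal) := by
  have hclt := tendstoInDistribution_inv_sqrt_mul_sum_sub (P := P')
    (P' := gaussianReal 0 Var[f; Q].toNNReal) (X := fun i ω => f (O i ω)) (Y := (id : ℝ → ℝ))
    (by rw [hO.variance_comp hfm 0]; exact HasLaw.id) (hO.memLp_comp hf 0)
    (hO.indep.comp (fun _ => f) fun _ => hfm) (fun i => hO.identDistrib hfm i)
  convert! hclt using 3 with n ω
  have hE := hO.integral_comp hfm 0
  rw [h0] at hE
  rw [hE, mul_zero, sub_zero, sampleMean, smul_eq_mul, ← mul_assoc]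
  congr 1
  rcases Nat.eq_zero_or_pos n with rfl | hn
  · simp
  · have h1 : √(n : ℝ) ≠ 0 := by positivity
    have h2 : (n : ℝ) = √(n : ℝ) * √(n : ℝ) := (Real.mul_self_sqrt (Nat.cast_nonneg n)).symm
    conv_lhs => rw [h2]
    simp only [Real.sqrt_mul_self (Real.sqrt_nonneg _)]
    field_simp

end RootN

/-! ### Asymptotics of Z-estimators and plug-in means -/

section ZEstimation

variable {Ω' 𝒪 E : Type*} [MeasurableSpace Ω'] [MeasurableSpace 𝒪] {P' : Measure Ω'}
  [IsProbabilityMeasure P'] {O : ℕ → Ω' → 𝒪} {Q : Measure 𝒪} [NormedAddCommGroup E]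
  [NormedSpace ℝ E] [FiniteDimensional ℝ E] [MeasurableSpace E] [BorelSpace E]
  {Ψ : 𝒪 → E → E} {φ : 𝒪 → E → ℝ} {θhat : ℕ → Ω' → E} {θ : E}

theorem tendstoInMeasure_zero_norm_sub (hθ : TendstoInMeasure P' θhat atTop (fun _ => θ)) :
    TendstoInMeasure P' (fun n ω => ‖θhat n ω - θ‖) atTop (fun _ => (0 : ℝ)) :=
  tendstoInMeasure_zero_norm (tendstoInMeasure_zero_sub_iff.2 hθ)

/-- The probability limit of a Z-estimator solves the population estimating equation. -/
theorem integral_system_eq_zero (hO : IsSample P' O Q) (hΨ : Measurable (Function.uncurry Ψ))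
    (hreg : ZRegular Q Ψ φ θ) (hz : IsZEstimator P' O Ψ θhat θ) : ∫ o, Ψ o θ ∂Q = 0 := by
  have := hO.isProbabilityMeasure
  obtain ⟨r, hr, G, hG, hsm⟩ := hreg.smooth
  have hrem := tendstoInMeasure_remainder (Φ := Ψ) hO
    (fun t => (hΨ.comp (measurable_id.prodMk measurable_const)).aestronglyMeasurable) hr hG
    (hsm.mono fun o ho => ⟨ho.1, fun t ht => (ho.2.2 t ht).1⟩) hz.plim
  have hΔ := tendstoInMeasure_zero_norm_sub hz.plim
  have hlln := hO.tendstoInMeasure_sampleMean (hreg.memLp_system.integrable one_le_two)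
  have h0 : TendstoInMeasure P' (fun n ω => sampleMean O n ω (fun o => Ψ o θ)) atTop
      (fun _ => 0) := by
    refine tendstoInMeasure_zero_of_norm_le_ae (tendstoInMeasure_zero_add
      (tendstoInMeasure_zero_add (tendstoInMeasure_zero_norm hz.root)
        (tendstoInMeasure_zero_const_mul ‖∫ o, fderiv ℝ (Ψ o) θ ∂Q‖ hΔ))
      (tendstoInMeasure_zero_mul hrem hΔ)) fun n => ae_of_all _ fun ω => ?_
    set J := ∫ o, fderiv ℝ (Ψ o) θ ∂Q
    set a := sampleMean O n ω (fun o => Ψ o (θhat n ω)) with ha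
    set b := sampleMean O n ω (fun o => Ψ o θ)
    set Δ := θhat n ω - θ with hΔ'
    -- A root up to `o_p(n^{-1/2})` is in particular one up to `o_p(1)`; for `n = 0` the empty mean
    -- vanishes.
    have h1 : ‖a‖ ≤ ‖√(n : ℝ) • a‖ := by
      rcases Nat.eq_zero_or_pos n with hn | hn
      · have : a = 0 := by rw [ha, sampleMean, hn]; simp
        simp [this]
      · rw [norm_smul, Real.norm_of_nonneg (Real.sqrt_nonneg _)]
        refine le_mul_of_one_le_left (norm_nonneg _) (Real.one_le_sqrt.2 ?_)
        exact_mod_cast hn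
    have h2 : ‖a - b - J Δ‖ / ‖Δ‖ * ‖Δ‖ = ‖a - b - J Δ‖ := by
      by_cases hd : Δ = 0
      · have : a = b := by
          have : θhat n ω = θ := sub_eq_zero.1 hd
          simp only [a, b, this]
        simp [hd, this]
      · exact div_mul_cancel₀ _ (norm_ne_zero_iff.2 hd)
    rw [h2]
    have h3 : b = a - J Δ - (a - b - J Δ) := by abel
    calc ‖b‖ = ‖a - J Δ - (a - b - J Δ)‖ := by rw [← h3]
      _ ≤ ‖a‖ + ‖J Δ‖ + ‖a - b - J Δ‖ :=
        (norm_sub_le _ _).trans (add_le_add_left (norm_sub_le _ _) _)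
      _ ≤ _ := by
        gcongr
        exact J.le_opNorm _
  -- Both limits in probability are constants, so their almost sure equality at a single point
  -- suffices.
  have := tendstoInMeasure_ae_unique hlln h0
  obtain ⟨ω, hω⟩ := this.exists
  exact hω

/-- Plug-in estimators based on Z-estimators are consistent and asymptotically normal. -/
theorem isCAN_plugIn (hO : IsSample P' O Q) (hΨ : Measurable (Function.uncurry Ψ))
    (hφ : Measurable (Function.uncurry φ)) (hreg : ZRegular Q Ψ φ θ)
    (hz : IsZEstimator P' O Ψ θhat θ) {ψ : ℝ} (hψ : ∫ o, φ o θ ∂Q = ψ) :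
    IsCAN P' (plugIn O φ θhat) ψ (asympVar Q Ψ φ ψ θ) := by
  have := hO.isProbabilityMeasure
  obtain ⟨r, hr, G, hG, hsm⟩ := hreg.smooth
  have hΨθ : Measurable (fun o => Ψ o θ) := hΨ.comp (measurable_id.prodMk measurable_const)
  have hφθ : Measurable (fun o => φ o θ) := hφ.comp (measurable_id.prodMk measurable_const)
  have hρ := tendstoInMeasure_remainder (Φ := Ψ) hO
    (fun t => (hΨ.comp (measurable_id.prodMk measurable_const)).aestronglyMeasurable) hr hG
    (hsm.mono fun o ho => ⟨ho.1, fun t ht => (ho.2.2 t ht).1⟩) hz.plim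
  have hσ := tendstoInMeasure_remainder (Φ := φ) hO
    (fun t => (hφ.comp (measurable_id.prodMk measurable_const)).aestronglyMeasurable) hr hG
    (hsm.mono fun o ho => ⟨ho.2.1, fun t ht => (ho.2.2 t ht).2⟩) hz.plim
  have hΔ := tendstoInMeasure_zero_norm_sub hz.plim
  have hΨ0 := integral_system_eq_zero hO hΨ hreg hz
  set J := ∫ o, fderiv ℝ (Ψ o) θ ∂Q with hJ
  set L := ∫ o, fderiv ℝ (φ o) θ ∂Q with hL
  have hinv : ∀ v, Ring.inverse J (J v) = v := fun v => by
    have := congrArg (fun A : E →L[ℝ] E => A v) (Ring.inverse_mul_cancel J hreg.nonsingular)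
    simpa using this
  have hmulσ : ∀ n ω, ‖sampleMean O n ω (fun o => φ o (θhat n ω)) -
      sampleMean O n ω (fun o => φ o θ) - L (θhat n ω - θ)‖ / ‖θhat n ω - θ‖ * ‖θhat n ω - θ‖ =
      ‖sampleMean O n ω (fun o => φ o (θhat n ω)) -
      sampleMean O n ω (fun o => φ o θ) - L (θhat n ω - θ)‖ := fun n ω => by
    by_cases hd : θhat n ω = θ
    · simp [hd]
    · exact div_mul_cancel₀ _ (norm_ne_zero_iff.2 (sub_ne_zero.2 hd))
  have hmulρ : ∀ n ω, ‖sampleMean O n ω (fun o => Ψ o (θhat n ω)) -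
      sampleMean O n ω (fun o => Ψ o θ) - J (θhat n ω - θ)‖ / ‖θhat n ω - θ‖ * ‖θhat n ω - θ‖ =
      ‖sampleMean O n ω (fun o => Ψ o (θhat n ω)) -
      sampleMean O n ω (fun o => Ψ o θ) - J (θhat n ω - θ)‖ := fun n ω => by
    by_cases hd : θhat n ω = θ
    · simp [hd]
    · exact div_mul_cancel₀ _ (norm_ne_zero_iff.2 (sub_ne_zero.2 hd))
  set ρ : ℕ → Ω' → ℝ := fun n ω => ‖sampleMean O n ω (fun o => Ψ o (θhat n ω)) -
      sampleMean O n ω (fun o => Ψ o θ) - J (θhat n ω - θ)‖ / ‖θhat n ω - θ‖ with hρdef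
  set σ : ℕ → Ω' → ℝ := fun n ω => ‖sampleMean O n ω (fun o => φ o (θhat n ω)) -
      sampleMean O n ω (fun o => φ o θ) - L (θhat n ω - θ)‖ / ‖θhat n ω - θ‖ with hσdef
  have hρ0 : ∀ n ω, 0 ≤ ρ n ω := fun n ω => by simp only [hρdef]; positivity
  have hσ0 : ∀ n ω, 0 ≤ σ n ω := fun n ω => by simp only [hσdef]; positivity
  constructor
  · have hlln := hO.tendstoInMeasure_sampleMean (hreg.memLp_target.integrable one_le_two)
    rw [hψ] at hlln
    refine tendstoInMeasure_zero_sub_iff.1 (tendstoInMeasure_zero_of_norm_le_ae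
      (tendstoInMeasure_zero_add (tendstoInMeasure_zero_add (tendstoInMeasure_zero_mul hσ hΔ)
        (tendstoInMeasure_zero_const_mul ‖L‖ hΔ))
        (tendstoInMeasure_zero_norm (tendstoInMeasure_zero_sub_iff.2 hlln)))
      fun n => ae_of_all _ fun ω => ?_)
    rw [hmulσ]
    have h3 : plugIn O φ θhat n ω - ψ = (sampleMean O n ω (fun o => φ o (θhat n ω)) -
        sampleMean O n ω (fun o => φ o θ) - L (θhat n ω - θ)) + L (θhat n ω - θ) +
        (sampleMean O n ω (fun o => φ o θ) - ψ) := by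
      rw [plugIn]; ring
    rw [h3]
    refine (norm_add_le _ _).trans (add_le_add_left ((norm_add_le _ _).trans ?_) _)
    gcongr
    exact L.le_opNorm _
  · let K : E →L[ℝ] ℝ := L.comp (Ring.inverse J)
    have hfm : Measurable fun o => φ o θ - ψ - L (Ring.inverse J (Ψ o θ)) :=
      (hφθ.sub_const ψ).sub (K.measurable.comp hΨθ)
    have hKmem : MemLp (fun o => K (Ψ o θ)) 2 Q := K.comp_memLp' hreg.memLp_system
    have hf : MemLp (fun o => φ o θ - ψ - L (Ring.inverse J (Ψ o θ))) 2 Q :=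
      (hreg.memLp_target.sub (memLp_const ψ)).sub hKmem
    have h0 : ∫ o, (φ o θ - ψ - L (Ring.inverse J (Ψ o θ))) ∂Q = 0 := by
      have hi1 := hreg.memLp_target.integrable one_le_two
      have hi2 := hreg.memLp_system.integrable one_le_two
      have hK0 : ∫ o, K (Ψ o θ) ∂Q = 0 := by
        rw [K.integral_comp_comm hi2, hΨ0, map_zero]
      have : ∫ o, (φ o θ - ψ - K (Ψ o θ)) ∂Q = 0 := by
        have hi3 : Integrable (fun o => φ o θ - ψ) Q := hi1.sub (integrable_const _)
        rw [integral_sub hi3 (hKmem.integrable one_le_two),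
          integral_sub hi1 (integrable_const _), hψ, hK0]
        simp
      exact this
    have hclt := hO.tendstoInDistribution_sqrt_mul_sampleMean hfm hf h0
    refine tendstoInDistribution_of_tendstoInMeasure_sub _ _ hclt ?_ fun n => ?_
    swap
    · exact (((measurable_sampleMean hO hφ (hz.measurable n) n).sub_const ψ).const_mul
        _).aemeasurable
    have hS := hO.boundedInProb_sqrt_mul_norm_sampleMean hΨθ hreg.memLp_system hΨ0
    have he := tendstoInMeasure_zero_norm hz.root
    -- This is the coefficient of `‖a‖ + ‖b‖` in the final bound; it is `o_p(1)`, while `√n * ‖b‖`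
    -- is bounded in probability and `√n * ‖a‖` tends to zero.
    have hcoef := (tendstoInMeasure_zero_const_mul (2 * ‖Ring.inverse J‖)
      (tendstoInMeasure_zero_add hσ (tendstoInMeasure_zero_const_mul ‖K‖ hρ)))
    -- Off this event `‖J⁻¹‖ * ρ < 1 / 2`, which permits absorbing the remainder of the expansion of
    -- `Ψ` into `‖θhat - θ‖`.
    have hB := (tendstoInMeasure_iff_norm.1
      (tendstoInMeasure_zero_const_mul ‖Ring.inverse J‖ hρ)) (1 / 2) (by norm_num)
    refine tendstoInMeasure_zero_of_norm_le (tendstoInMeasure_zero_add (tendstoInMeasure_zero_add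
      (tendstoInMeasure_zero_const_mul ‖K‖ he) (tendstoInMeasure_zero_mul hcoef he))
      (hS.mul_tendstoInMeasure_zero hcoef)) hB fun n => ae_of_all _ fun ω hω => ?_
    simp only [sub_zero, Set.mem_ofPred_eq, not_le, norm_mul, norm_norm,
      Real.norm_of_nonneg (hρ0 n ω)] at hω
    have hσn := hmulσ n ω
    have hρn := hmulρ n ω
    change σ n ω * _ = _ at hσn
    change ρ n ω * _ = _ at hρn
    have hinf : √(n : ℝ) * sampleMean O n ω (fun o => φ o θ - ψ - L (Ring.inverse J (Ψ o θ))) =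
        √(n : ℝ) * (sampleMean O n ω (fun o => φ o θ) - ψ -
          K (sampleMean O n ω (fun o => Ψ o θ))) := by
      rw [← sampleMean_clm O n ω (fun o => Ψ o θ) K, sampleMean_sub, sampleMean_sub]
      -- The empty mean of the constant `ψ` is `0`, not `ψ`; for `n = 0` the identity holds because
      -- of the factor `√n`.
      rcases Nat.eq_zero_or_pos n with hn | hn
      · simp [hn]
      · have : sampleMean O n ω (fun _ => ψ) = ψ := by
          simp only [sampleMean, Finset.sum_const, Finset.card_range, nsmul_eq_mul, smul_eq_mul]
          field_simp
        rw [this]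
        rfl
    rw [Pi.sub_apply, Pi.sub_apply, hinf, plugIn]
    set a := sampleMean O n ω (fun o => Ψ o (θhat n ω))
    set b := sampleMean O n ω (fun o => Ψ o θ)
    set p := sampleMean O n ω (fun o => φ o (θhat n ω))
    set q := sampleMean O n ω (fun o => φ o θ)
    set Δ := θhat n ω - θ
    set s := √(n : ℝ)
    have hs : 0 ≤ s := Real.sqrt_nonneg _
    have hsa : ‖s • a‖ = s * ‖a‖ := by rw [norm_smul, Real.norm_of_nonneg hs]
    have hΔeq : Δ = Ring.inverse J (a - b - (a - b - J Δ)) := by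
      rw [sub_sub_cancel, hinv]
    have hΔle : ‖Δ‖ ≤ ‖Ring.inverse J‖ * (‖a‖ + ‖b‖ + ρ n ω * ‖Δ‖) := by
      conv_lhs => rw [hΔeq]
      refine (ContinuousLinearMap.le_opNorm _ _).trans ?_
      gcongr
      rw [hρn]
      exact (norm_sub_le _ _).trans (add_le_add_left (norm_sub_le _ _) _)
    have hΔle2 : ‖Δ‖ ≤ 2 * ‖Ring.inverse J‖ * (‖a‖ + ‖b‖) := by
      have : ‖Ring.inverse J‖ * ρ n ω * ‖Δ‖ ≤ 1 / 2 * ‖Δ‖ := by gcongr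
      nlinarith
    have hKΔ : K (J Δ) = L Δ := by simp only [K, ContinuousLinearMap.comp_apply, hinv]
    -- Subtracting the influence function leaves the remainder of `φ`, the estimating-equation error
    -- `K a`, and `K` of the remainder of `Ψ`, because `K ∘ J = L`.
    have hmain : s * (p - ψ) - s * (q - ψ - K b) =
        s * ((p - q - L Δ) + K a - K (a - b - J Δ)) := by
      rw [K.map_sub, K.map_sub, hKΔ]; ring
    rw [hmain, norm_mul, Real.norm_of_nonneg hs, hsa]
    have h1 : ‖(p - q - L Δ) + K a - K (a - b - J Δ)‖ ≤
        σ n ω * ‖Δ‖ + ‖K‖ * ‖a‖ + ‖K‖ * (ρ n ω * ‖Δ‖) := by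
      refine (norm_sub_le _ _).trans (add_le_add ((norm_add_le _ _).trans (add_le_add ?_ ?_)) ?_)
      · rw [hσn]
      · exact K.le_opNorm _
      · rw [hρn]
        exact K.le_opNorm _
    have h2 : (σ n ω + ‖K‖ * ρ n ω) * ‖Δ‖ ≤
        (σ n ω + ‖K‖ * ρ n ω) * (2 * ‖Ring.inverse J‖ * (‖a‖ + ‖b‖)) :=
      mul_le_mul_of_nonneg_left hΔle2
        (add_nonneg (hσ0 n ω) (mul_nonneg (norm_nonneg _) (hρ0 n ω)))
    calc s * ‖(p - q - L Δ) + K a - K (a - b - J Δ)‖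
        ≤ s * (‖K‖ * ‖a‖ + (σ n ω + ‖K‖ * ρ n ω) * (2 * ‖Ring.inverse J‖ * (‖a‖ + ‖b‖))) := by
          gcongr
          linarith
      _ = _ := by ring

end ZEstimation

/-! ### Residuals with conditional mean zero and unbounded weights -/

section CondMean

variable {Ω : Type*} {m m₁ m₂ mΩ : MeasurableSpace Ω} {P : Measure Ω}
  {D D₁ D₂ f g w : Ω → ℝ}

/-- `D` is integrable and has conditional mean zero given `m`. -/
def CondMeanZero (m : MeasurableSpace Ω) {mΩ : MeasurableSpace Ω} (P : Measure Ω) (D : Ω → ℝ) :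
    Prop :=
  Integrable D P ∧ P[D | m] =ᵐ[P] 0

namespace CondMeanZero

theorem congr (h : CondMeanZero m P D₁) (hD : D₁ =ᵐ[P] D₂) : CondMeanZero m P D₂ :=
  ⟨h.1.congr hD, (condExp_congr_ae hD).symm.trans h.2⟩

theorem add (h₁ : CondMeanZero m P D₁) (h₂ : CondMeanZero m P D₂) :
    CondMeanZero m P (fun ω => D₁ ω + D₂ ω) := by
  refine ⟨h₁.1.add h₂.1, (condExp_add h₁.1 h₂.1 m).trans ?_⟩
  filter_upwards [h₁.2, h₂.2] with ω h1 h2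
  simp [h1, h2]

theorem sub (h₁ : CondMeanZero m P D₁) (h₂ : CondMeanZero m P D₂) :
    CondMeanZero m P (fun ω => D₁ ω - D₂ ω) := by
  refine ⟨h₁.1.sub h₂.1, (condExp_sub h₁.1 h₂.1 m).trans ?_⟩
  filter_upwards [h₁.2, h₂.2] with ω h1 h2
  simp [h1, h2]

theorem mul (h : CondMeanZero m P D) (hg : StronglyMeasurable[m] g)
    (hi : Integrable (fun ω => g ω * D ω) P) : CondMeanZero m P (fun ω => g ω * D ω) := by
  refine ⟨hi, (condExp_mul_of_stronglyMeasurable_left hg hi h.1).trans ?_⟩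
  filter_upwards [h.2] with ω h1
  simp [h1]

theorem mul_of_bound (hm : m ≤ mΩ) (h : CondMeanZero m P D) (hg : StronglyMeasurable[m] g) {C : ℝ}
    (hC : ∀ᵐ ω ∂P, |g ω| ≤ C) : CondMeanZero m P (fun ω => g ω * D ω) :=
  h.mul hg (h.1.bdd_mul (hg.mono hm).aestronglyMeasurable hC)

theorem mono [IsFiniteMeasure P] (hm : m₁ ≤ m₂) (hm₂ : m₂ ≤ mΩ) (h : CondMeanZero m₂ P D) :
    CondMeanZero m₁ P D := by
  refine ⟨h.1, (condExp_condExp_of_le hm hm₂).symm.trans ?_⟩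
  refine (condExp_congr_ae h.2).trans ?_
  simp

theorem integral_eq_zero [IsFiniteMeasure P] (hm : m ≤ mΩ) (h : CondMeanZero m P D) :
    ∫ ω, D ω ∂P = 0 := by
  rw [← integral_condExp hm, integral_congr_ae h.2]
  simp

theorem ae_eq_zero [IsFiniteMeasure P] (hm : m ≤ mΩ) (h : CondMeanZero m P D)
    (hD : StronglyMeasurable[m] D) : D =ᵐ[P] 0 := by
  have := h.2
  rwa [condExp_of_stronglyMeasurable hm hD h.1] at this

end CondMeanZero

theorem condMeanZero_sub_of_condExp_eq [IsFiniteMeasure P] (hf : Integrable f P)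
    (h : P[f | m] =ᵐ[P] g) (hm : m ≤ mΩ) (hg : StronglyMeasurable[m] g) :
    CondMeanZero m P (fun ω => f ω - g ω) := by
  have hgi : Integrable g P := integrable_condExp.congr h
  refine ⟨hf.sub hgi, (condExp_sub hf hgi m).trans ?_⟩
  rw [condExp_of_stronglyMeasurable hm hg hgi]
  filter_upwards [h] with ω h1
  simp [h1]

/-- The sets `{|w| ≤ K}` increase to the whole space, so an identity for bounded weights extends to
unbounded ones as soon as the complete integrand is integrable. -/
theorem integral_eq_zero_of_truncation (hf : Integrable f P) (hw : Measurable w)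
    (h : ∀ K : ℕ, ∫ ω in {ω | |w ω| ≤ K}, f ω ∂P = 0) : ∫ ω, f ω ∂P = 0 := by
  have hU : (⋃ K : ℕ, {ω | |w ω| ≤ (K : ℝ)}) = Set.univ := by
    refine Set.eq_univ_of_forall fun ω => Set.mem_iUnion.2 ?_
    exact exists_nat_ge |w ω|
  have := tendsto_setIntegral_of_monotone (μ := P) (f := f)
    (s := fun K : ℕ => {ω | |w ω| ≤ (K : ℝ)})
    (fun K => measurableSet_le hw.abs measurable_const)
    (fun i j hij ω hω => le_trans (show |w ω| ≤ i from hω) (by exact_mod_cast hij))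
    hf.integrableOn
  rw [hU, setIntegral_univ] at this
  simp only [h] at this
  exact tendsto_nhds_unique this tendsto_const_nhds

theorem measurable_indicator_le {w : Ω → ℝ} (hw : StronglyMeasurable[m] w) (K : ℝ) :
    StronglyMeasurable[m] ({ω | |w ω| ≤ K}.indicator (fun _ => (1 : ℝ))) := by
  refine StronglyMeasurable.indicator stronglyMeasurable_const ?_
  exact hw.norm.measurableSet_le stronglyMeasurable_const

/-- Only the sum is assumed integrable; its terms need not be. Truncating by the sum of the absolute
weights bounds all of them at once without leaving the conditioning σ-algebra. -/
theorem integral_sum_mul_eq_zero [IsFiniteMeasure P] (hm : m ≤ mΩ) {ι : Type*} (s : Finset ι)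
    {g D : ι → Ω → ℝ} (hg : ∀ i ∈ s, StronglyMeasurable[m] (g i))
    (hD : ∀ i ∈ s, CondMeanZero m P (D i))
    (hf : Integrable (fun ω => ∑ i ∈ s, g i ω * D i ω) P) :
    ∫ ω, ∑ i ∈ s, g i ω * D i ω ∂P = 0 := by
  set w : Ω → ℝ := fun ω => ∑ i ∈ s, |g i ω| with hw
  have hwm : StronglyMeasurable[m] w :=
    Finset.stronglyMeasurable_fun_sum s fun i hi => (hg i hi).norm
  refine integral_eq_zero_of_truncation hf (hwm.mono hm).measurable fun K => ?_
  have hms : MeasurableSet {ω | |w ω| ≤ (K : ℝ)} :=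
    measurableSet_le (hwm.mono hm).measurable.abs measurable_const
  rw [← integral_indicator hms]
  have hterm : ∀ i ∈ s, CondMeanZero m P (fun ω =>
      ({ω | |w ω| ≤ (K : ℝ)}.indicator (fun _ => (1 : ℝ)) ω * g i ω) * D i ω) := fun i hi => by
    refine (hD i hi).mul_of_bound hm ((measurable_indicator_le hwm K).mul (hg i hi)) (C := K)
      (ae_of_all _ fun ω => ?_)
    by_cases h : |w ω| ≤ (K : ℝ)
    · have h1 : |g i ω| ≤ w ω :=
        Finset.single_le_sum (f := fun i => |g i ω|) (fun j _ => abs_nonneg _) hi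
      simpa [Set.indicator, h] using h1.trans ((le_abs_self _).trans h)
    · simp [Set.indicator, h]
  have heq : ({ω | |w ω| ≤ (K : ℝ)}.indicator fun ω => ∑ i ∈ s, g i ω * D i ω) = fun ω =>
      ∑ i ∈ s, ({ω | |w ω| ≤ (K : ℝ)}.indicator (fun _ => (1 : ℝ)) ω * g i ω) * D i ω := by
    ext ω
    by_cases h : |w ω| ≤ (K : ℝ) <;> simp [Set.indicator, h]
  rw [heq, integral_finsetSum _ fun i hi => (hterm i hi).1]
  exact Finset.sum_eq_zero fun i hi => (hterm i hi).integral_eq_zero hm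

theorem integral_mul_eq_zero [IsFiniteMeasure P] (hm : m ≤ mΩ)
    (hg : StronglyMeasurable[m] g) (hD : CondMeanZero m P D)
    (hf : Integrable (fun ω => g ω * D ω) P) : ∫ ω, g ω * D ω ∂P = 0 :=
  (hD.mul hg hf).integral_eq_zero hm

/-- Truncating `w` alone is enough: the first product is then integrable, hence so is the second as
a difference, however large `g` is. This is the form of the `ν` score when the response is `R + g *
D`. -/
theorem integral_mul_add_mul_eq_zero [IsFiniteMeasure P] (hm : m₁ ≤ m₂) (hm₂ : m₂ ≤ mΩ)
    (hw : StronglyMeasurable[m₁] w) (hg : StronglyMeasurable[m₂] g)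
    (h₁ : CondMeanZero m₁ P D₁) (h₂ : CondMeanZero m₂ P D₂)
    (hf : Integrable (fun ω => w ω * (D₁ ω + g ω * D₂ ω)) P) :
    ∫ ω, w ω * (D₁ ω + g ω * D₂ ω) ∂P = 0 := by
  refine integral_eq_zero_of_truncation hf (hw.mono (hm.trans hm₂)).measurable fun K => ?_
  have hms : MeasurableSet {ω | |w ω| ≤ (K : ℝ)} :=
    measurableSet_le (hw.mono (hm.trans hm₂)).measurable.abs measurable_const
  set u : Ω → ℝ := fun ω => {ω | |w ω| ≤ (K : ℝ)}.indicator (fun _ => (1 : ℝ)) ω * w ω with hu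
  have hum : StronglyMeasurable[m₁] u := (measurable_indicator_le hw K).mul hw
  have hz₁ : CondMeanZero m₁ P (fun ω => u ω * D₁ ω) := by
    refine h₁.mul_of_bound (hm.trans hm₂) hum (C := K) (ae_of_all _ fun ω => ?_)
    by_cases h : |w ω| ≤ (K : ℝ) <;> simp [hu, Set.indicator, h]
  have heq : ({ω | |w ω| ≤ (K : ℝ)}.indicator fun ω => w ω * (D₁ ω + g ω * D₂ ω)) = fun ω =>
      u ω * D₁ ω + (u ω * g ω) * D₂ ω := by
    ext ω
    by_cases h : |w ω| ≤ (K : ℝ) <;> simp [hu, Set.indicator, h]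
    ring
  have hi := hf.indicator hms
  rw [heq] at hi
  have hi₂ : Integrable (fun ω => (u ω * g ω) * D₂ ω) P := by
    refine (hi.sub hz₁.1).congr (ae_of_all _ fun ω => ?_)
    simp
  rw [← integral_indicator hms, heq, integral_add hz₁.1 hi₂,
    hz₁.integral_eq_zero (hm.trans hm₂), zero_add]
  exact integral_mul_eq_zero (g := fun ω => u ω * g ω) hm₂ ((hum.mono hm).mul hg) h₂ hi₂

theorem integral_euclidean_eq_zero {d : ℕ} {U : Ω → Par d} (hU : Integrable U P)
    (h : ∀ j, ∫ ω, U ω j ∂P = 0) : ∫ ω, U ω ∂P = 0 := by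
  ext j
  have hj : ∫ ω, U ω j ∂P = (∫ ω, U ω ∂P) j :=
    (EuclideanSpace.proj (𝕜 := ℝ) j).integral_comp_comm hU
  rw [← hj, h j]
  rfl

theorem integrable_euclidean_apply {d : ℕ} {U : Ω → Par d} (hU : Integrable U P) (j : Fin d) :
    Integrable (fun ω => U ω j) P :=
  (EuclideanSpace.proj (𝕜 := ℝ) j).integrable_comp hU

/-- If an event has positive conditional probability given `U` almost surely, then a property of
`U` that holds almost surely on the event holds almost surely. -/
theorem ae_of_ae_imp_of_condProb_pos [IsFiniteMeasure P] {𝒰 : Type*} [m𝒰 : MeasurableSpace 𝒰]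
    {U : Ω → 𝒰} (hU : Measurable U) {T : Ω → Prop} [DecidablePred T] {p : 𝒰 → ℝ}
    (hT : CondMeanZero (m𝒰.comap U) P (fun ω => (if T ω then (1 : ℝ) else 0) - p (U ω)))
    (hp : ∀ᵐ ω ∂P, 0 < p (U ω)) {B : Set 𝒰} (hB : MeasurableSet B)
    (h : ∀ᵐ ω ∂P, T ω → U ω ∈ B) : ∀ᵐ ω ∂P, U ω ∈ B := by
  classical
  have hind : StronglyMeasurable[m𝒰.comap U] (fun ω => Bᶜ.indicator (fun _ => (1 : ℝ)) (U ω)) :=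
    ((measurable_const.indicator hB.compl).comp (comap_measurable U)).stronglyMeasurable
  have hz := hT.mul_of_bound hU.comap_le hind (C := 1) (ae_of_all _ fun ω => by
    by_cases hb : U ω ∈ B <;> simp [Set.indicator, hb])
  have h0 := hz.integral_eq_zero hU.comap_le
  -- Off `B` the event does not occur, so the residual there is `-p`. Its mean over `Bᶜ` is zero and
  -- `p > 0`, hence `Bᶜ` is null.
  have hneg : ∀ᵐ ω ∂P, -(Bᶜ.indicator (fun _ => (1 : ℝ)) (U ω) *
      ((if T ω then (1 : ℝ) else 0) - p (U ω))) = Bᶜ.indicator p (U ω) := by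
    filter_upwards [h] with ω hω
    by_cases hb : U ω ∈ B
    · simp [Set.indicator, hb]
    · have : ¬ T ω := fun ht => hb (hω ht)
      simp [Set.indicator, hb, this]
  have h1 : ∫ ω, Bᶜ.indicator p (U ω) ∂P = 0 := by
    rw [← integral_congr_ae hneg, integral_neg, h0, neg_zero]
  have hnn : 0 ≤ᵐ[P] fun ω => Bᶜ.indicator p (U ω) := by
    filter_upwards [hp] with ω hω
    by_cases hb : U ω ∈ B <;> simp [Set.indicator, hb, hω.le]
  have h2 := (integral_eq_zero_iff_of_nonneg_ae hnn (hz.1.neg.congr hneg)).1 h1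
  filter_upwards [h2, hp] with ω h3 h4
  by_contra hb
  simp [Set.indicator, hb, h4.ne'] at h3

end CondMean

/-! ### Conditional moments and identification of `ψ_am` -/

namespace Population

variable {Ω 𝒳 𝒜 𝒵 ℳ : Type*} [mΩ : MeasurableSpace Ω] [m𝒳 : MeasurableSpace 𝒳]
  [m𝒜 : MeasurableSpace 𝒜] [m𝒵 : MeasurableSpace 𝒵] [mℳ : MeasurableSpace ℳ] {P : Measure Ω}
  (V : Population Ω 𝒳 𝒜 𝒵 ℳ P)

theorem measurable_XA : Measurable V.XA := V.measurable_X.prodMk V.measurable_A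

theorem measurable_XAZM : Measurable V.XAZM :=
  V.measurable_X.prodMk (V.measurable_A.prodMk (V.measurable_Z.prodMk V.measurable_M))

theorem measurable_obs : Measurable V.obs :=
  V.measurable_X.prodMk (V.measurable_A.prodMk (V.measurable_Z.prodMk
    (V.measurable_M.prodMk V.measurable_Y)))

/-- The information in `X`. -/
abbrev sigmaX : MeasurableSpace Ω := m𝒳.comap V.X

/-- The information in `(X, A)`. -/
abbrev sigmaXA : MeasurableSpace Ω := MeasurableSpace.comap V.XA inferInstance

/-- The information in `(X, A, Z)`. -/
abbrev sigmaXAZ : MeasurableSpace Ω := MeasurableSpace.comap V.XAZ inferInstance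

/-- The information in `(X, A, Z, M)`. -/
abbrev sigmaXAZM : MeasurableSpace Ω := MeasurableSpace.comap V.XAZM inferInstance

theorem sigmaX_le : V.sigmaX ≤ mΩ := V.measurable_X.comap_le
theorem sigmaXA_le : V.sigmaXA ≤ mΩ := V.measurable_XA.comap_le
theorem sigmaXAZ_le : V.sigmaXAZ ≤ mΩ := V.measurable_XAZ.comap_le
theorem sigmaXAZM_le : V.sigmaXAZM ≤ mΩ := V.measurable_XAZM.comap_le

theorem sigmaX_le_sigmaXA : V.sigmaX ≤ V.sigmaXA :=
  (measurable_fst.comp (comap_measurable V.XA)).comap_le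

theorem sigmaXA_le_sigmaXAZ : V.sigmaXA ≤ V.sigmaXAZ :=
  ((measurable_fst.prodMk (measurable_fst.comp measurable_snd)).comp
    (comap_measurable V.XAZ)).comap_le

theorem sigmaXAZ_le_sigmaXAZM : V.sigmaXAZ ≤ V.sigmaXAZM :=
  ((measurable_fst.prodMk ((measurable_fst.comp measurable_snd).prodMk
    (measurable_fst.comp (measurable_snd.comp measurable_snd)))).comp
    (comap_measurable V.XAZM)).comap_le

/-- Regrouping the tuple as a pair `(XAZ, M)` matches the form in which conditional independence is
expressed through conditional distributions. -/
theorem sigmaXAZM_eq : V.sigmaXAZM =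
    MeasurableSpace.comap (fun ω => (V.XAZ ω, V.M ω)) inferInstance := by
  refine le_antisymm (Measurable.comap_le ?_) (Measurable.comap_le ?_)
  · let U : Ω → (𝒳 × 𝒜 × 𝒵) × ℳ := fun ω => (V.XAZ ω, V.M ω)
    have h : Measurable[MeasurableSpace.comap U inferInstance] U := comap_measurable U
    have h1 := h.fst
    exact h1.fst.prodMk (h1.snd.fst.prodMk (h1.snd.snd.prodMk h.snd))
  · have h : Measurable[V.sigmaXAZM] V.XAZM := comap_measurable V.XAZM
    exact (h.fst.prodMk (h.snd.fst.prodMk h.snd.snd.fst)).prodMk h.snd.snd.snd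

variable {V}

theorem stronglyMeasurable_comp_X {g : 𝒳 → ℝ} (hg : Measurable g) :
    StronglyMeasurable[V.sigmaX] (fun ω => g (V.X ω)) :=
  (hg.comp (comap_measurable V.X)).stronglyMeasurable

theorem stronglyMeasurable_comp_XA {g : 𝒳 × 𝒜 → ℝ} (hg : Measurable g) :
    StronglyMeasurable[V.sigmaXA] (fun ω => g (V.XA ω)) :=
  (hg.comp (comap_measurable V.XA)).stronglyMeasurable

theorem stronglyMeasurable_comp_XAZ {g : 𝒳 × 𝒜 × 𝒵 → ℝ} (hg : Measurable g) :
    StronglyMeasurable[V.sigmaXAZ] (fun ω => g (V.XAZ ω)) :=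
  (hg.comp (comap_measurable V.XAZ)).stronglyMeasurable

theorem stronglyMeasurable_comp_XAZM {g : 𝒳 × 𝒜 × 𝒵 × ℳ → ℝ} (hg : Measurable g) :
    StronglyMeasurable[V.sigmaXAZM] (fun ω => g (V.XAZM ω)) :=
  (hg.comp (comap_measurable V.XAZM)).stronglyMeasurable

variable (V)

/-- `E[Y | X, A, Z, M = m]`, as a random variable. -/
noncomputable def muYAt [IsFiniteMeasure P] (m : ℳ) (ω : Ω) : ℝ :=
  V.muY (V.X ω, V.A ω, V.Z ω, m)

theorem measurable_muY [IsFiniteMeasure P] : Measurable V.muY :=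
  (StronglyMeasurable.integral_condDistrib (X := V.XAZM) (Y := V.Y) (μ := P)
    (f := fun q : (𝒳 × 𝒜 × 𝒵 × ℳ) × ℝ => q.2)
    measurable_snd.stronglyMeasurable).measurable

theorem measurable_muY_at [IsFiniteMeasure P] (m : ℳ) :
    Measurable (fun v : 𝒳 × 𝒜 × 𝒵 => V.muY (v.1, v.2.1, v.2.2, m)) :=
  V.measurable_muY.comp (by fun_prop)

theorem measurable_nuY [IsFiniteMeasure P] [StandardBorelSpace 𝒵] [Nonempty 𝒵] (m : ℳ) :
    Measurable (V.nuY m) := by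
  refine (StronglyMeasurable.integral_condDistrib (X := V.XA) (Y := V.Z) (μ := P)
    (f := fun q : (𝒳 × 𝒜) × 𝒵 => V.muY (q.1.1, q.1.2, q.2, m)) ?_).measurable
  exact (V.measurable_muY.comp (by fun_prop)).stronglyMeasurable

theorem measurable_nuY_at [IsFiniteMeasure P] [StandardBorelSpace 𝒵] [Nonempty 𝒵] (m : ℳ) (a : 𝒜) :
    Measurable (fun x => V.nuY m (x, a)) :=
  (V.measurable_nuY m).comp measurable_prodMk_right

theorem measurable_piA [IsFiniteMeasure P] [StandardBorelSpace 𝒜] [Nonempty 𝒜]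
    [MeasurableSingletonClass 𝒜] (l : 𝒜) : Measurable (fun x => V.piA x l) :=
  (Kernel.measurable_coe _ (measurableSet_singleton l)).ennreal_toReal

theorem measurable_piM [IsFiniteMeasure P] [StandardBorelSpace ℳ] [Nonempty ℳ]
    [MeasurableSingletonClass ℳ] (l : ℳ) : Measurable (fun v => V.piM v l) :=
  (Kernel.measurable_coe _ (measurableSet_singleton l)).ennreal_toReal

section Facts

variable [IsProbabilityMeasure P]

theorem condMeanZero_A [StandardBorelSpace 𝒜] [Nonempty 𝒜] [MeasurableSingletonClass 𝒜]
    [DecidableEq 𝒜] (l : 𝒜) :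
    CondMeanZero V.sigmaX P (fun ω => (if V.A ω = l then (1 : ℝ) else 0) - V.piA (V.X ω) l) := by
  have hs := measurableSet_singleton l
  have hf : (fun ω => if V.A ω = l then (1 : ℝ) else 0) =
      (V.A ⁻¹' {l}).indicator (fun _ => (1 : ℝ)) := by
    ext ω; simp [Set.indicator]
  refine condMeanZero_sub_of_condExp_eq ?_ ?_ V.sigmaX_le
    (stronglyMeasurable_comp_X (V.measurable_piA l))
  · rw [hf]
    exact (integrable_const _).indicator (V.measurable_A hs)
  · rw [hf]
    exact (condDistrib_ae_eq_condExp V.measurable_X V.measurable_A hs).symm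

theorem condMeanZero_M [StandardBorelSpace ℳ] [Nonempty ℳ] [MeasurableSingletonClass ℳ]
    [DecidableEq ℳ] (l : ℳ) :
    CondMeanZero V.sigmaXAZ P
      (fun ω => (if V.M ω = l then (1 : ℝ) else 0) - V.piM (V.XAZ ω) l) := by
  have hs := measurableSet_singleton l
  have hf : (fun ω => if V.M ω = l then (1 : ℝ) else 0) =
      (V.M ⁻¹' {l}).indicator (fun _ => (1 : ℝ)) := by
    ext ω; simp [Set.indicator]
  refine condMeanZero_sub_of_condExp_eq ?_ ?_ V.sigmaXAZ_le
    (stronglyMeasurable_comp_XAZ (V.measurable_piM l))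
  · rw [hf]
    exact (integrable_const _).indicator (V.measurable_M hs)
  · rw [hf]
    exact (condDistrib_ae_eq_condExp V.measurable_XAZ V.measurable_M hs).symm

variable [Fintype 𝒜] [Fintype ℳ] {V}

/-- By consistency `|Y|` is at most the sum of all `|Y(a, m)|`, which is finite because there are
finitely many levels. -/
theorem integrable_Y (hcons : V.Consistency) : Integrable V.Y P := by
  have hb : Integrable (fun ω => ∑ a, ∑ m, |V.Ypot a m ω|) P :=
    integrable_finsetSum _ fun a _ => integrable_finsetSum _ fun m _ =>
      (V.integrable_Ypot a m).abs
  refine hb.mono' V.measurable_Y.aestronglyMeasurable ?_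
  have hall : ∀ᵐ ω ∂P, ∀ a m, V.A ω = a → V.M ω = m → V.Y ω = V.Ypot a m ω :=
    ae_all_iff.2 fun a => ae_all_iff.2 fun m => hcons a m
  filter_upwards [hall] with ω hω
  rw [hω _ _ rfl rfl, Real.norm_eq_abs]
  refine le_trans ?_ (Finset.single_le_sum (f := fun a => ∑ m, |V.Ypot a m ω|)
    (fun a _ => Finset.sum_nonneg fun m _ => abs_nonneg _) (Finset.mem_univ (V.A ω)))
  exact Finset.single_le_sum (f := fun m => |V.Ypot (V.A ω) m ω|)
    (fun m _ => abs_nonneg _) (Finset.mem_univ (V.M ω))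

theorem condMeanZero_Y (hcons : V.Consistency) :
    CondMeanZero V.sigmaXAZM P (fun ω => V.Y ω - V.muY (V.XAZM ω)) :=
  condMeanZero_sub_of_condExp_eq (integrable_Y hcons)
    (condExp_ae_eq_integral_condDistrib' V.measurable_XAZM (integrable_Y hcons))
    V.sigmaXAZM_le (stronglyMeasurable_comp_XAZM V.measurable_muY)

variable [StandardBorelSpace Ω] [StandardBorelSpace 𝒜] [Nonempty 𝒜] [MeasurableSingletonClass 𝒜]
  [StandardBorelSpace ℳ] [Nonempty ℳ] [MeasurableSingletonClass ℳ] [DecidableEq 𝒜] [DecidableEq ℳ]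

theorem ae_piA_pos (hpos : V.Positivity) (l : 𝒜) : ∀ᵐ ω ∂P, 0 < V.piA (V.X ω) l := by
  obtain ⟨ε, hε, h, -⟩ := hpos
  filter_upwards [ae_of_ae_map V.measurable_X.aemeasurable (h l)] with ω hω using hε.trans hω

theorem ae_piM_pos (hpos : V.Positivity) (l : ℳ) : ∀ᵐ ω ∂P, 0 < V.piM (V.XAZ ω) l := by
  obtain ⟨ε, hε, -, h⟩ := hpos
  filter_upwards [ae_of_ae_map V.measurable_XAZ.aemeasurable (h l)] with ω hω using hε.trans hω

theorem exists_bound_inv_piA (hpos : V.Positivity) (l : 𝒜) :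
    ∃ C : ℝ, ∀ᵐ ω ∂P, |(V.piA (V.X ω) l)⁻¹| ≤ C := by
  obtain ⟨ε, hε, h, -⟩ := hpos
  refine ⟨ε⁻¹, ?_⟩
  filter_upwards [ae_of_ae_map V.measurable_X.aemeasurable (h l)] with ω hω
  rw [abs_of_pos (inv_pos.2 (hε.trans hω))]
  exact inv_anti₀ hε hω.le

theorem exists_bound_inv_piM (hpos : V.Positivity) (l : ℳ) :
    ∃ C : ℝ, ∀ᵐ ω ∂P, |(V.piM (V.XAZ ω) l)⁻¹| ≤ C := by
  obtain ⟨ε, hε, -, h⟩ := hpos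
  refine ⟨ε⁻¹, ?_⟩
  filter_upwards [ae_of_ae_map V.measurable_XAZ.aemeasurable (h l)] with ω hω
  rw [abs_of_pos (inv_pos.2 (hε.trans hω))]
  exact inv_anti₀ hε hω.le

/-- Positivity of the mediator probability: what holds for units with `M = m` and concerns `(X, A,
Z)` only holds for all units. -/
theorem ae_XAZ_of_imp (hpos : V.Positivity) (m : ℳ) {B : Set (𝒳 × 𝒜 × 𝒵)} (hB : MeasurableSet B)
    (h : ∀ᵐ ω ∂P, V.M ω = m → V.XAZ ω ∈ B) : ∀ᵐ ω ∂P, V.XAZ ω ∈ B :=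
  ae_of_ae_imp_of_condProb_pos (T := fun ω => V.M ω = m) (p := fun v => V.piM v m) V.measurable_XAZ (V.condMeanZero_M m)
    (ae_piM_pos hpos m) hB h

theorem ae_X_of_imp (hpos : V.Positivity) (a : 𝒜) {B : Set 𝒳} (hB : MeasurableSet B)
    (h : ∀ᵐ ω ∂P, V.A ω = a → V.X ω ∈ B) : ∀ᵐ ω ∂P, V.X ω ∈ B :=
  ae_of_ae_imp_of_condProb_pos (T := fun ω => V.A ω = a) (p := fun x => V.piA x a) V.measurable_X (V.condMeanZero_A a)
    (ae_piA_pos hpos a) hB h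

variable (V) in
/-- `E[Y(a, m) | x, a', z]`. -/
noncomputable def potXAZ (a : 𝒜) (m : ℳ) (v : 𝒳 × 𝒜 × 𝒵) : ℝ :=
  ∫ y, y ∂(condDistrib (V.Ypot a m) V.XAZ P v)

variable (V) in
/-- `E[Y(a, m) | x]`. -/
noncomputable def potX (a : 𝒜) (m : ℳ) (x : 𝒳) : ℝ :=
  ∫ y, y ∂(condDistrib (V.Ypot a m) V.X P x)

theorem measurable_potXAZ (a : 𝒜) (m : ℳ) : Measurable (V.potXAZ a m) :=
  (StronglyMeasurable.integral_condDistrib (X := V.XAZ) (Y := V.Ypot a m) (μ := P)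
    (f := fun q : (𝒳 × 𝒜 × 𝒵) × ℝ => q.2) measurable_snd.stronglyMeasurable).measurable

theorem measurable_potX (a : 𝒜) (m : ℳ) : Measurable (V.potX a m) :=
  (StronglyMeasurable.integral_condDistrib (X := V.X) (Y := V.Ypot a m) (μ := P)
    (f := fun q : 𝒳 × ℝ => q.2) measurable_snd.stronglyMeasurable).measurable

theorem condExp_Ypot_XAZ (a : 𝒜) (m : ℳ) :
    P[V.Ypot a m | V.sigmaXAZ] =ᵐ[P] fun ω => V.potXAZ a m (V.XAZ ω) :=
  condExp_ae_eq_integral_condDistrib' V.measurable_XAZ (V.integrable_Ypot a m)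

theorem condExp_Ypot_X (a : 𝒜) (m : ℳ) :
    P[V.Ypot a m | V.sigmaX] =ᵐ[P] fun ω => V.potX a m (V.X ω) :=
  condExp_ae_eq_integral_condDistrib' V.measurable_X (V.integrable_Ypot a m)

/-- By ignorability of the mediator, adding `M` to the conditioning variables does not change the
conditional law of `Y(a, m)`. -/
theorem condMeanZero_Ypot_XAZM (hign : V.SequentialIgnorability) (a : 𝒜) (m : ℳ) :
    CondMeanZero V.sigmaXAZM P (fun ω => V.Ypot a m ω - V.potXAZ a m (V.XAZ ω)) := by
  have hmeas : Measurable fun ω => (V.XAZ ω, V.M ω) := V.measurable_XAZ.prodMk V.measurable_M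
  have hind := (condIndepFun_iff_condDistrib_prod_ae_eq_prodMkRight (V.measurable_Ypot a m)
    V.measurable_M V.measurable_XAZ).1 (hign.2 a m).symm
  have hce := condExp_ae_eq_integral_condDistrib' hmeas (V.integrable_Ypot a m)
  rw [← V.sigmaXAZM_eq] at hce
  refine condMeanZero_sub_of_condExp_eq (V.integrable_Ypot a m) ?_ V.sigmaXAZM_le
    ((stronglyMeasurable_comp_XAZ (measurable_potXAZ a m)).mono V.sigmaXAZ_le_sigmaXAZM)
  filter_upwards [hce, ae_of_ae_map hmeas.aemeasurable hind] with ω h1 h2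
  rw [h1, h2, Kernel.prodMkRight_apply]
  rfl

theorem condMeanZero_Ypot_XA (hign : V.SequentialIgnorability) (a : 𝒜) (m : ℳ) :
    CondMeanZero V.sigmaXA P (fun ω => V.Ypot a m ω - V.potX a m (V.X ω)) := by
  have hind := (condIndepFun_iff_condDistrib_prod_ae_eq_prodMkRight (V.measurable_Ypot a m)
    V.measurable_A V.measurable_X).1 (hign.1 a m).symm
  have hce := condExp_ae_eq_integral_condDistrib' V.measurable_XA (V.integrable_Ypot a m)
  refine condMeanZero_sub_of_condExp_eq (V.integrable_Ypot a m) ?_ V.sigmaXA_le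
    ((stronglyMeasurable_comp_X (measurable_potX a m)).mono V.sigmaX_le_sigmaXA)
  filter_upwards [hce, ae_of_ae_map V.measurable_XA.aemeasurable hind] with ω h1 h2
  rw [h1]
  change ∫ y, y ∂(condDistrib (V.Ypot a m) (fun ω => (V.X ω, V.A ω)) P (V.XA ω)) = _
  rw [h2, Kernel.prodMkRight_apply]
  rfl

theorem measurable_ite_A (a : 𝒜) {β : Type*} [MeasurableSpace β] {f : β → 𝒜} (hf : Measurable f) :
    Measurable (fun b => if f b = a then (1 : ℝ) else 0) :=
  Measurable.ite (hf (measurableSet_singleton a)) measurable_const measurable_const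

/-- Identification within the stratum `A = a`: `E[Y | X, a, Z, m] = E[Y(a, m) | X, a, Z]`. -/
theorem muYAt_eq_potXAZ (hcons : V.Consistency) (hign : V.SequentialIgnorability)
    (hpos : V.Positivity) (a : 𝒜) (m : ℳ) :
    ∀ᵐ ω ∂P, V.A ω = a → V.muYAt m ω = V.potXAZ a m (V.XAZ ω) := by
  set g : 𝒳 × 𝒜 × 𝒵 × ℳ → ℝ := fun v =>
    (if v.2.1 = a then 1 else 0) * (if v.2.2.2 = m then 1 else 0) with hg
  have hgm : Measurable g := by
    refine Measurable.mul ?_ ?_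
    · exact Measurable.ite ((measurable_fst.comp measurable_snd) (measurableSet_singleton a))
        measurable_const measurable_const
    · exact Measurable.ite ((measurable_snd.comp (measurable_snd.comp measurable_snd))
        (measurableSet_singleton m)) measurable_const measurable_const
  have hgb : ∀ v, |g v| ≤ 1 := fun v => by
    simp only [hg]; split_ifs <;> simp
  have h1 := (condMeanZero_Y hcons).mul_of_bound V.sigmaXAZM_le
    (stronglyMeasurable_comp_XAZM hgm) (C := 1) (ae_of_all _ fun ω => hgb _)
  have h2 := (condMeanZero_Ypot_XAZM hign a m).mul_of_bound V.sigmaXAZM_le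
    (stronglyMeasurable_comp_XAZM hgm) (C := 1) (ae_of_all _ fun ω => hgb _)
  -- On the cell `A = a`, `M = m` consistency cancels the outcomes in the difference of the two
  -- residuals. What is left is measurable for the conditioning σ-algebra, so having conditional
  -- mean zero it vanishes.
  have h3 : CondMeanZero V.sigmaXAZM P (fun ω =>
      g (V.XAZM ω) * (V.potXAZ a m (V.XAZ ω) - V.muY (V.XAZM ω))) := by
    refine (h1.sub h2).congr ?_
    filter_upwards [hcons a m] with ω hω
    by_cases hA : V.A ω = a
    · by_cases hM : V.M ω = m
      · rw [hω hA hM]; ring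
      · simp [hg, XAZM, hM]
    · simp [hg, XAZM, hA]
  have h4 := h3.ae_eq_zero V.sigmaXAZM_le ((stronglyMeasurable_comp_XAZM hgm).mul
    (((stronglyMeasurable_comp_XAZ (measurable_potXAZ a m)).mono V.sigmaXAZ_le_sigmaXAZM).sub
      (stronglyMeasurable_comp_XAZM V.measurable_muY)))
  refine ae_XAZ_of_imp hpos m
    (B := {v | v.2.1 = a → V.muY (v.1, v.2.1, v.2.2, m) = V.potXAZ a m v}) ?_ ?_
  · have hA : MeasurableSet {v : 𝒳 × 𝒜 × 𝒵 | v.2.1 = a} :=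
      (measurable_fst.comp measurable_snd) (measurableSet_singleton a)
    exact hA.imp (measurableSet_eq_fun (V.measurable_muY_at m) (measurable_potXAZ a m))
  · filter_upwards [h4] with ω hω hM hA
    simp only [XAZ] at hA
    have : g (V.XAZM ω) = 1 := by simp [hg, XAZM, hA, hM]
    rw [this, one_mul, Pi.zero_apply, sub_eq_zero] at hω
    rw [hω, XAZM, hM]
    rfl

/-- The regression is evaluated at `m` rather than at the observed `M`, so it is not itself a
conditional expectation of `Y`. The bound comes from identification: it coincides with one of
finitely many conditional expectations of potential outcomes. -/
theorem integrable_muYAt (hcons : V.Consistency) (hign : V.SequentialIgnorability)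
    (hpos : V.Positivity) (m : ℳ) : Integrable (V.muYAt m) P := by
  have hb : Integrable (fun ω => ∑ a, |V.potXAZ a m (V.XAZ ω)|) P :=
    integrable_finsetSum _ fun a _ => (integrable_condExp.congr (condExp_Ypot_XAZ a m)).abs
  refine hb.mono' ((V.measurable_muY_at m).comp V.measurable_XAZ).aestronglyMeasurable ?_
  have hall : ∀ᵐ ω ∂P, ∀ a, V.A ω = a → V.muYAt m ω = V.potXAZ a m (V.XAZ ω) :=
    ae_all_iff.2 fun a => muYAt_eq_potXAZ hcons hign hpos a m
  filter_upwards [hall] with ω hω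
  rw [hω _ rfl, Real.norm_eq_abs]
  exact Finset.single_le_sum (f := fun a => |V.potXAZ a m (V.XAZ ω)|)
    (fun a _ => abs_nonneg _) (Finset.mem_univ (V.A ω))

variable [StandardBorelSpace 𝒵] [Nonempty 𝒵]

theorem condMeanZero_muYAt (hcons : V.Consistency) (hign : V.SequentialIgnorability)
    (hpos : V.Positivity) (m : ℳ) :
    CondMeanZero V.sigmaXA P (fun ω => V.muYAt m ω - V.nuY m (V.XA ω)) := by
  have hf : StronglyMeasurable (fun q : (𝒳 × 𝒜) × 𝒵 => V.muY (q.1.1, q.1.2, q.2, m)) :=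
    (V.measurable_muY.comp (by fun_prop)).stronglyMeasurable
  have hi := integrable_muYAt hcons hign hpos m
  exact condMeanZero_sub_of_condExp_eq hi
    (condExp_prod_ae_eq_integral_condDistrib V.measurable_XA V.measurable_Z.aemeasurable hf hi)
    V.sigmaXA_le (stronglyMeasurable_comp_XA (V.measurable_nuY m))

/-- On `A = a`, averaging `E[Y | X, a, Z, m] = E[Y(a, m) | X, a, Z]` over `Z` gives `E[Y(a, m) | X,
a]`, which ignorability of the treatment turns into `E[Y(a, m) | X]`. Positivity removes the
restriction to `A = a`. -/
theorem nuY_eq_potX (hcons : V.Consistency) (hign : V.SequentialIgnorability)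
    (hpos : V.Positivity) (a : 𝒜) (m : ℳ) :
    ∀ᵐ ω ∂P, V.nuY m (V.X ω, a) = V.potX a m (V.X ω) := by
  have hite : Measurable (fun v : 𝒳 × 𝒜 => if v.2 = a then (1 : ℝ) else 0) :=
    measurable_ite_A a measurable_snd
  have hb : ∀ v : 𝒳 × 𝒜, |if v.2 = a then (1 : ℝ) else 0| ≤ 1 := fun v => by
    split_ifs <;> simp
  have hYh : CondMeanZero V.sigmaXA P (fun ω => V.Ypot a m ω - V.potXAZ a m (V.XAZ ω)) :=
    (condMeanZero_Ypot_XAZM hign a m).mono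
      (V.sigmaXA_le_sigmaXAZ.trans V.sigmaXAZ_le_sigmaXAZM) V.sigmaXAZM_le
  have h1 := ((condMeanZero_muYAt hcons hign hpos m).sub
    ((condMeanZero_Ypot_XA hign a m).sub hYh)).mul_of_bound V.sigmaXA_le
      (stronglyMeasurable_comp_XA hite) (C := 1) (ae_of_all _ fun ω => hb _)
  have h2 : CondMeanZero V.sigmaXA P (fun ω => (if (V.XA ω).2 = a then (1 : ℝ) else 0) *
      (V.potX a m (V.XA ω).1 - V.nuY m (V.XA ω))) := by
    refine h1.congr ?_
    filter_upwards [muYAt_eq_potXAZ hcons hign hpos a m] with ω hω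
    by_cases hA : V.A ω = a
    · simp only [XA, hA, hω hA]
      ring
    · simp [XA, hA]
  have h3 := h2.ae_eq_zero V.sigmaXA_le (stronglyMeasurable_comp_XA
    (hite.mul (((measurable_potX (V := V) a m).comp measurable_fst).sub (V.measurable_nuY m))))
  refine ae_X_of_imp hpos a (B := {x | V.nuY m (x, a) = V.potX a m x}) ?_ ?_
  · exact measurableSet_eq_fun (V.measurable_nuY_at m a) (measurable_potX a m)
  · filter_upwards [h3] with ω hω hA
    simp only [XA, hA, if_true, one_mul, Pi.zero_apply, sub_eq_zero] at hω
    exact hω.symm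

theorem integrable_nuY (hcons : V.Consistency) (hign : V.SequentialIgnorability)
    (hpos : V.Positivity) (a : 𝒜) (m : ℳ) : Integrable (fun ω => V.nuY m (V.X ω, a)) P := by
  refine (integrable_condExp.congr (condExp_Ypot_X (V := V) a m)).congr ?_
  filter_upwards [nuY_eq_potX hcons hign hpos a m] with ω hω using hω.symm

/-- Identification of the controlled response function: `E[ν_y(X)] = ψ_am`. -/
theorem integral_nuY (hcons : V.Consistency) (hign : V.SequentialIgnorability)
    (hpos : V.Positivity) (a : 𝒜) (m : ℳ) : ∫ ω, V.nuY m (V.X ω, a) ∂P = V.psi a m := by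
  rw [integral_congr_ae (nuY_eq_potX hcons hign hpos a m),
    ← integral_congr_ae (condExp_Ypot_X a m), integral_condExp V.sigmaX_le]
  rfl

end Facts

end Population

/-! ### Double robustness of the population functionals -/

namespace Population

variable {Ω 𝒳 𝒜 𝒵 ℳ : Type*} {m₂ : MeasurableSpace Ω} [mΩ : MeasurableSpace Ω] [MeasurableSpace 𝒳]
  [MeasurableSpace 𝒜] [MeasurableSpace 𝒵] [MeasurableSpace ℳ] {P : Measure Ω}
  [IsProbabilityMeasure P] {V : Population Ω 𝒳 𝒜 𝒵 ℳ P}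
  [Fintype 𝒜] [Fintype ℳ] [StandardBorelSpace Ω] [StandardBorelSpace 𝒜] [Nonempty 𝒜]
  [MeasurableSingletonClass 𝒜] [StandardBorelSpace ℳ] [Nonempty ℳ] [MeasurableSingletonClass ℳ]
  [DecidableEq 𝒜] [DecidableEq ℳ] [StandardBorelSpace 𝒵] [Nonempty 𝒵]

variable (V) in
/-- The outcome weighted by the inverse of the true mediator probability. -/
noncomputable def ipwOutcome (m : ℳ) (ω : Ω) : ℝ :=
  (if V.M ω = m then (1 : ℝ) else 0) * V.Y ω / V.piM (V.XAZ ω) m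

/-- The error splits into three residuals: `𝟙(M = m) / π_m * (Y - μ_y)` given `(X, A, Z, M)`, `μ_y *
(𝟙(M = m) / π_m - 1)` given `(X, A, Z)`, and `μ_y - ν_y` given `(X, A)`. Positivity bounds the
inverse weights. -/
theorem condMeanZero_ipwOutcome (hcons : V.Consistency) (hign : V.SequentialIgnorability)
    (hpos : V.Positivity) (m : ℳ) :
    CondMeanZero V.sigmaXA P (fun ω => V.ipwOutcome m ω - V.nuY m (V.XA ω)) := by
  obtain ⟨C, hC⟩ := exists_bound_inv_piM hpos m
  have hπ : Measurable (fun v => (V.piM v m)⁻¹) := (V.measurable_piM m).inv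
  have hle := V.sigmaXA_le_sigmaXAZ
  have hle' := V.sigmaXAZ_le_sigmaXAZM
  have hg : Measurable (fun v : 𝒳 × 𝒜 × 𝒵 × ℳ => (if v.2.2.2 = m then (1 : ℝ) else 0) *
      (V.piM (v.1, v.2.1, v.2.2.1) m)⁻¹) :=
    (Measurable.ite ((measurable_snd.comp (measurable_snd.comp measurable_snd))
      (measurableSet_singleton m)) measurable_const measurable_const).mul
      (hπ.comp (by fun_prop))
  have h1 := ((condMeanZero_Y hcons).mul_of_bound V.sigmaXAZM_le
    (stronglyMeasurable_comp_XAZM hg) (C := C) (by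
      filter_upwards [hC] with ω hω
      by_cases hM : V.M ω = m
      · simpa [XAZM, XAZ, hM] using hω
      · simpa [XAZM, hM] using (abs_nonneg _).trans hω)).mono (hle.trans hle') V.sigmaXAZM_le
  have hinv := (V.condMeanZero_M m).mul_of_bound V.sigmaXAZ_le
    (stronglyMeasurable_comp_XAZ hπ) hC
  have h2 : CondMeanZero V.sigmaXA P (fun ω => V.muYAt m ω * ((V.piM (V.XAZ ω) m)⁻¹ *
      ((if V.M ω = m then (1 : ℝ) else 0) - V.piM (V.XAZ ω) m))) := by
    refine (hinv.mul (g := V.muYAt m) (stronglyMeasurable_comp_XAZ (V.measurable_muY_at m))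
      ?_).mono hle V.sigmaXAZ_le
    refine (integrable_muYAt hcons hign hpos m).mul_bdd (c := C + 1)
      hinv.1.aestronglyMeasurable ?_
    filter_upwards [hC, ae_piM_pos hpos m] with ω hω hp
    rw [mul_sub, inv_mul_cancel₀ hp.ne', Real.norm_eq_abs]
    refine (abs_sub _ _).trans ?_
    rw [abs_one]
    gcongr
    split_ifs
    · simpa using hω
    · simpa using (abs_nonneg _).trans hω
  refine ((h1.add h2).add (condMeanZero_muYAt hcons hign hpos m)).congr ?_
  filter_upwards [ae_piM_pos hpos m] with ω hp
  have hp' := hp.ne'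
  by_cases hM : V.M ω = m
  · have hmu : V.muYAt m ω = V.muY (V.XAZM ω) := by simp only [muYAt, XAZM, hM]
    rw [hmu]
    simp only [ipwOutcome, hM, XAZM, if_true]
    change 1 * (V.piM (V.XAZ ω) m)⁻¹ * _ + _ + _ = _
    field_simp
    ring
  · simp only [ipwOutcome, XAZM, hM, if_false]
    field_simp
    ring

/-- The stage of a doubly robust estimator in which the model for `ν_y` is correct. -/
theorem integral_augmented_of_nu (hcons : V.Consistency) (hign : V.SequentialIgnorability)
    (hpos : V.Positivity) (a : 𝒜) (m : ℳ) {R : Ω → ℝ}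
    (hR : CondMeanZero V.sigmaXA P (fun ω => R ω - V.nuY m (V.XA ω))) {p : 𝒳 → ℝ}
    (hp : Measurable p)
    (hf : Integrable (fun ω => V.nuY m (V.X ω, a) +
      (if V.A ω = a then (1 : ℝ) else 0) / p (V.X ω) * (R ω - V.nuY m (V.X ω, a))) P) :
    ∫ ω, (V.nuY m (V.X ω, a) + (if V.A ω = a then (1 : ℝ) else 0) / p (V.X ω) *
      (R ω - V.nuY m (V.X ω, a))) ∂P = V.psi a m := by
  have hν := integrable_nuY hcons hign hpos a m
  -- The model `p` is arbitrary here, so `1 / p` may be unbounded; the augmentation term is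
  -- integrable only because the whole expression and `ν_y` are.
  have hi := hf.sub hν
  simp only [Pi.sub_def, add_sub_cancel_left] at hi
  rw [integral_add hν hi, integral_nuY hcons hign hpos a m, add_eq_left]
  have hg : Measurable (fun v : 𝒳 × 𝒜 => (if v.2 = a then (1 : ℝ) else 0) / p v.1) :=
    (measurable_ite_A a measurable_snd).div (hp.comp measurable_fst)
  have heq : ∀ ω, (if V.A ω = a then (1 : ℝ) else 0) / p (V.X ω) * (R ω - V.nuY m (V.X ω, a)) =
      (if (V.XA ω).2 = a then (1 : ℝ) else 0) / p (V.XA ω).1 * (R ω - V.nuY m (V.XA ω)) := by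
    intro ω
    by_cases hA : V.A ω = a
    · simp only [XA, hA]
    · simp [XA, hA]
  simp only [heq] at hi ⊢
  exact integral_mul_eq_zero (g := fun ω => (if (V.XA ω).2 = a then (1 : ℝ) else 0) / p (V.XA ω).1)
    V.sigmaXA_le (stronglyMeasurable_comp_XA hg) hR hi

theorem condMeanZero_ipwA (hpos : V.Positivity) (a : 𝒜) {m : ℳ} {R : Ω → ℝ}
    (hR : CondMeanZero V.sigmaXA P (fun ω => R ω - V.nuY m (V.XA ω))) :
    CondMeanZero V.sigmaXA P (fun ω => (if (V.XA ω).2 = a then (1 : ℝ) else 0) *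
      (V.piA (V.XA ω).1 a)⁻¹ * (R ω - V.nuY m (V.XA ω))) := by
  obtain ⟨C, hC⟩ := exists_bound_inv_piA hpos a
  have hg : Measurable (fun v : 𝒳 × 𝒜 => (if v.2 = a then (1 : ℝ) else 0) * (V.piA v.1 a)⁻¹) :=
    (measurable_ite_A a measurable_snd).mul (((V.measurable_piA a).comp measurable_fst).inv)
  refine hR.mul_of_bound V.sigmaXA_le (stronglyMeasurable_comp_XA hg) (C := C) ?_
  filter_upwards [hC] with ω hω
  by_cases hA : V.A ω = a
  · simpa [XA, hA] using hω
  · simpa [XA, hA] using (abs_nonneg _).trans hω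

/-- The stage of a doubly robust estimator in which the model for `π_a` is correct. -/
theorem integral_augmented_of_piA (hcons : V.Consistency) (hign : V.SequentialIgnorability)
    (hpos : V.Positivity) (a : 𝒜) (m : ℳ) {R : Ω → ℝ}
    (hR : CondMeanZero V.sigmaXA P (fun ω => R ω - V.nuY m (V.XA ω))) {ν : 𝒳 → ℝ}
    (hν : Measurable ν)
    (hf : Integrable (fun ω => ν (V.X ω) +
      (if V.A ω = a then (1 : ℝ) else 0) / V.piA (V.X ω) a * (R ω - ν (V.X ω))) P) :
    ∫ ω, (ν (V.X ω) + (if V.A ω = a then (1 : ℝ) else 0) / V.piA (V.X ω) a *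
      (R ω - ν (V.X ω))) ∂P = V.psi a m := by
  have hνi := integrable_nuY hcons hign hpos a m
  have h2 := condMeanZero_ipwA hpos a hR
  have hg : Measurable (fun x => (V.nuY m (x, a) - ν x) * (V.piA x a)⁻¹) :=
    ((V.measurable_nuY_at m a).sub hν).mul
      (V.measurable_piA a).inv
  -- Replacing the arbitrary `ν` by `ν_y` costs `(ν_y - ν) / π_a * (𝟙(A = a) - π_a)`, a weight in
  -- `X` times the treatment residual.
  have heq : ∀ᵐ ω ∂P, ν (V.X ω) + (if V.A ω = a then (1 : ℝ) else 0) / V.piA (V.X ω) a *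
      (R ω - ν (V.X ω)) = V.nuY m (V.X ω, a) +
      (if (V.XA ω).2 = a then (1 : ℝ) else 0) * (V.piA (V.XA ω).1 a)⁻¹ *
        (R ω - V.nuY m (V.XA ω)) + (V.nuY m (V.X ω, a) - ν (V.X ω)) * (V.piA (V.X ω) a)⁻¹ *
      ((if V.A ω = a then (1 : ℝ) else 0) - V.piA (V.X ω) a) := by
    filter_upwards [ae_piA_pos hpos a] with ω hp
    have hp' := hp.ne'
    by_cases hA : V.A ω = a
    · simp only [XA, hA, if_true]
      field_simp
      ring
    · simp only [XA, hA, if_false]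
      field_simp
      ring
  have hi := hf.congr heq
  have hi3 : Integrable (fun ω => (V.nuY m (V.X ω, a) - ν (V.X ω)) * (V.piA (V.X ω) a)⁻¹ *
      ((if V.A ω = a then (1 : ℝ) else 0) - V.piA (V.X ω) a)) P := by
    refine (hi.sub (hνi.add h2.1)).congr (ae_of_all _ fun ω => ?_)
    simp
  have hz3 := integral_mul_eq_zero
    (g := fun ω => (V.nuY m (V.X ω, a) - ν (V.X ω)) * (V.piA (V.X ω) a)⁻¹) V.sigmaX_le
    (stronglyMeasurable_comp_X hg) (V.condMeanZero_A a) hi3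
  have hi12 : Integrable (fun ω => V.nuY m (V.X ω, a) +
      (if (V.XA ω).2 = a then (1 : ℝ) else 0) * (V.piA (V.XA ω).1 a)⁻¹ *
        (R ω - V.nuY m (V.XA ω))) P := hνi.add h2.1
  rw [integral_congr_ae heq, integral_add hi12 hi3, hz3, integral_add hνi h2.1,
    h2.integral_eq_zero V.sigmaXA_le, integral_nuY hcons hign hpos a m, add_zero, add_zero]

/-- Inverse probability weighting of an augmented outcome. -/
theorem integral_weighted_of_piA (hcons : V.Consistency) (hign : V.SequentialIgnorability)
    (hpos : V.Positivity) (a : 𝒜) (m : ℳ) {R g D : Ω → ℝ}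
    (hR : CondMeanZero V.sigmaXA P (fun ω => R ω - V.nuY m (V.XA ω)))
    (hm : V.sigmaXA ≤ m₂) (hm₂ : m₂ ≤ mΩ)
    (hg : StronglyMeasurable[m₂] g) (hD : CondMeanZero m₂ P D)
    (hf : Integrable (fun ω => (if V.A ω = a then (1 : ℝ) else 0) / V.piA (V.X ω) a *
      (R ω + g ω * D ω)) P) :
    ∫ ω, (if V.A ω = a then (1 : ℝ) else 0) / V.piA (V.X ω) a * (R ω + g ω * D ω) ∂P =
      V.psi a m := by
  have hm0 : Measurable (fun v : 𝒳 × 𝒜 => (if v.2 = a then (1 : ℝ) else 0) / V.piA v.1 a) :=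
    (measurable_ite_A a measurable_snd).div ((V.measurable_piA a).comp measurable_fst)
  have h2 := condMeanZero_ipwA hpos a hR
  obtain ⟨C, hC⟩ := exists_bound_inv_piA hpos a
  have hνi := integrable_nuY hcons hign hpos a m
  have h1 : CondMeanZero V.sigmaX P (fun ω => V.nuY m (V.X ω, a) * ((V.piA (V.X ω) a)⁻¹ *
      ((if V.A ω = a then (1 : ℝ) else 0) - V.piA (V.X ω) a))) := by
    have hinv := (V.condMeanZero_A a).mul_of_bound V.sigmaX_le
      (stronglyMeasurable_comp_X (V.measurable_piA a).inv) hC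
    refine hinv.mul (g := fun ω => V.nuY m (V.X ω, a)) (stronglyMeasurable_comp_X
      (V.measurable_nuY_at m a)) ?_
    refine hνi.mul_bdd (c := C + 1) hinv.1.aestronglyMeasurable ?_
    filter_upwards [hC, ae_piA_pos hpos a] with ω hω hp
    change ‖(V.piA (V.X ω) a)⁻¹ * _‖ ≤ _
    rw [mul_sub, inv_mul_cancel₀ hp.ne', Real.norm_eq_abs]
    refine (abs_sub _ _).trans ?_
    rw [abs_one]
    gcongr
    split_ifs
    · simpa using hω
    · simpa using (abs_nonneg _).trans hω
  -- The weighted outcome is `ν_y` plus three mean-zero terms: the treatment residual weighted by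
  -- `ν_y / π_a`, the weighted error of `R`, and the weighted `g * D`. The last has no bound of its
  -- own and is integrable by subtraction.
  have heq : ∀ᵐ ω ∂P, (if V.A ω = a then (1 : ℝ) else 0) / V.piA (V.X ω) a *
      (R ω + g ω * D ω) = V.nuY m (V.X ω, a) + V.nuY m (V.X ω, a) * ((V.piA (V.X ω) a)⁻¹ *
      ((if V.A ω = a then (1 : ℝ) else 0) - V.piA (V.X ω) a)) +
      (if (V.XA ω).2 = a then (1 : ℝ) else 0) * (V.piA (V.XA ω).1 a)⁻¹ *
        (R ω - V.nuY m (V.XA ω)) +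
      ((if V.A ω = a then (1 : ℝ) else 0) / V.piA (V.X ω) a * g ω) * D ω := by
    filter_upwards [ae_piA_pos hpos a] with ω hp
    have hp' := hp.ne'
    by_cases hA : V.A ω = a
    · simp only [XA, hA, if_true]
      field_simp
      ring
    · simp only [XA, hA, if_false]
      field_simp
      ring
  have hi12 : Integrable (fun ω => V.nuY m (V.X ω, a) + V.nuY m (V.X ω, a) *
      ((V.piA (V.X ω) a)⁻¹ * ((if V.A ω = a then (1 : ℝ) else 0) - V.piA (V.X ω) a))) P :=
    hνi.add h1.1
  have hi123 : Integrable (fun ω => V.nuY m (V.X ω, a) + V.nuY m (V.X ω, a) *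
      ((V.piA (V.X ω) a)⁻¹ * ((if V.A ω = a then (1 : ℝ) else 0) - V.piA (V.X ω) a)) +
      (if (V.XA ω).2 = a then (1 : ℝ) else 0) * (V.piA (V.XA ω).1 a)⁻¹ *
        (R ω - V.nuY m (V.XA ω))) P := hi12.add h2.1
  have hi4 : Integrable (fun ω =>
      ((if V.A ω = a then (1 : ℝ) else 0) / V.piA (V.X ω) a * g ω) * D ω) P := by
    refine ((hf.congr heq).sub hi123).congr (ae_of_all _ fun ω => ?_)
    simp
  have hz4 := integral_mul_eq_zero
    (g := fun ω => (if V.A ω = a then (1 : ℝ) else 0) / V.piA (V.X ω) a * g ω) hm₂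
    (((stronglyMeasurable_comp_XA hm0).mono hm).mul hg) hD hi4
  rw [integral_congr_ae heq, integral_add hi123 hi4, hz4, integral_add hi12 h2.1,
    h2.integral_eq_zero V.sigmaXA_le, integral_add hνi h1.1, h1.integral_eq_zero V.sigmaX_le,
    integral_nuY hcons hign hpos a m, add_zero, add_zero, add_zero]

end Population

namespace WorkingModels

/-! ### Joint measurability in observation and parameter -/

section Measurability

variable {𝒳 𝒜 𝒵 ℳ : Type*} [MeasurableSpace 𝒳] [MeasurableSpace 𝒜] [MeasurableSpace 𝒵]
  [MeasurableSpace ℳ] [DecidableEq 𝒜] [DecidableEq ℳ] [MeasurableSingletonClass 𝒜]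
  [MeasurableSingletonClass ℳ] {a : 𝒜} {m : ℳ} (W : WorkingModels 𝒳 𝒵 a m)
  {T : Type*} [MeasurableSpace T] {o : T → Obs 𝒳 𝒜 𝒵 ℳ}

theorem measurable_mu_comp {β : T → Par W.dMu} {v : T → 𝒳 × 𝒜 × 𝒵 × ℳ} (hβ : Measurable β)
    (hv : Measurable v) : Measurable (fun t => W.mu (β t) (v t)) :=
  W.measurable_mu.comp (hβ.prodMk hv)

theorem measurable_nu_comp {η : T → Par W.dNu} {v : T → 𝒳 × 𝒜} (hη : Measurable η)
    (hv : Measurable v) : Measurable (fun t => W.nu (η t) (v t)) :=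
  W.measurable_nu.comp (hη.prodMk hv)

theorem measurable_pA_comp {α : T → Par W.dA} {x : T → 𝒳} (hα : Measurable α)
    (hx : Measurable x) (l : 𝒜) : Measurable (fun t => W.pA (α t) (x t) l) :=
  (W.measurable_pA l).comp (hα.prodMk hx)

theorem measurable_pM_comp {γ : T → Par W.dM} {v : T → 𝒳 × 𝒜 × 𝒵} (hγ : Measurable γ)
    (hv : Measurable v) (l : ℳ) : Measurable (fun t => W.pM (γ t) (v t) l) :=
  (W.measurable_pM l).comp (hγ.prodMk hv)

theorem measurable_ite_eq {S : Type*} [MeasurableSpace S] [MeasurableSingletonClass S]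
    [DecidableEq S] {f : T → S} (hf : Measurable f) (s : S) :
    Measurable (fun t => if f t = s then (1 : ℝ) else 0) :=
  Measurable.ite (hf (measurableSet_singleton s)) measurable_const measurable_const

theorem measurable_scoreMu {β : T → Par W.dMu} (ho : Measurable o) (hβ : Measurable β) :
    Measurable (fun t => W.scoreMu (o t) (β t)) := by
  have hv : Measurable fun t =>
      ((o t).1, (o t).2.1, (o t).2.2.1, (o t).2.2.2.1) := by fun_prop
  refine Measurable.ite (p := fun t => (o t).2.1 ∈ W.S ∧ (o t).2.2.2.1 ∈ W.T) ?_ ?_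
    measurable_const
  · exact (ho.snd.fst W.S.measurableSet).inter (ho.snd.snd.snd.fst W.T.measurableSet)
  · exact (ho.snd.snd.snd.snd.sub (W.measurable_mu_comp hβ hv)).smul
      (W.measurable_wMu.comp (hβ.prodMk hv))

theorem measurable_scoreA {α : T → Par W.dA} (ho : Measurable o) (hα : Measurable α) :
    Measurable (fun t => W.scoreA (o t) (α t)) := by
  change Measurable (fun t => ∑ l ∈ W.LA,
    ((if (o t).2.1 = l then (1 : ℝ) else 0) - W.pA (α t) (o t).1 l) • W.wA (α t) (o t).1 l)
  exact Finset.measurable_sum _ fun l _ =>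
    ((measurable_ite_eq ho.snd.fst l).sub (W.measurable_pA_comp hα ho.fst l)).smul
      ((W.measurable_wA l).comp (hα.prodMk ho.fst))

theorem measurable_scoreM {γ : T → Par W.dM} (ho : Measurable o) (hγ : Measurable γ) :
    Measurable (fun t => W.scoreM (o t) (γ t)) := by
  have hv : Measurable fun t => ((o t).1, (o t).2.1, (o t).2.2.1) := by fun_prop
  refine Measurable.ite (p := fun t => (o t).2.1 ∈ W.S) (ho.snd.fst W.S.measurableSet) ?_
    measurable_const
  exact Finset.measurable_sum _ fun l _ =>
    ((measurable_ite_eq ho.snd.snd.snd.fst l).sub (W.measurable_pM_comp hγ hv l)).smul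
      ((W.measurable_wM l).comp (hγ.prodMk hv))

/-- The response varies with `t` because it carries the parameters of the earlier steps. -/
theorem measurable_scoreNu {η : T → Par W.dNu} {u : T → Obs 𝒳 𝒜 𝒵 ℳ → ℝ} (ho : Measurable o)
    (hη : Measurable η) (hu : Measurable (fun t => u t (o t))) :
    Measurable (fun t => W.scoreNu (u t) (o t) (η t)) := by
  have hv : Measurable fun t => ((o t).1, (o t).2.1) := by fun_prop
  refine Measurable.ite (p := fun t => (o t).2.1 ∈ W.S) (ho.snd.fst W.S.measurableSet) ?_
    measurable_const
  exact (hu.sub (W.measurable_nu_comp hη hv)).smul (W.measurable_wNu.comp (hη.prodMk hv))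

theorem measurable_respMu {β : T → Par W.dMu} (ho : Measurable o) (hβ : Measurable β) :
    Measurable (fun t => W.respMu (β t) (o t)) :=
  W.measurable_mu_comp (v := fun t => ((o t).1, (o t).2.1, (o t).2.2.1, m)) hβ (by fun_prop)

theorem measurable_respM {γ : T → Par W.dM} (ho : Measurable o) (hγ : Measurable γ) :
    Measurable (fun t => W.respM (γ t) (o t)) :=
  ((measurable_ite_eq ho.snd.snd.snd.fst m).mul ho.snd.snd.snd.snd).div
    (W.measurable_pM_comp (v := fun t => ((o t).1, (o t).2.1, (o t).2.2.1)) hγ (by fun_prop) m)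

theorem measurable_respMuM {β : T → Par W.dMu} {γ : T → Par W.dM} (ho : Measurable o)
    (hβ : Measurable β) (hγ : Measurable γ) :
    Measurable (fun t => W.respMuM (β t) (γ t) (o t)) := by
  have hmu := W.measurable_mu_comp (v := fun t => ((o t).1, (o t).2.1, (o t).2.2.1, m)) hβ
    (by fun_prop)
  exact hmu.add (((measurable_ite_eq ho.snd.snd.snd.fst m).div
    (W.measurable_pM_comp (v := fun t => ((o t).1, (o t).2.1, (o t).2.2.1)) hγ
      (by fun_prop) m)).mul (ho.snd.snd.snd.snd.sub hmu))

theorem measurable_system1 : Measurable (Function.uncurry W.system1) :=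
  (W.measurable_scoreMu measurable_fst measurable_snd.fst).prodMk
    ((W.measurable_scoreNu (u := fun q : Obs 𝒳 𝒜 𝒵 ℳ × W.Par1 => W.respMu q.2.1) measurable_fst
      measurable_snd.snd.fst (W.measurable_respMu measurable_fst measurable_snd.fst)).prodMk
      (W.measurable_scoreA measurable_fst measurable_snd.snd.snd))

theorem measurable_system2 : Measurable (Function.uncurry W.system2) :=
  (W.measurable_scoreM measurable_fst measurable_snd.fst).prodMk
    ((W.measurable_scoreNu (u := fun q : Obs 𝒳 𝒜 𝒵 ℳ × W.Par2 => W.respM q.2.1) measurable_fst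
      measurable_snd.snd.fst (W.measurable_respM measurable_fst measurable_snd.fst)).prodMk
      (W.measurable_scoreA measurable_fst measurable_snd.snd.snd))

theorem measurable_system3 : Measurable (Function.uncurry W.system3) :=
  (W.measurable_scoreMu measurable_fst measurable_snd.fst).prodMk
    ((W.measurable_scoreM measurable_fst measurable_snd.snd.fst).prodMk
      (W.measurable_scoreA measurable_fst measurable_snd.snd.snd))

theorem measurable_system4 : Measurable (Function.uncurry W.system4) :=
  (W.measurable_scoreMu measurable_fst measurable_snd.fst).prodMk
    ((W.measurable_scoreM measurable_fst measurable_snd.snd.fst).prodMk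
      (W.measurable_scoreNu (u := fun q : Obs 𝒳 𝒜 𝒵 ℳ × W.Par4 => W.respMuM q.2.1 q.2.2.1)
        measurable_fst measurable_snd.snd.snd
        (W.measurable_respMuM measurable_fst measurable_snd.fst measurable_snd.snd.fst)))

theorem measurable_dr1 : Measurable (Function.uncurry W.dr1) := by
  have hν : Measurable fun q : Obs 𝒳 𝒜 𝒵 ℳ × W.Par1 => W.nu q.2.2.1 (q.1.1, a) :=
    W.measurable_nu_comp (by fun_prop) (by fun_prop)
  have hμ : Measurable fun q : Obs 𝒳 𝒜 𝒵 ℳ × W.Par1 => W.mu q.2.1 (q.1.1, a, q.1.2.2.1, m) :=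
    W.measurable_mu_comp (by fun_prop) (by fun_prop)
  exact hν.add (((measurable_ite_eq measurable_fst.snd.fst a).div
    (W.measurable_pA_comp measurable_snd.snd.snd measurable_fst.fst a)).mul (hμ.sub hν))

theorem measurable_dr2 : Measurable (Function.uncurry W.dr2) := by
  have hν : Measurable fun q : Obs 𝒳 𝒜 𝒵 ℳ × W.Par2 => W.nu q.2.2.1 (q.1.1, a) :=
    W.measurable_nu_comp (by fun_prop) (by fun_prop)
  have hp : Measurable fun q : Obs 𝒳 𝒜 𝒵 ℳ × W.Par2 => W.pM q.2.1 (q.1.1, a, q.1.2.2.1) m :=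
    W.measurable_pM_comp (by fun_prop) (by fun_prop) m
  exact hν.add (((measurable_ite_eq measurable_fst.snd.fst a).div
    (W.measurable_pA_comp measurable_snd.snd.snd measurable_fst.fst a)).mul
    ((((measurable_ite_eq measurable_fst.snd.snd.snd.fst m).mul
      measurable_fst.snd.snd.snd.snd).div hp).sub hν))

theorem measurable_dr3 : Measurable (Function.uncurry W.dr3) := by
  have hμ : Measurable fun q : Obs 𝒳 𝒜 𝒵 ℳ × W.Par3 => W.mu q.2.1 (q.1.1, a, q.1.2.2.1, m) :=
    W.measurable_mu_comp (by fun_prop) (by fun_prop)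
  have hp : Measurable fun q : Obs 𝒳 𝒜 𝒵 ℳ × W.Par3 => W.pM q.2.2.1 (q.1.1, a, q.1.2.2.1) m :=
    W.measurable_pM_comp (by fun_prop) (by fun_prop) m
  exact ((measurable_ite_eq measurable_fst.snd.fst a).div
    (W.measurable_pA_comp measurable_snd.snd.snd measurable_fst.fst a)).mul
    (hμ.add (((measurable_ite_eq measurable_fst.snd.snd.snd.fst m).div hp).mul
      (measurable_fst.snd.snd.snd.snd.sub hμ)))

theorem measurable_dr4 : Measurable (Function.uncurry W.dr4) :=
  W.measurable_nu_comp (T := Obs 𝒳 𝒜 𝒵 ℳ × W.Par4) (η := fun q => q.2.2.2)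
    (v := fun q => (q.1.1, a)) (by fun_prop) (by fun_prop)

end Measurability

/-! ### Limits of correctly specified fits and means of the four targets -/

section Limits

variable {Ω 𝒳 𝒜 𝒵 ℳ : Type*} {m₂ : MeasurableSpace Ω} [mΩ : MeasurableSpace Ω]
  [MeasurableSpace 𝒳] [MeasurableSpace 𝒜] [MeasurableSpace 𝒵] [MeasurableSpace ℳ] {P : Measure Ω}
  [IsProbabilityMeasure P] {V : Population Ω 𝒳 𝒜 𝒵 ℳ P}
  [Fintype 𝒜] [Fintype ℳ] [StandardBorelSpace Ω] [StandardBorelSpace 𝒜] [Nonempty 𝒜]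
  [MeasurableSingletonClass 𝒜] [StandardBorelSpace ℳ] [Nonempty ℳ] [MeasurableSingletonClass ℳ]
  [DecidableEq 𝒜] [DecidableEq ℳ] [StandardBorelSpace 𝒵] [Nonempty 𝒵] {a : 𝒜} {m : ℳ}
  {W : WorkingModels 𝒳 𝒵 a m}

theorem scoreMu_obs (β : Par W.dMu) (ω : Ω) : W.scoreMu (V.obs ω) β =
    if V.A ω ∈ W.S ∧ V.M ω ∈ W.T then
      (V.Y ω - W.mu β (V.XAZM ω)) • W.wMu β (V.XAZM ω) else 0 := rfl

theorem scoreA_obs (α : Par W.dA) (ω : Ω) : W.scoreA (V.obs ω) α =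
    ∑ l ∈ W.LA, ((if V.A ω = l then (1 : ℝ) else 0) - W.pA α (V.X ω) l) • W.wA α (V.X ω) l := rfl

theorem scoreM_obs (γ : Par W.dM) (ω : Ω) : W.scoreM (V.obs ω) γ =
    if V.A ω ∈ W.S then ∑ l ∈ W.LM,
      ((if V.M ω = l then (1 : ℝ) else 0) - W.pM γ (V.XAZ ω) l) • W.wM γ (V.XAZ ω) l else 0 := rfl

theorem scoreNu_obs (u : Obs 𝒳 𝒜 𝒵 ℳ → ℝ) (η : Par W.dNu) (ω : Ω) :
    W.scoreNu u (V.obs ω) η =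
      if V.A ω ∈ W.S then (u (V.obs ω) - W.nu η (V.XA ω)) • W.wNu η (V.XA ω) else 0 := rfl

theorem respMuM_obs (β : Par W.dMu) (γ : Par W.dM) (ω : Ω) : W.respMuM β γ (V.obs ω) =
    W.mu β (V.X ω, V.A ω, V.Z ω, m) + (if V.M ω = m then (1 : ℝ) else 0) /
      W.pM γ (V.X ω, V.A ω, V.Z ω) m * (V.Y ω - W.mu β (V.X ω, V.A ω, V.Z ω, m)) := rfl

theorem dr1_obs (θ : W.Par1) (ω : Ω) : W.dr1 (V.obs ω) θ =
    W.nu θ.2.1 (V.X ω, a) + (if V.A ω = a then (1 : ℝ) else 0) / W.pA θ.2.2 (V.X ω) a *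
      (W.mu θ.1 (V.X ω, a, V.Z ω, m) - W.nu θ.2.1 (V.X ω, a)) := rfl

theorem dr2_obs (θ : W.Par2) (ω : Ω) : W.dr2 (V.obs ω) θ =
    W.nu θ.2.1 (V.X ω, a) + (if V.A ω = a then (1 : ℝ) else 0) / W.pA θ.2.2 (V.X ω) a *
      ((if V.M ω = m then (1 : ℝ) else 0) * V.Y ω / W.pM θ.1 (V.X ω, a, V.Z ω) m -
        W.nu θ.2.1 (V.X ω, a)) := rfl

theorem dr3_obs (θ : W.Par3) (ω : Ω) : W.dr3 (V.obs ω) θ =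
    (if V.A ω = a then (1 : ℝ) else 0) / W.pA θ.2.2 (V.X ω) a *
      (W.mu θ.1 (V.X ω, a, V.Z ω, m) + (if V.M ω = m then (1 : ℝ) else 0) /
        W.pM θ.2.1 (V.X ω, a, V.Z ω) m * (V.Y ω - W.mu θ.1 (V.X ω, a, V.Z ω, m))) := rfl

theorem integrable_comp_obs {F : Type*} [NormedAddCommGroup F] {f : Obs 𝒳 𝒜 𝒵 ℳ → F}
    (hf : Integrable f V.law) : Integrable (fun ω => f (V.obs ω)) P :=
  hf.comp_measurable V.measurable_obs

theorem integral_law {F : Type*} [NormedAddCommGroup F] [NormedSpace ℝ F]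
    {f : Obs 𝒳 𝒜 𝒵 ℳ → F} (hf : AEStronglyMeasurable f V.law) :
    ∫ o, f o ∂V.law = ∫ ω, f (V.obs ω) ∂P :=
  integral_map V.measurable_obs.aemeasurable hf

/-- The limit of a fitted parameter is the true one if the latter solves the population estimating
equation. -/
theorem eq_of_integral_eq_zero {d : ℕ} {U : Obs 𝒳 𝒜 𝒵 ℳ → Par d → Par d} {Θ : Set (Par d)}
    {θ θ₀ : Par d} (hI : Identified V.law U Θ θ) (h₀ : θ₀ ∈ Θ)
    (h : ∀ j, ∫ ω, U (V.obs ω) θ₀ j ∂P = 0) : θ₀ = θ := by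
  have hi := hI.integrable θ₀ h₀
  refine hI.unique θ₀ h₀ ?_
  rw [integral_law hi.1]
  exact integral_euclidean_eq_zero (integrable_comp_obs hi) h

theorem integrable_score_apply {d : ℕ} {U : Obs 𝒳 𝒜 𝒵 ℳ → Par d → Par d} {Θ : Set (Par d)}
    {θ θ₀ : Par d} (hI : Identified V.law U Θ θ) (h₀ : θ₀ ∈ Θ) (j : Fin d) :
    Integrable (fun ω => U (V.obs ω) θ₀ j) P :=
  integrable_euclidean_apply (integrable_comp_obs (hI.integrable θ₀ h₀)) j

theorem measurable_apply {T : Type*} [MeasurableSpace T] {d : ℕ} {f : T → Par d}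
    (hf : Measurable f) (j : Fin d) : Measurable (fun t => f t j) :=
  (EuclideanSpace.proj (𝕜 := ℝ) j).measurable.comp hf

/-- The score at the correct parameter is a function of `(X, A, Z, M)` times `Y - μ_y`, so that
parameter is the limit. Correctness concerns observed mediators; positivity moves it to the fixed
level `m ∈ T` for every unit with `A ∈ S`. -/
theorem mu_eq_muYAt (hcons : V.Consistency) (hpos : V.Positivity) {β : Par W.dMu}
    (hI : Identified V.law W.scoreMu W.ΘMu β) (hc : W.MuCorrect V) :
    ∀ᵐ ω ∂P, V.A ω ∈ W.S → W.mu β (V.X ω, V.A ω, V.Z ω, m) = V.muYAt m ω := by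
  obtain ⟨β₀, hβ₀, hcorr⟩ := hc
  have hcorr' := ae_of_ae_map V.measurable_XAZM.aemeasurable hcorr
  have hβ : β₀ = β := by
    refine eq_of_integral_eq_zero hI hβ₀ fun j => ?_
    have hi := integrable_score_apply hI hβ₀ j
    let g : 𝒳 × 𝒜 × 𝒵 × ℳ → ℝ := fun v =>
      (if v.2.1 ∈ W.S ∧ v.2.2.2 ∈ W.T then 1 else 0) * W.wMu β₀ v j
    have hg : Measurable g := by
      refine Measurable.mul (Measurable.ite ?_ measurable_const measurable_const) ?_
      · exact (measurable_snd.fst W.S.measurableSet).inter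
          (measurable_snd.snd.snd W.T.measurableSet)
      · exact measurable_apply (W.measurable_wMu.comp (measurable_const.prodMk measurable_id)) j
    have heq : ∀ᵐ ω ∂P, W.scoreMu (V.obs ω) β₀ j =
        g (V.XAZM ω) * (V.Y ω - V.muY (V.XAZM ω)) := by
      filter_upwards [hcorr'] with ω hω
      by_cases h : V.A ω ∈ W.S ∧ V.M ω ∈ W.T
      · have h2 := hω h.1 h.2
        have hgω : g (V.XAZM ω) = W.wMu β₀ (V.XAZM ω) j := by
          rw [show g (V.XAZM ω) = (if V.A ω ∈ W.S ∧ V.M ω ∈ W.T then 1 else 0) *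
            W.wMu β₀ (V.XAZM ω) j from rfl, if_pos h, one_mul]
        rw [scoreMu_obs, if_pos h, h2, hgω, PiLp.smul_apply, smul_eq_mul, mul_comm]
      · have hgω : g (V.XAZM ω) = 0 := by
          rw [show g (V.XAZM ω) = (if V.A ω ∈ W.S ∧ V.M ω ∈ W.T then 1 else 0) *
            W.wMu β₀ (V.XAZM ω) j from rfl, if_neg h, zero_mul]
        rw [scoreMu_obs, if_neg h, hgω, zero_mul, PiLp.zero_apply]
    rw [integral_congr_ae heq]
    exact integral_mul_eq_zero V.sigmaXAZM_le (Population.stronglyMeasurable_comp_XAZM hg)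
      (Population.condMeanZero_Y hcons) (hi.congr heq)
  subst hβ
  have hmu : Measurable fun v : 𝒳 × 𝒜 × 𝒵 => W.mu β₀ (v.1, v.2.1, v.2.2, m) :=
    W.measurable_mu_comp measurable_const (by fun_prop)
  have hS : MeasurableSet {v : 𝒳 × 𝒜 × 𝒵 | v.2.1 ∈ W.S} := measurable_snd.fst W.S.measurableSet
  refine Population.ae_XAZ_of_imp hpos m (B := {v | v.2.1 ∈ W.S →
    W.mu β₀ (v.1, v.2.1, v.2.2, m) = V.muY (v.1, v.2.1, v.2.2, m)})
    (hS.imp (measurableSet_eq_fun hmu (V.measurable_muY_at m))) ?_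
  filter_upwards [hcorr'] with ω hω hM hA
  subst hM
  exact hω hA W.m_mem_T

/-- The score at the correct parameter is a sum over levels of weights in `X` times treatment
residuals, of which only the sum is known to be integrable. -/
theorem pA_eq_piA {α : Par W.dA} (hI : Identified V.law W.scoreA W.ΘA α) (hc : W.PiACorrect V) :
    ∀ᵐ ω ∂P, W.pA α (V.X ω) a = V.piA (V.X ω) a := by
  obtain ⟨α₀, hα₀, hcorr⟩ := hc
  have hcorr' := ae_of_ae_map V.measurable_X.aemeasurable hcorr
  have hα : α₀ = α := by
    refine eq_of_integral_eq_zero hI hα₀ fun j => ?_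
    have hi := integrable_score_apply hI hα₀ j
    have heq : ∀ᵐ ω ∂P, W.scoreA (V.obs ω) α₀ j = ∑ l ∈ W.LA, W.wA α₀ (V.X ω) l j *
        ((if V.A ω = l then (1 : ℝ) else 0) - V.piA (V.X ω) l) := by
      filter_upwards [hcorr'] with ω hω
      simp only [scoreA_obs, WithLp.ofLp_sum, Finset.sum_apply, PiLp.smul_apply, smul_eq_mul]
      refine Finset.sum_congr rfl fun l hl => ?_
      rw [hω l hl, mul_comm]
    rw [integral_congr_ae heq]
    exact integral_sum_mul_eq_zero V.sigmaX_le W.LA (g := fun l ω => W.wA α₀ (V.X ω) l j)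
      (fun l _ => Population.stronglyMeasurable_comp_X (g := fun x => W.wA α₀ x l j)
        (measurable_apply ((W.measurable_wA l).comp (measurable_const.prodMk measurable_id)) j))
      (fun l _ => V.condMeanZero_A l) (hi.congr heq)
  subst hα
  filter_upwards [hcorr'] with ω hω using hω a W.a_mem_LA

theorem pM_eq_piM {γ : Par W.dM} (hI : Identified V.law W.scoreM W.ΘM γ) (hc : W.PiMCorrect V) :
    ∀ᵐ ω ∂P, V.A ω ∈ W.S → W.pM γ (V.XAZ ω) m = V.piM (V.XAZ ω) m := by
  obtain ⟨γ₀, hγ₀, hcorr⟩ := hc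
  have hcorr' := ae_of_ae_map V.measurable_XAZ.aemeasurable hcorr
  have hγ : γ₀ = γ := by
    refine eq_of_integral_eq_zero hI hγ₀ fun j => ?_
    have hi := integrable_score_apply hI hγ₀ j
    let g : ℳ → 𝒳 × 𝒜 × 𝒵 → ℝ := fun l v =>
      (if v.2.1 ∈ W.S then 1 else 0) * W.wM γ₀ v l j
    have hg : ∀ l, Measurable (g l) := fun l =>
      (Measurable.ite (measurable_snd.fst W.S.measurableSet) measurable_const
        measurable_const).mul
        (measurable_apply ((W.measurable_wM l).comp (measurable_const.prodMk measurable_id)) j)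
    have heq : ∀ᵐ ω ∂P, W.scoreM (V.obs ω) γ₀ j = ∑ l ∈ W.LM, g l (V.XAZ ω) *
        ((if V.M ω = l then (1 : ℝ) else 0) - V.piM (V.XAZ ω) l) := by
      filter_upwards [hcorr'] with ω hω
      by_cases h : V.A ω ∈ W.S
      · have h2 := hω h
        rw [scoreM_obs, if_pos h]
        simp only [WithLp.ofLp_sum, Finset.sum_apply, PiLp.smul_apply, smul_eq_mul]
        refine Finset.sum_congr rfl fun l hl => ?_
        rw [show g l (V.XAZ ω) = (if V.A ω ∈ W.S then 1 else 0) * W.wM γ₀ (V.XAZ ω) l j from rfl,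
          if_pos h, h2 l hl, one_mul, mul_comm]
      · rw [scoreM_obs, if_neg h, PiLp.zero_apply]
        refine (Finset.sum_eq_zero fun l _ => ?_).symm
        rw [show g l (V.XAZ ω) = (if V.A ω ∈ W.S then 1 else 0) * W.wM γ₀ (V.XAZ ω) l j from rfl,
          if_neg h, zero_mul, zero_mul]
    rw [integral_congr_ae heq]
    exact integral_sum_mul_eq_zero V.sigmaXAZ_le W.LM (g := fun l ω => g l (V.XAZ ω))
      (fun l _ => Population.stronglyMeasurable_comp_XAZ (hg l))
      (fun l _ => V.condMeanZero_M l) (hi.congr heq)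
  subst hγ
  filter_upwards [hcorr'] with ω hω hA using hω hA m W.m_mem_LM

/-- One statement serves all three responses: `R` carries the conditional mean `ν_y`, while `g * D`
absorbs a misspecified ingredient. The σ-algebra `m₂` is that of `(X, A, Z)` or of `(X, A, Z, M)`,
according to which ingredient is correct. -/
theorem nu_eq_nuY (hpos : V.Positivity) {η : Par W.dNu} {u : Obs 𝒳 𝒜 𝒵 ℳ → ℝ}
    (hI : Identified V.law (W.scoreNu u) W.ΘNu η) (hc : W.NuCorrect V) {R g D : Ω → ℝ}
    (hR : CondMeanZero V.sigmaXA P (fun ω => R ω - V.nuY m (V.XA ω)))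
    (hm : V.sigmaXA ≤ m₂) (hm₂ : m₂ ≤ mΩ) (hg : StronglyMeasurable[m₂] g)
    (hD : CondMeanZero m₂ P D)
    (hu : ∀ᵐ ω ∂P, V.A ω ∈ W.S → u (V.obs ω) = R ω + g ω * D ω) :
    ∀ᵐ ω ∂P, W.nu η (V.X ω, a) = V.nuY m (V.X ω, a) := by
  obtain ⟨η₀, hη₀, hcorr⟩ := hc
  have hcorr' := ae_of_ae_map V.measurable_XA.aemeasurable hcorr
  have hη : η₀ = η := by
    refine eq_of_integral_eq_zero hI hη₀ fun j => ?_
    have hi := integrable_score_apply hI hη₀ j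
    let w : 𝒳 × 𝒜 → ℝ := fun v => (if v.2 ∈ W.S then 1 else 0) * W.wNu η₀ v j
    have hw : Measurable w :=
      (Measurable.ite (measurable_snd W.S.measurableSet) measurable_const
        measurable_const).mul
        (measurable_apply (W.measurable_wNu.comp (measurable_const.prodMk measurable_id)) j)
    have heq : ∀ᵐ ω ∂P, W.scoreNu u (V.obs ω) η₀ j =
        w (V.XA ω) * ((R ω - V.nuY m (V.XA ω)) + g ω * D ω) := by
      filter_upwards [hcorr', hu] with ω hω hu
      by_cases h : V.A ω ∈ W.S
      · have h2 := hω h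
        have h3 := hu h
        rw [scoreNu_obs, if_pos h, h2, h3, PiLp.smul_apply, smul_eq_mul,
          show w (V.XA ω) = (if V.A ω ∈ W.S then 1 else 0) * W.wNu η₀ (V.XA ω) j from rfl,
          if_pos h]
        ring
      · rw [scoreNu_obs, if_neg h, PiLp.zero_apply,
          show w (V.XA ω) = (if V.A ω ∈ W.S then 1 else 0) * W.wNu η₀ (V.XA ω) j from rfl,
          if_neg h, zero_mul, zero_mul]
    rw [integral_congr_ae heq]
    exact integral_mul_add_mul_eq_zero hm hm₂ (Population.stronglyMeasurable_comp_XA hw) hg hR hD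
      (hi.congr heq)
  subst hη
  refine Population.ae_X_of_imp hpos a (B := {x | W.nu η₀ (x, a) = V.nuY m (x, a)})
    (measurableSet_eq_fun (W.measurable_nu_comp measurable_const (by fun_prop))
      (V.measurable_nuY_at m a)) ?_
  filter_upwards [hcorr'] with ω hω hA
  have := hω (by rw [Population.XA, hA]; exact W.a_mem_S)
  rwa [Population.XA, hA] at this

theorem measurable_neg_mu_div_piM (β : Par W.dMu) : Measurable fun v : 𝒳 × 𝒜 × 𝒵 =>
    -W.mu β (v.1, v.2.1, v.2.2, m) / V.piM v m :=
  (W.measurable_mu_comp measurable_const (by fun_prop)).neg.div (V.measurable_piM m)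

theorem measurable_ite_div_pM (γ : Par W.dM) : Measurable fun v : 𝒳 × 𝒜 × 𝒵 × ℳ =>
    (if v.2.2.2 = m then (1 : ℝ) else 0) / W.pM γ (v.1, v.2.1, v.2.2.1) m :=
  (measurable_ite_eq measurable_snd.snd.snd m).div
    (W.measurable_pM_comp measurable_const (by fun_prop) m)

/-- With the true mediator probability, the possibly wrong `μ` enters only as a multiple of the
mediator residual. -/
theorem respMuM_eq_of_piM (hpos : V.Positivity) (β : Par W.dMu) {γ : Par W.dM}
    (hM : Identified V.law W.scoreM W.ΘM γ) (hc : W.PiMCorrect V) :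
    ∀ᵐ ω ∂P, V.A ω ∈ W.S → W.respMuM β γ (V.obs ω) = V.ipwOutcome m ω +
      -W.mu β (V.X ω, V.A ω, V.Z ω, m) / V.piM (V.XAZ ω) m *
        ((if V.M ω = m then (1 : ℝ) else 0) - V.piM (V.XAZ ω) m) := by
  filter_upwards [pM_eq_piM hM hc, Population.ae_piM_pos hpos m] with ω hω hp hA
  have h1 : W.pM γ (V.X ω, V.A ω, V.Z ω) m = V.piM (V.XAZ ω) m := hω hA
  have hp' := hp.ne'
  rw [respMuM_obs, h1, Population.ipwOutcome]
  field_simp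
  ring

/-- With the true outcome regression, the possibly wrong `p_M` enters only as a factor of the
outcome residual on `M = m`. -/
theorem respMuM_eq_of_mu (hcons : V.Consistency) (hpos : V.Positivity) {β : Par W.dMu}
    (γ : Par W.dM) (hμ : Identified V.law W.scoreMu W.ΘMu β) (hc : W.MuCorrect V) :
    ∀ᵐ ω ∂P, V.A ω ∈ W.S → W.respMuM β γ (V.obs ω) = V.muYAt m ω +
      (if V.M ω = m then (1 : ℝ) else 0) / W.pM γ (V.X ω, V.A ω, V.Z ω) m *
        (V.Y ω - V.muY (V.XAZM ω)) := by
  filter_upwards [mu_eq_muYAt hcons hpos hμ hc] with ω hω hA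
  rw [respMuM_obs, hω hA]
  by_cases hMm : V.M ω = m
  · rw [show V.muY (V.XAZM ω) = V.muYAt m ω by
      rw [Population.muYAt, Population.XAZM, hMm]]
  · rw [if_neg hMm, zero_div, zero_mul, zero_mul]

theorem integral_dr1 (hcons : V.Consistency) (hign : V.SequentialIgnorability)
    (hpos : V.Positivity) {θ : W.Par1} (hreg : W.Regular1 V.law θ) (hμ : W.MuCorrect V)
    (hc : W.NuCorrect V ∨ W.PiACorrect V) [IsFiniteMeasure V.law] :
    ∫ o, W.dr1 o θ ∂V.law = V.psi a m := by
  have hi : Integrable (fun o => W.dr1 o θ) V.law :=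
    hreg.regular.memLp_target.integrable one_le_two
  rw [integral_law hi.1]
  have hi' := integrable_comp_obs hi
  have hR := Population.condMeanZero_muYAt hcons hign hpos m
  have hmu := mu_eq_muYAt hcons hpos hreg.mu hμ
  rcases hc with hc | hc
  · have hν := nu_eq_nuY hpos hreg.nu hc hR V.sigmaXA_le_sigmaXAZ V.sigmaXAZ_le
      (g := fun _ => 0) stronglyMeasurable_const (V.condMeanZero_M m) (by
        filter_upwards [hmu] with ω hω hA
        rw [zero_mul, add_zero, ← hω hA]
        rfl)
    have heq : ∀ᵐ ω ∂P, W.dr1 (V.obs ω) θ = V.nuY m (V.X ω, a) +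
        (if V.A ω = a then (1 : ℝ) else 0) / W.pA θ.2.2 (V.X ω) a *
          (V.muYAt m ω - V.nuY m (V.X ω, a)) := by
      filter_upwards [hν, hmu] with ω h1 h2
      simp only [dr1_obs, h1]
      by_cases hA : V.A ω = a
      · have := h2 (hA ▸ W.a_mem_S)
        rw [← this, hA]
      · simp [hA]
    rw [integral_congr_ae heq]
    exact Population.integral_augmented_of_nu hcons hign hpos a m hR
      (W.measurable_pA_comp measurable_const measurable_id a) (hi'.congr heq)
  · have hA := pA_eq_piA hreg.piA hc
    have heq : ∀ᵐ ω ∂P, W.dr1 (V.obs ω) θ = W.nu θ.2.1 (V.X ω, a) +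
        (if V.A ω = a then (1 : ℝ) else 0) / V.piA (V.X ω) a *
          (V.muYAt m ω - W.nu θ.2.1 (V.X ω, a)) := by
      filter_upwards [hA, hmu] with ω h1 h2
      simp only [dr1_obs, h1]
      by_cases hA : V.A ω = a
      · have := h2 (hA ▸ W.a_mem_S)
        rw [← this, hA]
      · simp [hA]
    rw [integral_congr_ae heq]
    exact Population.integral_augmented_of_piA hcons hign hpos a m hR
      (ν := fun x => W.nu θ.2.1 (x, a))
      (W.measurable_nu_comp measurable_const (by fun_prop)) (hi'.congr heq)

theorem integral_dr2 (hcons : V.Consistency) (hign : V.SequentialIgnorability)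
    (hpos : V.Positivity) {θ : W.Par2} (hreg : W.Regular2 V.law θ) (hM : W.PiMCorrect V)
    (hc : W.NuCorrect V ∨ W.PiACorrect V) [IsFiniteMeasure V.law] :
    ∫ o, W.dr2 o θ ∂V.law = V.psi a m := by
  have hi : Integrable (fun o => W.dr2 o θ) V.law :=
    hreg.regular.memLp_target.integrable one_le_two
  rw [integral_law hi.1]
  have hi' := integrable_comp_obs hi
  have hR := Population.condMeanZero_ipwOutcome hcons hign hpos m
  have hpM := pM_eq_piM hreg.piM hM
  rcases hc with hc | hc
  · have hν := nu_eq_nuY hpos hreg.nu hc hR V.sigmaXA_le_sigmaXAZ V.sigmaXAZ_le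
      (g := fun _ => 0) stronglyMeasurable_const (V.condMeanZero_M m) (by
        filter_upwards [hpM] with ω hω hA
        rw [zero_mul, add_zero, Population.ipwOutcome, ← hω hA]
        rfl)
    have heq : ∀ᵐ ω ∂P, W.dr2 (V.obs ω) θ = V.nuY m (V.X ω, a) +
        (if V.A ω = a then (1 : ℝ) else 0) / W.pA θ.2.2 (V.X ω) a *
          (V.ipwOutcome m ω - V.nuY m (V.X ω, a)) := by
      filter_upwards [hν, hpM] with ω h1 h2
      simp only [dr2_obs, h1]
      by_cases hA : V.A ω = a
      · have := h2 (hA ▸ W.a_mem_S)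
        rw [Population.ipwOutcome, ← this, Population.XAZ, hA]
      · simp [hA]
    rw [integral_congr_ae heq]
    exact Population.integral_augmented_of_nu hcons hign hpos a m hR
      (W.measurable_pA_comp measurable_const measurable_id a) (hi'.congr heq)
  · have hA := pA_eq_piA hreg.piA hc
    have heq : ∀ᵐ ω ∂P, W.dr2 (V.obs ω) θ = W.nu θ.2.1 (V.X ω, a) +
        (if V.A ω = a then (1 : ℝ) else 0) / V.piA (V.X ω) a *
          (V.ipwOutcome m ω - W.nu θ.2.1 (V.X ω, a)) := by
      filter_upwards [hA, hpM] with ω h1 h2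
      simp only [dr2_obs, h1]
      by_cases hA : V.A ω = a
      · have := h2 (hA ▸ W.a_mem_S)
        rw [Population.ipwOutcome, ← this, Population.XAZ, hA]
      · simp [hA]
    rw [integral_congr_ae heq]
    exact Population.integral_augmented_of_piA hcons hign hpos a m hR
      (ν := fun x => W.nu θ.2.1 (x, a))
      (W.measurable_nu_comp measurable_const (by fun_prop)) (hi'.congr heq)

/-- On `A = a` the bracket in `φ_3` is the response `R_4`, so the decompositions used for fitting
`ν` in the fourth estimator serve here too. -/
theorem integral_dr3_of_respMuM_eq (hcons : V.Consistency) (hign : V.SequentialIgnorability)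
    (hpos : V.Positivity) {θ : W.Par3} (hi : Integrable (fun o => W.dr3 o θ) V.law)
    (hpA : ∀ᵐ ω ∂P, W.pA θ.2.2 (V.X ω) a = V.piA (V.X ω) a) {R g D : Ω → ℝ}
    (hR : CondMeanZero V.sigmaXA P (fun ω => R ω - V.nuY m (V.XA ω)))
    (hm : V.sigmaXA ≤ m₂) (hm₂ : m₂ ≤ mΩ) (hg : StronglyMeasurable[m₂] g)
    (hD : CondMeanZero m₂ P D)
    (hu : ∀ᵐ ω ∂P, V.A ω ∈ W.S → W.respMuM θ.1 θ.2.1 (V.obs ω) = R ω + g ω * D ω) :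
    ∫ o, W.dr3 o θ ∂V.law = V.psi a m := by
  rw [integral_law hi.1]
  have heq : ∀ᵐ ω ∂P, W.dr3 (V.obs ω) θ = (if V.A ω = a then (1 : ℝ) else 0) /
      V.piA (V.X ω) a * (R ω + g ω * D ω) := by
    filter_upwards [hpA, hu] with ω h1 h2
    rw [dr3_obs, h1]
    by_cases hA : V.A ω = a
    · rw [← h2 (hA ▸ W.a_mem_S), respMuM_obs, hA]
    · rw [if_neg hA, zero_div, zero_mul, zero_mul]
  rw [integral_congr_ae heq]
  exact Population.integral_weighted_of_piA hcons hign hpos a m hR hm hm₂ hg hD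
    ((integrable_comp_obs hi).congr heq)

theorem integral_dr3 (hcons : V.Consistency) (hign : V.SequentialIgnorability)
    (hpos : V.Positivity) {θ : W.Par3} (hreg : W.Regular3 V.law θ) (hA : W.PiACorrect V)
    (hc : W.PiMCorrect V ∨ W.MuCorrect V) [IsFiniteMeasure V.law] :
    ∫ o, W.dr3 o θ ∂V.law = V.psi a m := by
  have hi : Integrable (fun o => W.dr3 o θ) V.law :=
    hreg.regular.memLp_target.integrable one_le_two
  have hpA := pA_eq_piA hreg.piA hA
  rcases hc with hc | hc
  · exact integral_dr3_of_respMuM_eq hcons hign hpos hi hpA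
      (Population.condMeanZero_ipwOutcome hcons hign hpos m) V.sigmaXA_le_sigmaXAZ V.sigmaXAZ_le
      (Population.stronglyMeasurable_comp_XAZ (measurable_neg_mu_div_piM _)) (V.condMeanZero_M m)
      (respMuM_eq_of_piM hpos θ.1 hreg.piM hc)
  · exact integral_dr3_of_respMuM_eq hcons hign hpos hi hpA
      (Population.condMeanZero_muYAt hcons hign hpos m)
      (V.sigmaXA_le_sigmaXAZ.trans V.sigmaXAZ_le_sigmaXAZM) V.sigmaXAZM_le
      (Population.stronglyMeasurable_comp_XAZM (measurable_ite_div_pM _))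
      (Population.condMeanZero_Y hcons) (respMuM_eq_of_mu hcons hpos θ.2.1 hreg.mu hc)

theorem integral_dr4 (hcons : V.Consistency) (hign : V.SequentialIgnorability)
    (hpos : V.Positivity) {θ : W.Par4} (hreg : W.Regular4 V.law θ) (hν : W.NuCorrect V)
    (hc : W.PiMCorrect V ∨ W.MuCorrect V) [IsFiniteMeasure V.law] :
    ∫ o, W.dr4 o θ ∂V.law = V.psi a m := by
  rw [integral_law (hreg.regular.memLp_target.integrable one_le_two).1,
    ← Population.integral_nuY hcons hign hpos a m]
  refine integral_congr_ae ?_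
  rcases hc with hc | hc
  · exact nu_eq_nuY hpos hreg.nu hν (Population.condMeanZero_ipwOutcome hcons hign hpos m)
      V.sigmaXA_le_sigmaXAZ V.sigmaXAZ_le
      (Population.stronglyMeasurable_comp_XAZ (measurable_neg_mu_div_piM _)) (V.condMeanZero_M m)
      (respMuM_eq_of_piM hpos θ.1 hreg.piM hc)
  · exact nu_eq_nuY hpos hreg.nu hν (Population.condMeanZero_muYAt hcons hign hpos m)
      (V.sigmaXA_le_sigmaXAZ.trans V.sigmaXAZ_le_sigmaXAZM) V.sigmaXAZM_le
      (Population.stronglyMeasurable_comp_XAZM (measurable_ite_div_pM _))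
      (Population.condMeanZero_Y hcons) (respMuM_eq_of_mu hcons hpos θ.2.1 hreg.mu hc)

end Limits

end WorkingModels

end CRF

/-! ### Assembly: general asymptotics applied to the four population means -/

theorem proposition1
    {Ω Ω' 𝒳 𝒜 𝒵 ℳ : Type*}
    [MeasurableSpace Ω] [StandardBorelSpace Ω] [MeasurableSpace Ω']
    [MeasurableSpace 𝒳]
    [Fintype 𝒜] [DecidableEq 𝒜] [Nonempty 𝒜] [MeasurableSpace 𝒜] [DiscreteMeasurableSpace 𝒜]
    [MeasurableSpace 𝒵] [StandardBorelSpace 𝒵] [Nonempty 𝒵]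
    [Fintype ℳ] [DecidableEq ℳ] [Nonempty ℳ] [MeasurableSpace ℳ] [DiscreteMeasurableSpace ℳ]
    (P : Measure Ω) [IsProbabilityMeasure P] (V : Population Ω 𝒳 𝒜 𝒵 ℳ P)
    (hcons : V.Consistency) (hign : V.SequentialIgnorability) (hpos : V.Positivity)
    (a : 𝒜) (m : ℳ) (W : WorkingModels 𝒳 𝒵 a m)
    (P' : Measure Ω') [IsProbabilityMeasure P'] (O : ℕ → Ω' → Obs 𝒳 𝒜 𝒵 ℳ)
    (hO : IsSample P' O V.law) :
    (∀ (θ : W.Par1) (θhat : ℕ → Ω' → W.Par1),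
      W.Regular1 V.law θ → IsZEstimator P' O W.system1 θhat θ →
      W.MuCorrect V → (W.NuCorrect V ∨ W.PiACorrect V) →
      IsCAN P' (plugIn O W.dr1 θhat) (V.psi a m)
        (asympVar V.law W.system1 W.dr1 (V.psi a m) θ)) ∧
    (∀ (θ : W.Par2) (θhat : ℕ → Ω' → W.Par2),
      W.Regular2 V.law θ → IsZEstimator P' O W.system2 θhat θ →
      W.PiMCorrect V → (W.NuCorrect V ∨ W.PiACorrect V) →
      IsCAN P' (plugIn O W.dr2 θhat) (V.psi a m)
        (asympVar V.law W.system2 W.dr2 (V.psi a m) θ)) ∧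
    (∀ (θ : W.Par3) (θhat : ℕ → Ω' → W.Par3),
      W.Regular3 V.law θ → IsZEstimator P' O W.system3 θhat θ →
      W.PiACorrect V → (W.PiMCorrect V ∨ W.MuCorrect V) →
      IsCAN P' (plugIn O W.dr3 θhat) (V.psi a m)
        (asympVar V.law W.system3 W.dr3 (V.psi a m) θ)) ∧
    (∀ (θ : W.Par4) (θhat : ℕ → Ω' → W.Par4),
      W.Regular4 V.law θ → IsZEstimator P' O W.system4 θhat θ →
      W.NuCorrect V → (W.PiMCorrect V ∨ W.MuCorrect V) →
      IsCAN P' (plugIn O W.dr4 θhat) (V.psi a m)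
        (asympVar V.law W.system4 W.dr4 (V.psi a m) θ)) := by
  have hlaw : IsProbabilityMeasure V.law := hO.isProbabilityMeasure
  refine ⟨fun θ θhat hreg hz h1 h2 => ?_, fun θ θhat hreg hz h1 h2 => ?_,
    fun θ θhat hreg hz h1 h2 => ?_, fun θ θhat hreg hz h1 h2 => ?_⟩
  · exact isCAN_plugIn hO W.measurable_system1 W.measurable_dr1 hreg.regular hz
      (WorkingModels.integral_dr1 hcons hign hpos hreg h1 h2)
  · exact isCAN_plugIn hO W.measurable_system2 W.measurable_dr2 hreg.regular hz
      (WorkingModels.integral_dr2 hcons hign hpos hreg h1 h2)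
  · exact isCAN_plugIn hO W.measurable_system3 W.measurable_dr3 hreg.regular hz
      (WorkingModels.integral_dr3 hcons hign hpos hreg h1 h2)
  · exact isCAN_plugIn hO W.measurable_system4 W.measurable_dr4 hreg.regular hz
      (WorkingModels.integral_dr4 hcons hign hpos hreg h1 h2)
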